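/- **Setting.** Let $d\ge 1$, $T\ge 2$ with $d\le\sqrt T$, and let $\mathcal A\subset\mathbb R^d$ be a finite set with full-dimensional affine hull. In each round $t=1,\dots,T$ an adversary (who may react to the past) fixes $\theta_t\in\mathbb R^d$ with $|\langle a,\theta_t\rangle|\le 1$ for all $a\in\mathcal A$ and a misspecification $\epsilon_t:\mathcal A\to\mathbb R$; the learner then draws $a_t\sim p_t\in\Delta(\mathcal A)$ and observes $r_t\in[-1,1]$ with $\mathbb E[r_t\mid \text{past},a_t]=\langle a_t,\theta_t\rangle+\epsilon_t(a_t)$. Let $C_\infty\ge 0$ be a number, known to the learner, with $\sum_{t=1}^T\max_{a\in\mathcal A}|\epsilon_t(a)|\le C_\infty$. For $p_\star\in\Delta(\mathcal A)$ let $\mathrm{Reg}_T(p_\star)=\sum_{t=1}^T\langle \mathbb E_{a\sim p_\star}[a]-a_t,\theta_t\rangle$. **Notation.** For $p\in\Delta(\mathcal A)$ put $\mu(p)=\mathbb E_{a\sim p}[a]$, $\mathrm{Cov}(p)=\mathbb E_{a\sim p}[(a-\mu(p))(a-\mu(p))^\top]$, $\Sigma(p)=\mathbb E_{a\sim p}[aa^\top]$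 and $$\widehat{\mathrm{Cov}}(p)=\begin{bmatrix}\mathrm{Cov}(p)+\mu(p)\mu(p)^\top&\mu(p)\\ \mu(p)^\top&1\end{bmatrix}.$$ Let $\rho\in\Delta(\mathcal A)$ be John's exploration over $\mathcal A$: if $\{x:(x-c)^\top M^{-1}(x-c)\le 1\}$ is the minimum-volume ellipsoid enclosing $\mathcal A$, then $\rho$ is supported on points of $\mathcal A$ on its boundary, $\sum_a\rho(a)(a-c)=0$ and $\sum_a\rho(a)(a-c)(a-c)^\top=\frac1d M$. Let $\gamma=d/\sqrt T$, $\Delta_\gamma(\mathcal A)=\{(1-\gamma)p'+\gamma\rho:\ p'\in\Delta(\mathcal A)\}$, $\mathcal H=\{\widehat{\mathrm{Cov}}(p):p\in\Delta_\gamma(\mathcal A)\}$, $G(\pmb H)=-\log\det\pmb H$ and $$\alpha=\max\Big\{\tfrac{C_\infty}{\sqrt{d\log T}},\sqrt T\Big\}.$$ For a positive semidefinite $B$ and a positive definite $\Sigma$, $\mathrm{Bonus}(B,\Sigma)=\Sigma^{-1}$ if $B\preceq\Sigma^{-1}$; otherwise $\mathrm{Bonus}(B,\Sigma)=B^{1/2}\big(\sum_{i}\max\{\lambda_i,1\}v_iv_i^\top\big)B^{1/2}$,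 where $B^{-1/2}\Sigma^{-1}B^{-1/2}=\sum_i\lambda_iv_iv_i^\top$ is an eigendecomposition with orthonormal $v_i$. **Algorithms.** Put $B_0=0$ and, for $t\ge1$, $\Sigma_t=\Sigma(p_t)$, $B_t=\mathrm{Bonus}(B_{t-1},\Sigma_t)$, $\hat\theta_t=\Sigma_t^{-1}a_tr_t$, where $p_t\in\Delta_\gamma(\mathcal A)$ is such that $\pmb H_t=\widehat{\mathrm{Cov}}(p_t)$ satisfies $$\pmb H_t\in\operatorname*{argmax}_{\pmb H\in\mathcal H}\big\{\eta\langle\pmb H,\pmb\Theta\rangle-G(\pmb H)\big\},\qquad \pmb\Theta=\begin{bmatrix}\alpha B&\frac12\sum_{s<t}\hat\theta_s\\ \frac12\sum_{s<t}\hat\theta_s^\top&0\end{bmatrix}.$$ * *Option I (fixed point):* $B=B_t$ (so $p_t$ and $B_t$ are determined jointly) and $\eta=\sqrt{\log T/T}$. * *Option II (standard FTRL):* $B=B_{t-1}$ and $\eta=\min\big\{\frac{\sqrt{\log T}}{16C_\infty},\frac1{16\sqrt T}\big\}$ (the first term is $+\infty$ if $C_\infty=0$). **Theorem.** There is an absolute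 constant $K$ such that, for every $\delta\in(0,1)$, with probability at least $1-\delta$, simultaneously for all $p_\star\in\Delta(\mathcal A)$, $$\mathrm{Reg}_T(p_\star)\le K\big(d\sqrt T\,\log(T/\delta)+C_\infty\sqrt{d\log T}\big)$$ if the learner follows Option I, and $$\mathrm{Reg}_T(p_\star)\le K\big(d\sqrt T\,\log(T/\delta)+d\,C_\infty\sqrt{\log T}\big)$$ if the learner follows Option II. -/

import Mathlib

open MeasureTheory ProbabilityTheory
open scoped Matrix

namespace LogDetBandit

noncomputable section

/-! ### Distributions over a finite action set and their (lifted) covariance matrices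

The action set is a finite set `A` of vectors; a distribution over `A` is a point of
`stdSimplex ℝ A`. -/

/-- `μ(p) = E_{a ∼ p}[a]`. -/
def mean {d : ℕ} {A : Finset (Fin d → ℝ)} (p : A → ℝ) : Fin d → ℝ :=
  ∑ a : A, p a • (a : Fin d → ℝ)

/-- `Σ(p) = E_{a ∼ p}[a aᵀ]`. -/
def secondMoment {d : ℕ} {A : Finset (Fin d → ℝ)} (p : A → ℝ) : Matrix (Fin d) (Fin d) ℝ :=
  ∑ a : A, p a • Matrix.vecMulVec (a : Fin d → ℝ) (a : Fin d → ℝ)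

/-- `Cov(p) = E_{a ∼ p}[(a - μ(p)) (a - μ(p))ᵀ]`. -/
def cov {d : ℕ} {A : Finset (Fin d → ℝ)} (p : A → ℝ) : Matrix (Fin d) (Fin d) ℝ :=
  ∑ a : A, p a • Matrix.vecMulVec ((a : Fin d → ℝ) - mean p) ((a : Fin d → ℝ) - mean p)

/-- The lifted covariance matrix: the symmetric `(d+1) × (d+1)` block matrix with blocks
`Cov(p) + μ(p) μ(p)ᵀ`, `μ(p)`, `μ(p)ᵀ` and `1`. -/
def liftedCov {d : ℕ} {A : Finset (Fin d → ℝ)} (p : A → ℝ) :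
    Matrix (Fin d ⊕ Unit) (Fin d ⊕ Unit) ℝ :=
  Matrix.fromBlocks (cov p + Matrix.vecMulVec (mean p) (mean p))
    (Matrix.replicateCol Unit (mean p)) (Matrix.replicateRow Unit (mean p)) 1

/-! ### John's exploration -/

/-- The ellipsoid `{x | (x - c)ᵀ M⁻¹ (x - c) ≤ 1}`. -/
def ellipsoid {d : ℕ} (c : Fin d → ℝ) (M : Matrix (Fin d) (Fin d) ℝ) : Set (Fin d → ℝ) :=
  {x | (x - c) ⬝ᵥ (M⁻¹ *ᵥ (x - c)) ≤ 1}

/-- `ellipsoid c M` is a minimum-volume ellipsoid enclosing `A`. -/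
structure IsMinVolumeEllipsoid {d : ℕ} (A : Finset (Fin d → ℝ)) (c : Fin d → ℝ)
    (M : Matrix (Fin d) (Fin d) ℝ) : Prop where
  posDef : M.PosDef
  encloses : (A : Set (Fin d → ℝ)) ⊆ ellipsoid c M
  minimal : ∀ (c' : Fin d → ℝ) (M' : Matrix (Fin d) (Fin d) ℝ), M'.PosDef →
    (A : Set (Fin d → ℝ)) ⊆ ellipsoid c' M' →
      volume (ellipsoid c M) ≤ volume (ellipsoid c' M')

/-- `ρ` is a John's exploration distribution over `A`: it is carried by the contact points of `A`
with the boundary of the minimum-volume enclosing ellipsoid `{x | (x - c)ᵀ M⁻¹ (x - c) ≤ 1}`, and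
its weights give the decomposition of John's theorem: `∑ ρ(a) (a - c) = 0` and
`∑ ρ(a) (a - c) (a - c)ᵀ = M / d`. -/
def IsJohnExploration {d : ℕ} (A : Finset (Fin d → ℝ)) (ρ : A → ℝ) : Prop :=
  ρ ∈ stdSimplex ℝ A ∧
  ∃ (c : Fin d → ℝ) (M : Matrix (Fin d) (Fin d) ℝ), IsMinVolumeEllipsoid A c M ∧
    (∀ a : A, ρ a ≠ 0 → ((a : Fin d → ℝ) - c) ⬝ᵥ (M⁻¹ *ᵥ ((a : Fin d → ℝ) - c)) = 1) ∧
    ∑ a : A, ρ a • ((a : Fin d → ℝ) - c) = 0 ∧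
    ∑ a : A, ρ a • Matrix.vecMulVec ((a : Fin d → ℝ) - c) ((a : Fin d → ℝ) - c)
      = (1 / (d : ℝ)) • M

/-! ### The ingredients of the algorithms -/

/-- `Δ_γ(A) = {(1 - γ) p' + γ ρ : p' ∈ Δ(A)}`. -/
def mixedSimplex {d : ℕ} {A : Finset (Fin d → ℝ)} (γ : ℝ) (ρ : A → ℝ) : Set (A → ℝ) :=
  {p | ∃ p' ∈ stdSimplex ℝ A, p = (1 - γ) • p' + γ • ρ}

/-- The feasible set of lifted covariance matrices of the elements of `Δ_γ(A)`. -/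
def feasibleSet {d : ℕ} {A : Finset (Fin d → ℝ)} (γ : ℝ) (ρ : A → ℝ) :
    Set (Matrix (Fin d ⊕ Unit) (Fin d ⊕ Unit) ℝ) :=
  liftedCov '' mixedSimplex γ ρ

/-- The log-determinant barrier `G(H) = - log det H`. -/
def logDetBarrier {d : ℕ} (H : Matrix (Fin d ⊕ Unit) (Fin d ⊕ Unit) ℝ) : ℝ :=
  - Real.log H.det

open Classical in
/-- The bonus function `Bonus(B, S)`, for `B` positive semidefinite and `S` positive definite:
it is `S⁻¹` if `B ⪯ S⁻¹`; otherwise it is `B^{1/2} (∑ᵢ max{λᵢ, 1} vᵢ vᵢᵀ) B^{1/2}`,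
where `∑ᵢ λᵢ vᵢ vᵢᵀ` is the eigendecomposition of `B^{-1/2} S⁻¹ B^{-1/2}`. Functions of symmetric
matrices are taken through the continuous functional calculus `cfc`, that is, on the
eigenvalues. -/
def bonus {d : ℕ} (B S : Matrix (Fin d) (Fin d) ℝ) : Matrix (Fin d) (Fin d) ℝ :=
  if (S⁻¹ - B).PosSemidef then S⁻¹
  else
    cfc Real.sqrt B *
      cfc (fun x : ℝ => max x 1) ((cfc Real.sqrt B)⁻¹ * S⁻¹ * (cfc Real.sqrt B)⁻¹) *
      cfc Real.sqrt B

/-- The bonus matrices `B_0 = 0`, `B_t = Bonus(B_{t-1}, Σ_t)` along a sequence of distributions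
`p_1, p_2, …`, with `Σ_t = Σ(p_t)`. -/
def bonusSeq {d : ℕ} {A : Finset (Fin d → ℝ)} (p : ℕ → A → ℝ) : ℕ → Matrix (Fin d) (Fin d) ℝ
  | 0 => 0
  | t + 1 => bonus (bonusSeq p t) (secondMoment (p (t + 1)))

/-- The reward estimator `θ̂ = Σ(p)⁻¹ a r`. -/
def estimator {d : ℕ} {A : Finset (Fin d → ℝ)} (p : A → ℝ) (a : A) (r : ℝ) : Fin d → ℝ :=
  r • ((secondMoment p)⁻¹ *ᵥ (a : Fin d → ℝ))

/-- The block matrix with blocks `α B`, `v / 2`, `vᵀ / 2` and `0`. -/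
def gainMatrix {d : ℕ} (α : ℝ) (B : Matrix (Fin d) (Fin d) ℝ) (v : Fin d → ℝ) :
    Matrix (Fin d ⊕ Unit) (Fin d ⊕ Unit) ℝ :=
  Matrix.fromBlocks (α • B) (Matrix.replicateCol Unit ((1 / 2 : ℝ) • v))
    (Matrix.replicateRow Unit ((1 / 2 : ℝ) • v)) 0

/-- The objective `η ⟨H, Θ⟩ - G(H)`. -/
def ftrlObjective {d : ℕ} (η : ℝ) (Θ H : Matrix (Fin d ⊕ Unit) (Fin d ⊕ Unit) ℝ) : ℝ :=
  η * (Hᵀ * Θ).trace - logDetBarrier H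

/-- `p` is an element of `Δ_γ(A)` whose lifted covariance matrix maximizes the objective
`η ⟨H, Θ⟩ - G(H)` over the feasible set. -/
def IsFTRLChoice {d : ℕ} {A : Finset (Fin d → ℝ)} (γ η : ℝ) (ρ : A → ℝ)
    (Θ : Matrix (Fin d ⊕ Unit) (Fin d ⊕ Unit) ℝ) (p : A → ℝ) : Prop :=
  p ∈ mixedSimplex γ ρ ∧ IsMaxOn (ftrlObjective η Θ) (feasibleSet γ ρ) (liftedCov p)

/-! ### The two algorithms

A trajectory consists of distributions `p_t`, actions `a_t` and rewards `r_t`, `t = 1, …, T`. -/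

/-- First algorithm: the bonus used in round `t` is `B_t`, which itself depends on `p_t`, so that
`p_t`, `Σ_t` and `B_t` solve a joint fixed-point condition. -/
def FollowsFixedPointFTRL {d : ℕ} {A : Finset (Fin d → ℝ)} (T : ℕ) (γ α η : ℝ) (ρ : A → ℝ)
    (p : ℕ → A → ℝ) (a : ℕ → A) (r : ℕ → ℝ) : Prop :=
  ∀ t ∈ Finset.Icc 1 T,
    IsFTRLChoice γ η ρ
      (gainMatrix α (bonusSeq p t) (∑ s ∈ Finset.Ico 1 t, estimator (p s) (a s) (r s))) (p t)

/-- Second algorithm (standard FTRL): the bonus used in round `t` is `B_{t-1}`. -/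
def FollowsStandardFTRL {d : ℕ} {A : Finset (Fin d → ℝ)} (T : ℕ) (γ α η : ℝ) (ρ : A → ℝ)
    (p : ℕ → A → ℝ) (a : ℕ → A) (r : ℕ → ℝ) : Prop :=
  ∀ t ∈ Finset.Icc 1 T,
    IsFTRLChoice γ η ρ
      (gainMatrix α (bonusSeq p (t - 1)) (∑ s ∈ Finset.Ico 1 t, estimator (p s) (a s) (r s)))
      (p t)

/-- `γ = d / √T`. -/
def mixRate (d T : ℕ) : ℝ := d / √(T : ℝ)

/-- `α = max{C / √(d log T), √T}`. -/
def bonusRate (d T : ℕ) (C : ℝ) : ℝ := max (C / √(d * Real.log T)) √(T : ℝ)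

/-- `η = √(log T / T)`, the learning rate of the first algorithm. -/
def learningRate (T : ℕ) : ℝ := √(Real.log T / T)

/-- `η = min{√(log T) / (16 C), 1 / (16 √T)}` (the first term being `+∞` if `C = 0`), the learning
rate of the second algorithm, written so that nothing is divided by `C`. -/
def learningRateStandard (T : ℕ) (C : ℝ) : ℝ := 1 / (16 * max (C / √(Real.log T)) √(T : ℝ))

/-! ### The interaction with the adversary, and the regret -/

/-- `T` rounds of a misspecified adversarial linear bandit with total misspecification at most `C`.
`ℱ t` is the information generated up to the end of round `t`, together with what the adversary
has fixed for round `t + 1`. In round `t = 1, …, T` the adversary fixes `θ_t` and the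
misspecification `ε_t : A → ℝ`, possibly depending on the past; the learner draws `a_t ∼ p_t`, and
receives `r_t ∈ [-1, 1]` with conditional mean `⟨a_t, θ_t⟩ + ε_t(a_t)`. -/
structure IsMisspecifiedBandit {Ω : Type*} [mΩ : MeasurableSpace Ω] (P : Measure Ω)
    (ℱ : Filtration ℕ mΩ) {d : ℕ} {A : Finset (Fin d → ℝ)} (T : ℕ) (C : ℝ)
    (θ : ℕ → Ω → Fin d → ℝ) (ε : ℕ → Ω → A → ℝ)
    (p : ℕ → Ω → A → ℝ) (a : ℕ → Ω → A) (r : ℕ → Ω → ℝ) : Prop where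
  measurable_theta : ∀ t ∈ Finset.Icc 1 T, Measurable[ℱ (t - 1)] (θ t)
  measurable_eps : ∀ t ∈ Finset.Icc 1 T, Measurable[ℱ (t - 1)] (ε t)
  measurable_dist : ∀ t ∈ Finset.Icc 1 T, Measurable[ℱ (t - 1)] (p t)
  measurable_action : ∀ t ∈ Finset.Icc 1 T, Measurable[ℱ t] (a t)
  measurable_reward : ∀ t ∈ Finset.Icc 1 T, Measurable[ℱ t] (r t)
  abs_inner_le : ∀ t ∈ Finset.Icc 1 T, ∀ ω, ∀ x ∈ A, |x ⬝ᵥ θ t ω| ≤ 1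
  abs_reward_le : ∀ t ∈ Finset.Icc 1 T, ∀ ω, |r t ω| ≤ 1
  misspecification_le : ∀ ω, ∑ t ∈ Finset.Icc 1 T, ⨆ x : A, |ε t ω x| ≤ C
  action_law : ∀ t ∈ Finset.Icc 1 T, ∀ x : A,
    P⟦a t ⁻¹' {x} | ℱ (t - 1)⟧ =ᵐ[P] fun ω => p t ω x
  reward_mean : ∀ t ∈ Finset.Icc 1 T,
    P[r t | ℱ (t - 1) ⊔ MeasurableSpace.comap (a t) inferInstance] =ᵐ[P]
      fun ω => (a t ω : Fin d → ℝ) ⬝ᵥ θ t ω + ε t ω (a t ω)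

/-- The regret `Reg_T(p⋆) = ∑_{t=1}^T ⟨E_{x ∼ p⋆}[x] - a_t, θ_t⟩` against the comparator `p⋆`. -/
def regret {d : ℕ} {A : Finset (Fin d → ℝ)} (T : ℕ) (θ : ℕ → Fin d → ℝ) (a : ℕ → A)
    (pstar : A → ℝ) : ℝ :=
  ∑ t ∈ Finset.Icc 1 T, (mean pstar - (a t : Fin d → ℝ)) ⬝ᵥ θ t

end

end LogDetBandit

/-! Moving the comparator into the mixed simplex costs at most 2γT = 2d√T. There every lifted action
satisfies (a,1)(a,1)ᵀ ⪯ β·`liftedCov p` with β = 2√T (`IsSpread`), which controls all estimators,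
variances and log-determinant ratios.

The regret is the estimated regret plus the deviation of the true rewards from the estimated ones.
Misspecification biases the estimate toward an action x in round t by a multiple of max|ε_t|·(1 +
‖x‖), the norm being that of Σ_t⁻¹, which can be large. The bonus repairs this. The matrix B_T
dominates every Σ_t⁻¹, so with X = xᵀB_T x the total bias is at most αX/4 + O(α + C²/α), and the
variance adds at most αX/2 + O(d√T). FTRL with bonuses credits αX, averaged over the comparator, and
absorbs both. The price is 2α∑tr(Σ_t(B_t − B_{t−1})), which telescopes through log det B_t to O(αd
log T) (`isBonusStep_bonus`, `sum_trace_bonus_le`); the choice of α balances it against C²/α.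

The estimated regret follows from a be-the-leader induction (`regret_le_of_step`). A maximizer of
linear + log det beats each competitor by a Bregman divergence (`le_sub_logDetDiv_of_isMax`), and
that divergence pays for the change of objective within a round (`trace_sub_trace_le_logDetDiv`). In
Option I the maximized objective already contains B_t, so only the reward estimate needs stability.
In Option II the bonus increment needs it too, which forces ηα ≤ 1/4; the smaller η turns the term d
log T/η into dC√(log T).

The deviation is controlled by an exponential supermartingale for each point of a net of actions
with at most (4T²+1)^d points (`compensator_le`, `sum_deviation_le`), so the union bound costs O(d
log T) whatever the size of A. Averaging over actions then covers all comparators at once. -/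

namespace LogDetBandit

/-! ### Log-determinant inequalities for real matrices. -/

section MatrixLemmas

variable {n : Type*} [Fintype n]

theorem posSemidef_iff_real {M : Matrix n n ℝ} (hM : Mᵀ = M) :
    M.PosSemidef ↔ ∀ x, 0 ≤ x ⬝ᵥ (M *ᵥ x) := by
  rw [Matrix.posSemidef_iff_dotProduct_mulVec]
  simp [Matrix.IsHermitian, Matrix.conjTranspose_eq_transpose_of_trivial, hM]

theorem _root_.Matrix.PosSemidef.transpose_eq {m : Type*} {M : Matrix m m ℝ} (hM : M.PosSemidef) : Mᵀ = M := by
  simpa [Matrix.IsHermitian, Matrix.conjTranspose_eq_transpose_of_trivial] using hM.1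

theorem _root_.Matrix.PosSemidef.quad_nonneg {M : Matrix n n ℝ} (hM : M.PosSemidef) (x : n → ℝ) :
    0 ≤ x ⬝ᵥ (M *ᵥ x) := by
  simpa using hM.dotProduct_mulVec_nonneg x

theorem _root_.Matrix.PosDef.transpose_eq {m : Type*} {M : Matrix m m ℝ} (hM : M.PosDef) : Mᵀ = M :=
  hM.posSemidef.transpose_eq

theorem _root_.Matrix.PosDef.quad_pos {M : Matrix n n ℝ} (hM : M.PosDef) {x : n → ℝ}
    (hx : x ≠ 0) : 0 < x ⬝ᵥ (M *ᵥ x) := by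
  simpa using hM.dotProduct_mulVec_pos hx

theorem posDef_of_quad_pos {M : Matrix n n ℝ} (hM : Mᵀ = M)
    (h : ∀ x, x ≠ 0 → 0 < x ⬝ᵥ (M *ᵥ x)) : M.PosDef := by
  refine Matrix.PosDef.of_dotProduct_mulVec_pos ?_ fun x hx => by simpa using h x hx
  simpa [Matrix.IsHermitian, Matrix.conjTranspose_eq_transpose_of_trivial] using hM

theorem posSemidef_conj {M Q : Matrix n n ℝ} (hM : M.PosSemidef) (hQ : Qᵀ = Q) :
    (Q * M * Q).PosSemidef := by
  have := hM.conjTranspose_mul_mul_same Q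
  rwa [Matrix.conjTranspose_eq_transpose_of_trivial, hQ] at this

variable [DecidableEq n]

theorem det_cfc {X : Matrix n n ℝ} (hX : X.IsHermitian) (f : ℝ → ℝ) :
    (cfc f X).det = ∏ i, f (hX.eigenvalues i) := by
  rw [hX.cfc_eq, Matrix.IsHermitian.cfc, Unitary.conjStarAlgAut_apply, Matrix.det_mul_comm,
    ← mul_assoc]
  simp [Matrix.det_diagonal]

theorem trace_cfc {X : Matrix n n ℝ} (hX : X.IsHermitian) (f : ℝ → ℝ) :
    (cfc f X).trace = ∑ i, f (hX.eigenvalues i) := by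
  rw [hX.cfc_eq, Matrix.IsHermitian.cfc, Unitary.conjStarAlgAut_apply, Matrix.trace_mul_comm,
    ← mul_assoc]
  simp [Matrix.trace_diagonal]

theorem log_det_le_trace_sub_card {M : Matrix n n ℝ} (hM : M.PosDef) :
    Real.log M.det ≤ M.trace - Fintype.card n := by
  have h1 := hM.1.det_eq_prod_eigenvalues
  have h2 := hM.1.trace_eq_sum_eigenvalues
  simp only [RCLike.ofReal_real_eq_id, id] at h1 h2
  rw [h1, h2, Real.log_prod (fun i _ => (hM.eigenvalues_pos i).ne')]
  calc _ ≤ ∑ i, (hM.1.eigenvalues i - 1) :=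
        Finset.sum_le_sum fun i _ => Real.log_le_sub_one_of_pos (hM.eigenvalues_pos i)
    _ = _ := by simp

/-- A positive definite matrix has a positive definite square root. -/
theorem exists_posDef_mul_self {M : Matrix n n ℝ} (hM : M.PosDef) :
    ∃ Q : Matrix n n ℝ, Q.PosDef ∧ Qᵀ = Q ∧ M = Q * Q ∧ Q = cfc Real.sqrt M := by
  have hc : ∀ f : ℝ → ℝ, ContinuousOn f (spectrum ℝ M) := fun f => by
    have : Finite (spectrum ℝ M) := inferInstance
    exact (Set.toFinite (spectrum ℝ M)).continuousOn f
  have hsa : IsSelfAdjoint M := hM.1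
  have hsq : cfc Real.sqrt M * cfc Real.sqrt M = M := by
    rw [← cfc_mul _ _ M (hc _) (hc _)]
    nth_rw 2 [← cfc_id ℝ M hsa]
    refine cfc_congr fun x hx => ?_
    rw [hM.1.spectrum_real_eq_range_eigenvalues] at hx
    obtain ⟨i, rfl⟩ := hx
    exact Real.mul_self_sqrt (hM.eigenvalues_pos i).le
  have hherm : (cfc Real.sqrt M).IsHermitian := cfc_predicate _ _
  -- Positivity of the root: it is the square of the symmetric fourth root.
  have hfour : cfc Real.sqrt M = (cfc (fun x => √(√x)) M)ᴴ * cfc (fun x => √(√x)) M := by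
    have : (cfc (fun x : ℝ => √(√x)) M).IsHermitian := cfc_predicate _ _
    rw [this.eq, ← cfc_mul _ _ M (hc _) (hc _)]
    exact cfc_congr fun x hx => (Real.mul_self_sqrt (Real.sqrt_nonneg x)).symm
  have hpsd : (cfc Real.sqrt M).PosSemidef := by
    rw [hfour]; exact Matrix.posSemidef_conjTranspose_mul_self _
  refine ⟨cfc Real.sqrt M, ?_, ?_, hsq.symm, rfl⟩
  · rw [hpsd.posDef_iff_det_ne_zero]
    intro h
    have := congrArg Matrix.det hsq
    rw [Matrix.det_mul, h] at this
    simp only [mul_zero] at this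
    exact hM.det_pos.ne this
  · exact hpsd.transpose_eq

theorem posDef_conj {M Q : Matrix n n ℝ} (hM : M.PosDef) (hQ : Q.PosDef) : (Q * M * Q).PosDef := by
  have := hM.conjTranspose_mul_mul_same (B := Q)
    (Matrix.mulVec_injective_iff_isUnit.2 hQ.isUnit)
  rwa [hQ.1.eq] at this

/-- Fenchel–Young inequality for −log det: apply log x ≤ x − 1 to the eigenvalues of M^{1/2} N
M^{1/2}. -/
theorem log_det_add_log_det_le {M N : Matrix n n ℝ} (hM : M.PosDef) (hN : N.PosDef) :
    Real.log M.det + Real.log N.det ≤ (M * N).trace - Fintype.card n := by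
  obtain ⟨Q, hQ, -, rfl, -⟩ := exists_posDef_mul_self hM
  have h := log_det_le_trace_sub_card (posDef_conj hN hQ)
  have h1 : (Q * N * Q).det = (Q * Q).det * N.det := by simp only [Matrix.det_mul]; ring
  have h2 : (Q * N * Q).trace = (Q * Q * N).trace := by
    rw [Matrix.trace_mul_comm, mul_assoc]
  rwa [h1, h2, Real.log_mul hM.det_pos.ne' hN.det_pos.ne'] at h

theorem trace_mul_nonneg {M N : Matrix n n ℝ} (hM : M.PosDef) (hN : N.PosSemidef) :
    0 ≤ (M * N).trace := by
  obtain ⟨Q, hQ, hQt, rfl, -⟩ := exists_posDef_mul_self hM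
  have h := (posSemidef_conj hN hQt).trace_nonneg
  rwa [Matrix.trace_mul_comm, ← mul_assoc] at h

/-- Monotonicity of `log det` along the Loewner order, with a scaling. -/
theorem log_det_le_of_sub_posSemidef {M N : Matrix n n ℝ} (hM : M.PosDef) (hN : N.PosDef) {c : ℝ}
    (hc : 0 < c) (h : (c • N - M).PosSemidef) :
    Real.log M.det ≤ Fintype.card n * Real.log c + Real.log N.det := by
  have h1 : (c⁻¹ • N⁻¹).PosDef := hN.inv.smul (inv_pos.2 hc)
  have h2 := log_det_add_log_det_le hM h1
  have h3 := trace_mul_nonneg h1 h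
  have h4 : (c⁻¹ • N⁻¹ * (c • N - M)).trace = Fintype.card n - (M * (c⁻¹ • N⁻¹)).trace := by
    rw [mul_sub, Matrix.trace_sub, Matrix.smul_mul, Matrix.mul_smul, smul_smul,
      inv_mul_cancel₀ hc.ne', one_smul, Matrix.nonsing_inv_mul _ hN.det_pos.ne'.isUnit,
      Matrix.trace_one, Matrix.trace_mul_comm M]
  have h5 : Real.log (c⁻¹ • N⁻¹).det = - (Fintype.card n * Real.log c) - Real.log N.det := by
    rw [Matrix.det_smul, Matrix.det_nonsing_inv, Ring.inverse_eq_inv', Real.log_mul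
      (pow_pos (inv_pos.2 hc) _).ne' (inv_pos.2 hN.det_pos).ne', Real.log_pow, Real.log_inv,
      Real.log_inv]
    ring
  linarith

theorem one_sub_eigenvalues {X : Matrix n n ℝ} (hX : X.IsHermitian) :
    1 - X = cfc (fun x : ℝ => 1 - x) X ∧ X * X = cfc (fun x : ℝ => x * x) X := by
  have hsa : IsSelfAdjoint X := hX
  constructor
  · rw [cfc_sub (R := ℝ) (fun _ => 1) (fun x => x) X, cfc_const_one ℝ X, cfc_id' ℝ X]
  · rw [cfc_mul (R := ℝ) (fun x => x) (fun x => x) X, cfc_id' ℝ X]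

/-- One-sided: x may be arbitrarily negative. For this reason the stability lemmas only need an
upper bound on the perturbation. -/
theorem neg_log_one_sub_le {x : ℝ} (hx : x ≤ 1 / 2) : - Real.log (1 - x) ≤ x + x * x := by
  have h1 : 0 < 1 - x := by linarith
  have h2 : 1 - x ≥ Real.exp (-(x + x * x)) := by
    rcases le_total (x + x * x) 1 with h | h
    · rcases le_total (-1) (x + x * x) with h' | h'
      · rcases le_total 0 x with h0 | h0
        · rw [Real.exp_neg, ge_iff_le, inv_le_comm₀ (Real.exp_pos _) h1]
          refine le_trans ?_ (Real.quadratic_le_exp_of_nonneg (by nlinarith))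
          rw [inv_le_iff_one_le_mul₀ h1]
          have h3 : 0 ≤ (1 - x) / 2 - 1 / 4 := by linarith
          have h4 : 0 ≤ x ^ 2 * (1 + x) ^ 2 := by positivity
          nlinarith [mul_nonneg h3 h4, mul_nonneg (sq_nonneg x) (sq_nonneg (1 - x))]
        · rcases le_total (-1) x with h3 | h3
          · have h4 : |(-(x + x * x))| ≤ 1 := abs_le.2 ⟨by linarith, by linarith⟩
            have h5 := (abs_le.1 (Real.abs_exp_sub_one_sub_id_le h4)).2
            nlinarith [mul_nonneg (neg_nonneg.2 h0) (mul_self_nonneg x), mul_nonneg (mul_self_nonneg x) (by linarith : 0 ≤ 1 + x), mul_nonneg (mul_self_nonneg x) (neg_nonneg.2 h0), mul_self_nonneg (x+1)]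
          · have : Real.exp (-(x + x * x)) ≤ 1 := by
              apply Real.exp_le_one_iff.2; nlinarith
            linarith
      · nlinarith [sq_nonneg (x + 1 / 2)]
    · rcases le_total 0 x with h0 | h0
      · nlinarith
      · have : Real.exp (-(x + x * x)) ≤ 1 := by
          apply Real.exp_le_one_iff.2; nlinarith
        linarith
  have := Real.log_le_log (Real.exp_pos _) h2
  rw [Real.log_exp] at this
  linarith

theorem eigenvalues_le_of_quad_le {X : Matrix n n ℝ} (hX : X.IsHermitian) {c : ℝ}
    (h : ∀ z, z ⬝ᵥ (X *ᵥ z) ≤ c * (z ⬝ᵥ z)) (i : n) : hX.eigenvalues i ≤ c := by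
  set v : n → ℝ := (hX.eigenvectorBasis i).ofLp
  have h1 := h v
  rw [hX.mulVec_eigenvectorBasis, dotProduct_smul, smul_eq_mul] at h1
  have hv : v ≠ 0 := by
    intro h0
    have := hX.eigenvectorBasis.orthonormal.ne_zero i
    apply this
    ext j
    exact congrFun h0 j
  have : 0 < v ⬝ᵥ v := by
    rcases (Finset.sum_nonneg fun j _ => mul_self_nonneg (v j)).lt_or_eq with h | h
    · exact h
    · exact absurd (dotProduct_self_eq_zero.1 h.symm) hv
  exact le_of_mul_le_mul_right h1 this

theorem log_det_one_sub_ge {X : Matrix n n ℝ} (hX : X.IsHermitian)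
    (h : ∀ z, z ⬝ᵥ (X *ᵥ z) ≤ (1 / 2) * (z ⬝ᵥ z)) :
    (1 - X).PosDef ∧ - X.trace - (X * X).trace ≤ Real.log (1 - X).det := by
  have he := eigenvalues_le_of_quad_le hX h
  obtain ⟨h1, h2⟩ := one_sub_eigenvalues hX
  constructor
  · refine posDef_of_quad_pos ?_ fun z hz => ?_
    · rw [Matrix.transpose_sub, Matrix.transpose_one]
      congr 1
    · rw [Matrix.sub_mulVec, Matrix.one_mulVec, dotProduct_sub]
      have : 0 < z ⬝ᵥ z := by
        rcases (Finset.sum_nonneg fun j _ => mul_self_nonneg (z j)).lt_or_eq with h | h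
        · exact h
        · exact absurd (dotProduct_self_eq_zero.1 h.symm) hz
      linarith [h z]
  · have h3 := hX.trace_eq_sum_eigenvalues
    simp only [RCLike.ofReal_real_eq_id, id] at h3
    rw [h1, h2, det_cfc hX, trace_cfc hX, h3, Real.log_prod (fun i _ => by linarith [he i]),
      ← Finset.sum_neg_distrib, ← Finset.sum_sub_distrib]
    exact Finset.sum_le_sum fun i _ => by linarith [neg_log_one_sub_le (he i)]

end MatrixLemmas

/-! ### The Bregman divergence of the log-determinant: stability and optimality. -/

section Divergence

variable {n : Type*} [Fintype n]

theorem dotProduct_mulVec_comm {M : Matrix n n ℝ} (hM : Mᵀ = M) (v w : n → ℝ) :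
    v ⬝ᵥ (M *ᵥ w) = w ⬝ᵥ (M *ᵥ v) := by
  rw [Matrix.dotProduct_mulVec, ← Matrix.mulVec_transpose, hM, dotProduct_comm]

theorem quad_conj {Q M : Matrix n n ℝ} (hQ : Qᵀ = Q) (z : n → ℝ) :
    z ⬝ᵥ ((Q * M * Q) *ᵥ z) = (Q *ᵥ z) ⬝ᵥ (M *ᵥ (Q *ᵥ z)) := by
  rw [← Matrix.mulVec_mulVec, ← Matrix.mulVec_mulVec, Matrix.dotProduct_mulVec z,
    ← Matrix.mulVec_transpose, hQ]

theorem sq_dotProduct_mulVec_le {H : Matrix n n ℝ} (hH : H.PosSemidef) (v w : n → ℝ) :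
    (v ⬝ᵥ (H *ᵥ w)) ^ 2 ≤ (v ⬝ᵥ (H *ᵥ v)) * (w ⬝ᵥ (H *ᵥ w)) := by
  have h : ∀ t : ℝ, 0 ≤ (w ⬝ᵥ (H *ᵥ w)) * (t * t) + (2 * (v ⬝ᵥ (H *ᵥ w))) * t
      + v ⬝ᵥ (H *ᵥ v) := by
    intro t
    have := hH.quad_nonneg (v + t • w)
    simp only [Matrix.mulVec_add, Matrix.mulVec_smul, dotProduct_add, add_dotProduct,
      dotProduct_smul, smul_dotProduct, smul_eq_mul] at this
    rw [dotProduct_mulVec_comm hH.transpose_eq w v] at this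
    linarith
  have := discrim_le_zero h
  unfold discrim at this
  linarith

variable [DecidableEq n]

theorem inv_mulVec_mulVec {H : Matrix n n ℝ} (hH : H.PosDef) (v : n → ℝ) :
    H *ᵥ (H⁻¹ *ᵥ v) = v := by
  rw [Matrix.mulVec_mulVec, Matrix.mul_nonsing_inv _ hH.det_pos.ne'.isUnit, Matrix.one_mulVec]

/-- Cauchy–Schwarz between the norms of H⁻¹ and H. -/
theorem sq_dotProduct_le {H : Matrix n n ℝ} (hH : H.PosDef) (v w : n → ℝ) :
    (v ⬝ᵥ w) ^ 2 ≤ (v ⬝ᵥ (H⁻¹ *ᵥ v)) * (w ⬝ᵥ (H *ᵥ w)) := by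
  have h := sq_dotProduct_mulVec_le hH.posSemidef (H⁻¹ *ᵥ v) w
  rw [inv_mulVec_mulVec hH, dotProduct_comm (H⁻¹ *ᵥ v) v,
    dotProduct_mulVec_comm hH.transpose_eq, inv_mulVec_mulVec hH, dotProduct_comm w v] at h
  exact h

/-- Inversion reverses the Loewner order: test M ⪯ cN at N⁻¹y and use Cauchy–Schwarz for the pair
M⁻¹, M. -/
theorem quad_inv_le {M N : Matrix n n ℝ} (hM : M.PosDef) (hN : N.PosDef) {c : ℝ}
    (h : ∀ v, v ⬝ᵥ (M *ᵥ v) ≤ c * (v ⬝ᵥ (N *ᵥ v))) (y : n → ℝ) :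
    y ⬝ᵥ (N⁻¹ *ᵥ y) ≤ c * (y ⬝ᵥ (M⁻¹ *ᵥ y)) := by
  have h1 := sq_dotProduct_le hM y (N⁻¹ *ᵥ y)
  have h2 := h (N⁻¹ *ᵥ y)
  rw [inv_mulVec_mulVec hN, dotProduct_comm (N⁻¹ *ᵥ y) y] at h2
  have h3 := hM.inv.posSemidef.quad_nonneg y
  rcases (hN.inv.posSemidef.quad_nonneg y).eq_or_lt with h4 | h4
  · rcases eq_or_ne y 0 with rfl | hy
    · simp
    · exact absurd h4 (hN.inv.quad_pos hy).ne
  · refine le_of_mul_le_mul_right ?_ h4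
    nlinarith [mul_le_mul_of_nonneg_left h2 h3]

/-- The Bregman divergence of the log-determinant barrier. -/
noncomputable def logDetDiv (H' H : Matrix n n ℝ) : ℝ :=
  (H⁻¹ * H').trace - Fintype.card n - Real.log H'.det + Real.log H.det

theorem trace_inv_conj {Q M N : Matrix n n ℝ} (hQ : Q.PosDef) :
    (Q⁻¹ * M * Q⁻¹ * (Q * N * Q)).trace = (M * N).trace := by
  have hu := hQ.det_pos.ne'.isUnit
  have : Q⁻¹ * M * Q⁻¹ * (Q * N * Q) = Q⁻¹ * (M * N * Q) := by
    rw [show Q⁻¹ * M * Q⁻¹ * (Q * N * Q) = Q⁻¹ * M * (Q⁻¹ * Q) * N * Q by noncomm_ring,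
      Matrix.nonsing_inv_mul _ hu]
    noncomm_ring
  rw [this, Matrix.trace_mul_comm, mul_assoc, Matrix.mul_nonsing_inv _ hu, mul_one]

theorem log_det_inv_conj {Q M : Matrix n n ℝ} (hQ : Q.PosDef) (hM : M.PosDef) :
    Real.log (Q⁻¹ * M * Q⁻¹).det = Real.log M.det - Real.log (Q * Q).det := by
  rw [Matrix.det_mul, Matrix.det_mul, Matrix.det_nonsing_inv, Ring.inverse_eq_inv', Matrix.det_mul,
    Real.log_mul (mul_pos (inv_pos.2 hQ.det_pos) hM.det_pos).ne' (inv_pos.2 hQ.det_pos).ne',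
    Real.log_mul (inv_pos.2 hQ.det_pos).ne' hM.det_pos.ne', Real.log_inv,
    Real.log_mul hQ.det_pos.ne' hQ.det_pos.ne']
  ring

theorem trace_inv_conj_self {Q M : Matrix n n ℝ} :
    (Q⁻¹ * M * Q⁻¹).trace = ((Q * Q)⁻¹ * M).trace := by
  rw [Matrix.trace_mul_comm, ← mul_assoc, Matrix.mul_inv_rev]

theorem quad_mul_self_inv {Q : Matrix n n ℝ} (hQ : Q.PosDef) (z : n → ℝ) :
    (Q *ᵥ z) ⬝ᵥ ((Q * Q)⁻¹ *ᵥ (Q *ᵥ z)) = z ⬝ᵥ z := by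
  have hu := hQ.det_pos.ne'.isUnit
  rw [← quad_conj hQ.transpose_eq, Matrix.mul_inv_rev,
    show Q * (Q⁻¹ * Q⁻¹) * Q = (Q * Q⁻¹) * (Q⁻¹ * Q) by noncomm_ring,
    Matrix.mul_nonsing_inv _ hu, Matrix.nonsing_inv_mul _ hu, one_mul, Matrix.one_mulVec]

/-- Stability of the log-determinant barrier under a small linear perturbation. -/
theorem trace_sub_trace_le_logDetDiv {H H' N : Matrix n n ℝ} (hH : H.PosDef) (hH' : H'.PosDef)
    (hN : Nᵀ = N) (h : ∀ z, z ⬝ᵥ (N *ᵥ z) ≤ (1 / 2) * (z ⬝ᵥ (H⁻¹ *ᵥ z))) :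
    (H' * N).trace - (H * N).trace ≤ logDetDiv H' H + (N * H * (N * H)).trace := by
  obtain ⟨Q, hQ, hQt, rfl, -⟩ := exists_posDef_mul_self hH
  have hX : (Q * N * Q).IsHermitian := by
    simp [Matrix.IsHermitian, Matrix.conjTranspose_eq_transpose_of_trivial, hN, hQt, mul_assoc]
  obtain ⟨h1, h2⟩ := log_det_one_sub_ge hX fun z => by
    rw [quad_conj hQt, ← quad_mul_self_inv hQ z]; exact h _
  -- Fenchel–Young for Q⁻¹H'Q⁻¹ and 1 − QNQ: the first matrix produces the divergence, the second
  -- the linear and quadratic terms in N.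
  have h3 := log_det_add_log_det_le (posDef_conj hH' hQ.inv) h1
  rw [log_det_inv_conj hQ hH', mul_sub, mul_one, Matrix.trace_sub, trace_inv_conj hQ,
    trace_inv_conj_self] at h3
  have h4 : (Q * N * Q).trace = (Q * Q * N).trace := by rw [Matrix.trace_mul_comm, mul_assoc]
  have h5 : (Q * N * Q * (Q * N * Q)).trace = (N * (Q * Q) * (N * (Q * Q))).trace := by
    rw [show Q * N * Q * (Q * N * Q) = Q * (N * Q * (Q * N * Q)) by noncomm_ring,
      Matrix.trace_mul_comm]
    congr 1; noncomm_ring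
  unfold logDetDiv
  linarith

/-- A maximizer of `ℓ + log det` along a segment satisfies the first-order optimality condition,
in the form of a quadratic-growth inequality. -/
theorem le_sub_logDetDiv_of_isMax {H H' : Matrix n n ℝ} (hH : H.PosDef) (hH' : H'.PosDef)
    (l : Matrix n n ℝ →ₗ[ℝ] ℝ)
    (h : ∀ s : ℝ, 0 < s → s ≤ 1 → l (H + s • (H' - H)) + Real.log (H + s • (H' - H)).det
      ≤ l H + Real.log H.det) :
    l H' + Real.log H'.det ≤ l H + Real.log H.det - logDetDiv H' H := by
  obtain ⟨Q, hQ, hQt, rfl, -⟩ := exists_posDef_mul_self hH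
  have hu := hQ.det_pos.ne'.isUnit
  set Y := Q⁻¹ * H' * Q⁻¹ with hY
  have hYp : Y.PosDef := posDef_conj hH' hQ.inv
  have hYt := hYp.transpose_eq
  set X := 1 - Y with hXd
  have hXt : Xᵀ = X := by rw [hXd, Matrix.transpose_sub, hYt, Matrix.transpose_one]
  -- In coordinates where H is the identity, the segment is 1 − sX with X ⪯ 1, so sX ⪯ 1/2.
  -- Expanding log det to second order and dividing by s leaves an error of order s, and s → 0 gives
  -- first-order optimality without derivatives.
  have key : ∀ s : ℝ, 0 < s → s ≤ 1 / 2 → l H' - l (Q * Q) ≤ X.trace + s * (X * X).trace := by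
    intro s hs hs2
    have hXs : (s • X).IsHermitian := by
      simp [Matrix.IsHermitian, Matrix.conjTranspose_eq_transpose_of_trivial, hXt]
    obtain ⟨h1, h2⟩ := log_det_one_sub_ge hXs fun z => by
      rw [Matrix.smul_mulVec, dotProduct_smul, smul_eq_mul, hXd, Matrix.sub_mulVec,
        Matrix.one_mulVec, dotProduct_sub]
      have h3 := hYp.posSemidef.quad_nonneg z
      have h4 : 0 ≤ z ⬝ᵥ z := Finset.sum_nonneg fun j _ => mul_self_nonneg (z j)
      nlinarith
    have h5 : Q * Q + s • (H' - Q * Q) = Q * (1 - s • X) * Q := by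
      have : H' = Q * Y * Q := by
        rw [hY, show Q * (Q⁻¹ * H' * Q⁻¹) * Q = (Q * Q⁻¹) * H' * (Q⁻¹ * Q) by noncomm_ring,
          Matrix.mul_nonsing_inv _ hu, Matrix.nonsing_inv_mul _ hu, one_mul, mul_one]
      rw [this, hXd]
      simp only [mul_sub, sub_mul, mul_one, Matrix.mul_smul, Matrix.smul_mul, smul_sub]
      abel
    have h6 := h s hs (by linarith)
    have h7 : Real.log (Q * (1 - s • X) * Q).det
        = Real.log (1 - s • X).det + Real.log (Q * Q).det := by
      rw [← Real.log_mul h1.det_pos.ne' hH.det_pos.ne']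
      simp only [Matrix.det_mul]; congr 1; ring
    rw [map_add, map_smul, map_sub, h5, h7, smul_eq_mul] at h6
    rw [Matrix.trace_smul, Matrix.smul_mul, Matrix.mul_smul, Matrix.trace_smul, Matrix.trace_smul,
      smul_eq_mul, smul_eq_mul, smul_eq_mul] at h2
    refine le_of_mul_le_mul_left ?_ hs
    linarith
  have h1 : l H' - l (Q * Q) ≤ X.trace := by
    refine le_of_forall_pos_le_add fun e he => ?_
    have h2 : 0 < |(X * X).trace| + 1 := by positivity
    have h3 := key (min (1 / 2) (e / (|(X * X).trace| + 1)))
      (lt_min (by norm_num) (div_pos he h2)) (min_le_left _ _)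
    refine h3.trans (add_le_add le_rfl ?_)
    calc _ ≤ min (1 / 2) (e / (|(X * X).trace| + 1)) * (|(X * X).trace| + 1) := by
          refine mul_le_mul_of_nonneg_left (by linarith [le_abs_self (X * X).trace]) ?_
          exact le_min (by norm_num) (div_pos he h2).le
      _ ≤ e / (|(X * X).trace| + 1) * (|(X * X).trace| + 1) :=
          mul_le_mul_of_nonneg_right (min_le_right _ _) h2.le
      _ = e := div_mul_cancel₀ _ h2.ne'
  have h2 : X.trace = Fintype.card n - ((Q * Q)⁻¹ * H').trace := by
    rw [hXd, Matrix.trace_sub, Matrix.trace_one, hY, trace_inv_conj_self]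
  unfold logDetDiv
  linarith

end Divergence

/-! ### Moments of distributions over the actions, and spread distributions. -/

section Moments

variable {d : ℕ} {A : Finset (Fin d → ℝ)}

theorem quad_vecMulVec {n : Type*} [Fintype n] (u v w : n → ℝ) :
    v ⬝ᵥ (Matrix.vecMulVec u u *ᵥ w) = (v ⬝ᵥ u) * (w ⬝ᵥ u) := by
  rw [Matrix.vecMulVec_mulVec, dotProduct_smul, dotProduct_comm u w]
  simp

theorem secondMoment_bilin (p : A → ℝ) (v w : Fin d → ℝ) :
    v ⬝ᵥ (secondMoment p *ᵥ w) = ∑ a : A, p a * ((v ⬝ᵥ a) * (w ⬝ᵥ a)) := by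
  simp only [secondMoment, Matrix.sum_mulVec, dotProduct_sum, Matrix.smul_mulVec, dotProduct_smul,
    quad_vecMulVec, smul_eq_mul]

theorem secondMoment_transpose (p : A → ℝ) : (secondMoment p)ᵀ = secondMoment p := by
  simp only [secondMoment, Matrix.transpose_sum, Matrix.transpose_smul, Matrix.transpose_vecMulVec]

theorem dotProduct_mean (p : A → ℝ) (v : Fin d → ℝ) : v ⬝ᵥ mean p = ∑ a : A, p a * (v ⬝ᵥ a) := by
  simp only [mean, dotProduct_sum, dotProduct_smul, smul_eq_mul]

theorem mean_dotProduct (p : A → ℝ) (v : Fin d → ℝ) : mean p ⬝ᵥ v = ∑ a : A, p a * (a.1 ⬝ᵥ v) := by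
  simp only [mean, sum_dotProduct, smul_dotProduct, smul_eq_mul]

/-- The lift `(a, 1)` of a vector. -/
def liftVec (a : Fin d → ℝ) : Fin d ⊕ Unit → ℝ := Sum.elim a fun _ => 1

theorem cov_add_mean {p : A → ℝ} (hp : ∑ a, p a = 1) :
    cov p + Matrix.vecMulVec (mean p) (mean p) = secondMoment p := by
  ext i j
  have hm : ∀ i, mean p i = ∑ a : A, p a * a.1 i := fun i => by simp [mean]
  simp only [cov, secondMoment, Matrix.add_apply, Matrix.sum_apply, Matrix.smul_apply,
    Matrix.vecMulVec_apply, Pi.sub_apply, smul_eq_mul]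
  have : ∀ a : A, p a * ((a.1 i - mean p i) * (a.1 j - mean p j)) = p a * (a.1 i * a.1 j)
      - (p a * a.1 i) * mean p j - (p a * a.1 j) * mean p i + p a * (mean p i * mean p j) := by
    intro a; ring
  simp only [this, Finset.sum_add_distrib, Finset.sum_sub_distrib, ← Finset.sum_mul, hp, ← hm]
  ring

/-- The lifted covariance is the uncentred second moment of (a, 1). In this form it is affine in p,
so the feasible set is convex. -/
theorem liftedCov_eq {p : A → ℝ} (hp : ∑ a, p a = 1) :
    liftedCov p = ∑ a : A, p a • Matrix.vecMulVec (liftVec a.1) (liftVec a.1) := by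
  rw [liftedCov, cov_add_mean hp]
  ext (i | i) (j | j)
  · simp [liftVec, secondMoment, Matrix.sum_apply, Matrix.vecMulVec_apply]
  · simp [liftVec, mean, Matrix.sum_apply, Matrix.vecMulVec_apply]
  · simp [liftVec, mean, Matrix.sum_apply, Matrix.vecMulVec_apply]
  · simp [liftVec, Matrix.sum_apply, Matrix.vecMulVec_apply, hp, -Finset.univ_eq_attach]

theorem liftedCov_quad {p : A → ℝ} (hp : ∑ a, p a = 1) (z : Fin d ⊕ Unit → ℝ) :
    z ⬝ᵥ (liftedCov p *ᵥ z) = ∑ a : A, p a * (z ⬝ᵥ liftVec a.1) ^ 2 := by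
  simp only [liftedCov_eq hp, Matrix.sum_mulVec, dotProduct_sum, Matrix.smul_mulVec,
    dotProduct_smul, quad_vecMulVec, smul_eq_mul, sq]

theorem liftedCov_transpose {p : A → ℝ} (hp : ∑ a, p a = 1) : (liftedCov p)ᵀ = liftedCov p := by
  simp only [liftedCov_eq hp, Matrix.transpose_sum, Matrix.transpose_smul,
    Matrix.transpose_vecMulVec]

theorem dotProduct_liftVec (z : Fin d ⊕ Unit → ℝ) (a : Fin d → ℝ) :
    z ⬝ᵥ liftVec a = (z ∘ Sum.inl) ⬝ᵥ a + z (Sum.inr ()) := by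
  simp [dotProduct, liftVec]

theorem liftedCov_convexCombo {p q : A → ℝ} (hp : ∑ a, p a = 1) (hq : ∑ a, q a = 1) (s : ℝ) :
    liftedCov ((1 - s) • p + s • q) = liftedCov p + s • (liftedCov q - liftedCov p) := by
  have h : ∑ a, ((1 - s) • p + s • q) a = 1 := by
    simp [Finset.sum_add_distrib, ← Finset.mul_sum, hp, hq, -Finset.univ_eq_attach]
  rw [liftedCov_eq h, liftedCov_eq hp, liftedCov_eq hq, ← Finset.sum_sub_distrib, Finset.smul_sum,
    ← Finset.sum_add_distrib]
  refine Finset.sum_congr rfl fun a _ => ?_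
  simp only [Pi.add_apply, Pi.smul_apply, smul_eq_mul]
  module

/-- A distribution whose lifted covariance dominates every lifted action up to the factor `β`. -/
structure IsSpread (β : ℝ) (p : A → ℝ) : Prop where
  mem : p ∈ stdSimplex ℝ A
  posDef : (liftedCov p).PosDef
  sq_le : ∀ (a : A) (z : Fin d ⊕ Unit → ℝ),
    (z ⬝ᵥ liftVec a.1) ^ 2 ≤ β * ∑ b : A, p b * (z ⬝ᵥ liftVec b.1) ^ 2

/-- In coordinates centred at c, the lifted covariance of ρ is block diagonal with blocks M/d and 1.
Since A lies in the ellipsoid, a lifted action has squared dual norm at most d + 1. -/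
theorem IsJohnExploration.isSpread {ρ : A → ℝ} (hd : 1 ≤ d) (h : IsJohnExploration A ρ) :
    IsSpread (d + 1) ρ := by
  obtain ⟨hρ, c, M, hM, -, h1, h2⟩ := h
  have hd0 : (0 : ℝ) < d := by exact_mod_cast hd
  have hquad : ∀ z : Fin d ⊕ Unit → ℝ, ∑ b : A, ρ b * (z ⬝ᵥ liftVec b.1) ^ 2
      = (z ∘ Sum.inl) ⬝ᵥ (M *ᵥ (z ∘ Sum.inl)) / d
        + ((z ∘ Sum.inl) ⬝ᵥ c + z (Sum.inr ())) ^ 2 := by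
    intro z
    set y := z ∘ Sum.inl
    set w := y ⬝ᵥ c + z (Sum.inr ()) with hw
    have e1 : ∑ b : A, ρ b * (y ⬝ᵥ (b.1 - c)) = 0 := by
      have := congrArg (fun v => y ⬝ᵥ v) h1
      simpa only [dotProduct_sum, dotProduct_smul, smul_eq_mul, dotProduct_zero] using this
    have e2 : ∑ b : A, ρ b * (y ⬝ᵥ (b.1 - c)) ^ 2 = y ⬝ᵥ (M *ᵥ y) / d := by
      have := congrArg (fun N : Matrix (Fin d) (Fin d) ℝ => y ⬝ᵥ (N *ᵥ y)) h2
      simp only [Matrix.sum_mulVec, dotProduct_sum, Matrix.smul_mulVec, dotProduct_smul,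
        quad_vecMulVec, smul_eq_mul, ← sq] at this
      rw [this]; ring
    have e3 : ∀ b : A, ρ b * (z ⬝ᵥ liftVec b.1) ^ 2 = ρ b * (y ⬝ᵥ (b.1 - c)) ^ 2
        + 2 * w * (ρ b * (y ⬝ᵥ (b.1 - c))) + ρ b * w ^ 2 := by
      intro b
      rw [dotProduct_liftVec, dotProduct_sub, hw]; ring
    simp only [e3, Finset.sum_add_distrib, ← Finset.mul_sum, ← Finset.sum_mul, e1, e2, hρ.2]
    ring
  refine ⟨hρ, posDef_of_quad_pos (liftedCov_transpose hρ.2) fun z hz => ?_, fun a z => ?_⟩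
  · rw [liftedCov_quad hρ.2, hquad]
    by_cases hy : z ∘ Sum.inl = 0
    · rw [hy]
      have : z (Sum.inr ()) ≠ 0 := by
        intro h0
        apply hz
        ext (i | i)
        · exact congrFun hy i
        · exact h0
      simp only [Matrix.mulVec_zero, zero_dotProduct, zero_div, zero_add]
      positivity
    · have := hM.posDef.quad_pos hy
      positivity
  · rw [hquad, dotProduct_liftVec]
    set y := z ∘ Sum.inl
    set w := y ⬝ᵥ c + z (Sum.inr ()) with hw
    have h3 := sq_dotProduct_le hM.posDef (a.1 - c) y
    have h4 : (a.1 - c) ⬝ᵥ (M⁻¹ *ᵥ (a.1 - c)) ≤ 1 := hM.encloses a.2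
    have h5 := hM.posDef.posSemidef.quad_nonneg y
    set u := (a.1 - c) ⬝ᵥ y with hu
    have h6 : u ^ 2 ≤ y ⬝ᵥ (M *ᵥ y) := h3.trans (by nlinarith)
    have h7 : y ⬝ᵥ a.1 + z (Sum.inr ()) = u + w := by
      rw [hu, hw, sub_dotProduct, dotProduct_comm y a.1, dotProduct_comm y c]; ring
    rw [h7]
    have h8 : u ^ 2 / d ≤ y ⬝ᵥ (M *ᵥ y) / d := by gcongr
    -- Cauchy–Schwarz with weights d and 1.
    have h9 : (u + w) ^ 2 ≤ (d + 1) * (u ^ 2 / d + w ^ 2) := by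
      have : (d + 1) * (u ^ 2 / d + w ^ 2) - (u + w) ^ 2 = (u - d * w) ^ 2 / d := by
        field_simp; ring
      have : 0 ≤ (u - d * w) ^ 2 / d := by positivity
      linarith
    refine h9.trans ?_
    gcongr

theorem mixedSimplex_subset {γ : ℝ} {ρ : A → ℝ} (h0 : 0 ≤ γ) (h1 : γ ≤ 1)
    (hρ : ρ ∈ stdSimplex ℝ A) {p : A → ℝ} (hp : p ∈ mixedSimplex γ ρ) : p ∈ stdSimplex ℝ A := by
  obtain ⟨p', hp', rfl⟩ := hp
  exact convex_stdSimplex ℝ A hp' hρ (by linarith) h0 (by ring)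

theorem mixedSimplex_convexCombo {γ : ℝ} {ρ : A → ℝ} {p q : A → ℝ} (hp : p ∈ mixedSimplex γ ρ)
    (hq : q ∈ mixedSimplex γ ρ) {s : ℝ} (h0 : 0 ≤ s) (h1 : s ≤ 1) :
    (1 - s) • p + s • q ∈ mixedSimplex γ ρ := by
  obtain ⟨p', hp', rfl⟩ := hp
  obtain ⟨q', hq', rfl⟩ := hq
  refine ⟨(1 - s) • p' + s • q', convex_stdSimplex ℝ A hp' hq' (by linarith) h0 (by ring), ?_⟩
  module

theorem IsSpread.of_mem_mixedSimplex {γ β : ℝ} {ρ : A → ℝ} (h0 : 0 < γ) (h1 : γ ≤ 1) (hβ : 0 ≤ β)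
    (hρ : IsSpread β ρ) {p : A → ℝ} (hp : p ∈ mixedSimplex γ ρ) : IsSpread (β / γ) p := by
  have hps := mixedSimplex_subset h0.le h1 hρ.mem hp
  have key : ∀ z : Fin d ⊕ Unit → ℝ, γ * ∑ b : A, ρ b * (z ⬝ᵥ liftVec b.1) ^ 2
      ≤ ∑ b : A, p b * (z ⬝ᵥ liftVec b.1) ^ 2 := by
    obtain ⟨p', hp', rfl⟩ := hp
    intro z
    rw [Finset.mul_sum]
    refine Finset.sum_le_sum fun b _ => ?_
    simp only [Pi.add_apply, Pi.smul_apply, smul_eq_mul]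
    have : 0 ≤ (1 - γ) * p' b * (z ⬝ᵥ liftVec b.1) ^ 2 :=
      mul_nonneg (mul_nonneg (by linarith) (hp'.1 b)) (sq_nonneg _)
    linarith
  refine ⟨hps, posDef_of_quad_pos (liftedCov_transpose hps.2) fun z hz => ?_, fun a z => ?_⟩
  · have := hρ.posDef.quad_pos hz
    rw [liftedCov_quad hρ.mem.2] at this
    rw [liftedCov_quad hps.2]
    exact (mul_pos h0 this).trans_le (key z)
  · refine (hρ.sq_le a z).trans ?_
    have := key z
    rw [div_mul_eq_mul_div, le_div_iff₀ h0]
    calc _ = β * (γ * ∑ b : A, ρ b * (z ⬝ᵥ liftVec b.1) ^ 2) := by ring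
      _ ≤ _ := mul_le_mul_of_nonneg_left this hβ

namespace IsSpread

variable {β : ℝ} {p : A → ℝ} (hp : IsSpread β p)

include hp

theorem sq_le' (a : A) (y : Fin d → ℝ) :
    (y ⬝ᵥ a.1) ^ 2 ≤ β * (y ⬝ᵥ (secondMoment p *ᵥ y)) := by
  have := hp.sq_le a (Sum.elim y fun _ => 0)
  simp only [dotProduct_liftVec, Sum.elim_comp_inl, Sum.elim_inr, add_zero] at this
  rw [secondMoment_bilin]
  simpa only [← sq] using this

theorem secondMoment_posDef : (secondMoment p).PosDef := by
  refine posDef_of_quad_pos (secondMoment_transpose p) fun y hy => ?_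
  have := hp.posDef.quad_pos (x := Sum.elim y fun _ => 0) (fun h => hy (by
    ext i; exact congrFun h (Sum.inl i)))
  rw [liftedCov_quad hp.mem.2] at this
  simp only [dotProduct_liftVec, Sum.elim_comp_inl, Sum.elim_inr, add_zero] at this
  rw [secondMoment_bilin]
  simpa only [← sq] using this

theorem quad_lifted_le {p' : A → ℝ} (hp' : p' ∈ stdSimplex ℝ A) (z : Fin d ⊕ Unit → ℝ) :
    z ⬝ᵥ (liftedCov p' *ᵥ z) ≤ β * (z ⬝ᵥ (liftedCov p *ᵥ z)) := by
  rw [liftedCov_quad hp'.2, liftedCov_quad hp.mem.2]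
  calc _ ≤ ∑ a : A, p' a * (β * ∑ b : A, p b * (z ⬝ᵥ liftVec b.1) ^ 2) :=
        Finset.sum_le_sum fun a _ => mul_le_mul_of_nonneg_left (hp.sq_le a z) (hp'.1 a)
    _ = _ := by rw [← Finset.sum_mul, hp'.2, one_mul]

theorem quad_secondMoment_le {p' : A → ℝ} (hp' : p' ∈ stdSimplex ℝ A) (y : Fin d → ℝ) :
    y ⬝ᵥ (secondMoment p' *ᵥ y) ≤ β * (y ⬝ᵥ (secondMoment p *ᵥ y)) := by
  rw [secondMoment_bilin]
  calc _ ≤ ∑ a : A, p' a * (β * (y ⬝ᵥ (secondMoment p *ᵥ y))) :=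
        Finset.sum_le_sum fun a _ => mul_le_mul_of_nonneg_left
          (by rw [← sq]; exact hp.sq_le' a y) (hp'.1 a)
    _ = _ := by rw [← Finset.sum_mul, hp'.2, one_mul]

/-- Testing the spread inequality at y = Σ⁻¹a gives t² ≤ βt for t = aᵀΣ⁻¹a. -/
theorem quad_inv_action_le (a : A) : a.1 ⬝ᵥ ((secondMoment p)⁻¹ *ᵥ a.1) ≤ β := by
  have h := hp.sq_le' a ((secondMoment p)⁻¹ *ᵥ a.1)
  rw [inv_mulVec_mulVec hp.secondMoment_posDef, dotProduct_comm] at h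
  rcases (hp.secondMoment_posDef.inv.posSemidef.quad_nonneg a.1).eq_or_lt with h0 | h0
  · rw [← h0]
    -- If t = 0 it remains to see that β ≥ 0; the lifted test vector (0, 1) even gives β ≥ 1.
    by_contra hβ
    have h1 := hp.sq_le a (Sum.elim 0 fun _ => 1)
    have : ∑ b : A, p b * ((Sum.elim (0 : Fin d → ℝ) fun _ => (1 : ℝ)) ⬝ᵥ liftVec b.1) ^ 2 = 1 := by
      simp [dotProduct_liftVec, hp.mem.2, -Finset.univ_eq_attach]
    rw [this, dotProduct_liftVec] at h1
    simp at h1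
    linarith
  · nlinarith

theorem sum_quad_inv : ∑ a : A, p a * (a.1 ⬝ᵥ ((secondMoment p)⁻¹ *ᵥ a.1)) = d := by
  have h : ((secondMoment p)⁻¹ * secondMoment p).trace = d := by
    rw [Matrix.nonsing_inv_mul _ hp.secondMoment_posDef.det_pos.ne'.isUnit]; simp
  rw [← h]
  nth_rw 3 [secondMoment]
  simp only [Matrix.mul_sum, Matrix.trace_sum, Matrix.mul_smul, Matrix.trace_smul, smul_eq_mul,
    Matrix.mul_vecMulVec, Matrix.trace_vecMulVec]
  exact Finset.sum_congr rfl fun a _ => by rw [dotProduct_comm]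

/-- Unbiasedness of the estimator: E[Σ⁻¹ a aᵀ w] = w. -/
theorem sum_mul_inner_inv (v w : Fin d → ℝ) :
    ∑ a : A, p a * ((v ⬝ᵥ ((secondMoment p)⁻¹ *ᵥ a.1)) * (a.1 ⬝ᵥ w)) = v ⬝ᵥ w := by
  have ht := hp.secondMoment_posDef.inv.transpose_eq
  have h := secondMoment_bilin p ((secondMoment p)⁻¹ *ᵥ v) w
  rw [dotProduct_mulVec_comm (secondMoment_transpose p), inv_mulVec_mulVec hp.secondMoment_posDef,
    dotProduct_comm] at h
  rw [h]
  refine Finset.sum_congr rfl fun a _ => ?_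
  rw [dotProduct_comm a.1 w, dotProduct_mulVec_comm ht, dotProduct_comm a.1]

theorem sum_sq_inner_inv (v : Fin d → ℝ) :
    ∑ a : A, p a * (v ⬝ᵥ ((secondMoment p)⁻¹ *ᵥ a.1)) ^ 2
      = v ⬝ᵥ ((secondMoment p)⁻¹ *ᵥ v) := by
  rw [← hp.sum_mul_inner_inv v]
  refine Finset.sum_congr rfl fun a _ => ?_
  rw [dotProduct_mulVec_comm hp.secondMoment_posDef.inv.transpose_eq a.1 v, sq]

/-- With v = Σ⁻¹μ and t = μᵀv, Jensen gives t² = (E v·a)² ≤ E(v·a)² = t. -/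
theorem quad_inv_mean_le : mean p ⬝ᵥ ((secondMoment p)⁻¹ *ᵥ mean p) ≤ 1 := by
  have hS := hp.secondMoment_posDef
  have h1 : (mean p ⬝ᵥ ((secondMoment p)⁻¹ *ᵥ mean p)) ^ 2
      ≤ mean p ⬝ᵥ ((secondMoment p)⁻¹ *ᵥ mean p) := by
    set v := (secondMoment p)⁻¹ *ᵥ mean p with hv
    have h2 : mean p ⬝ᵥ v = v ⬝ᵥ (secondMoment p *ᵥ v) := by
      rw [hv, inv_mulVec_mulVec hS, dotProduct_comm]
    nth_rw 2 [h2]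
    rw [dotProduct_comm, dotProduct_mean, secondMoment_bilin]
    have hj := (even_two.convexOn_pow : ConvexOn ℝ Set.univ fun x : ℝ => x ^ 2).map_sum_le
      (t := Finset.univ) (w := p) (p := fun a : A => v ⬝ᵥ a.1) (fun a _ => hp.mem.1 a) hp.mem.2
      (fun a _ => Set.mem_univ _)
    simpa only [smul_eq_mul, ← sq] using hj
  nlinarith

end IsSpread

end Moments

/-! ### The bonus recursion and its log-determinant potential. -/

section Bonus

theorem posSemidef_cfc {n : Type*} [Fintype n] [DecidableEq n] (X : Matrix n n ℝ) {f : ℝ → ℝ}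
    (hf : ∀ x ∈ spectrum ℝ X, 0 ≤ f x) : (cfc f X).PosSemidef := by
  have hc : ∀ g : ℝ → ℝ, ContinuousOn g (spectrum ℝ X) := fun g =>
    (Set.toFinite (spectrum ℝ X)).continuousOn g
  have hs : (cfc (fun x => √(f x)) X).IsHermitian := cfc_predicate _ _
  have : cfc f X = (cfc (fun x => √(f x)) X)ᴴ * cfc (fun x => √(f x)) X := by
    rw [hs.eq, ← cfc_mul _ _ X (hc _) (hc _)]
    exact cfc_congr fun x hx => (Real.mul_self_sqrt (hf x hx)).symm
  rw [this]
  exact Matrix.posSemidef_conjTranspose_mul_self _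

/-- The matrix `max(K, 1)`, taken on the eigenvalues of `K`. -/
theorem cfc_max_one_spec {n : Type*} [Fintype n] [DecidableEq n] {K : Matrix n n ℝ}
    (hK : K.PosDef) {m : Matrix n n ℝ} (hm : m = cfc (fun x : ℝ => max x 1) K) :
    (m - K).PosSemidef ∧ (m - 1).PosSemidef ∧ (1 + K - m).PosSemidef ∧
      (m - K) * (m - 1) = 0 := by
  subst hm
  have hc : ∀ g : ℝ → ℝ, ContinuousOn g (spectrum ℝ K) := fun g =>
    (Set.toFinite (spectrum ℝ K)).continuousOn g
  have hsa : IsSelfAdjoint K := hK.1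
  have e1 : cfc (fun x : ℝ => max x 1) K - K = cfc (fun x : ℝ => max x 1 - x) K := by
    rw [cfc_sub _ _ K (hc _) (hc _), cfc_id' ℝ K]
  have e2 : cfc (fun x : ℝ => max x 1) K - 1 = cfc (fun x : ℝ => max x 1 - 1) K := by
    rw [cfc_sub _ _ K (hc _) (hc _), cfc_const_one ℝ K]
  have e3 : 1 + K - cfc (fun x : ℝ => max x 1) K = cfc (fun x : ℝ => 1 + x - max x 1) K := by
    rw [cfc_sub _ _ K (hc _) (hc _), cfc_add _ _ (a := K) (hf := hc _) (hg := hc _),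
      cfc_const_one ℝ K, cfc_id' ℝ K]
  rw [e3, e1, e2]
  refine ⟨posSemidef_cfc K fun x _ => by linarith [le_max_left x 1],
    posSemidef_cfc K fun x _ => by linarith [le_max_right x 1], posSemidef_cfc K fun x hx => ?_, ?_⟩
  · rw [hK.1.spectrum_real_eq_range_eigenvalues] at hx
    obtain ⟨i, rfl⟩ := hx
    have := hK.eigenvalues_pos i
    rcases max_cases (hK.1.eigenvalues i) 1 with h | h <;> linarith [h.1]
  · rw [← cfc_mul _ _ K (hc _) (hc _), ← cfc_const_zero ℝ K]
    refine cfc_congr fun x _ => ?_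
    rcases max_cases x 1 with h | h <;> simp [h.1]

/-- The defining properties of one step `B ↦ B' = Bonus(B, S)` of the bonus recursion. -/
structure IsBonusStep {d : ℕ} (B S B' : Matrix (Fin d) (Fin d) ℝ) : Prop where
  posDef : B'.PosDef
  sub_posSemidef : (B' - B).PosSemidef
  inv_le : ∀ y, y ⬝ᵥ (S⁻¹ *ᵥ y) ≤ y ⬝ᵥ (B' *ᵥ y)
  sub_le : ∀ y, y ⬝ᵥ ((B' - B) *ᵥ y) ≤ y ⬝ᵥ (S⁻¹ *ᵥ y)

theorem bonus_zero {d : ℕ} {S : Matrix (Fin d) (Fin d) ℝ} (hS : S.PosDef) : bonus 0 S = S⁻¹ := by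
  rw [bonus, if_pos]
  simpa using hS.inv.posSemidef

theorem isBonusStep_zero {d : ℕ} {S : Matrix (Fin d) (Fin d) ℝ} (hS : S.PosDef) :
    IsBonusStep 0 S (bonus 0 S) := by
  rw [bonus_zero hS]
  exact ⟨hS.inv, by simpa using hS.inv.posSemidef, fun y => le_rfl, fun y => by simp⟩

/-- The bonus is a least costly upper bound of B and S⁻¹. In coordinates where B is the identity it
is m = max(K, 1), K being the image of S⁻¹. The cost tr(S(B' − B)) becomes tr(1 − m⁻¹) ≤ log det m,
the increase of the potential. -/
theorem isBonusStep_bonus {d : ℕ} {B S : Matrix (Fin d) (Fin d) ℝ} (hB : B.PosDef)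
    (hS : S.PosDef) :
    IsBonusStep B S (bonus B S) ∧
      (S * (bonus B S - B)).trace ≤ Real.log (bonus B S).det - Real.log B.det := by
  have hSu := hS.det_pos.ne'.isUnit
  by_cases hle : (S⁻¹ - B).PosSemidef
  · rw [bonus, if_pos hle]
    refine ⟨⟨hS.inv, hle, fun y => le_rfl, fun y => ?_⟩, ?_⟩
    · rw [Matrix.sub_mulVec, dotProduct_sub]
      linarith [hB.posSemidef.quad_nonneg y]
    · have h1 := log_det_add_log_det_le hS hB
      rw [mul_sub, Matrix.mul_nonsing_inv _ hSu, Matrix.trace_sub, Matrix.trace_one,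
        Matrix.det_nonsing_inv, Ring.inverse_eq_inv', Real.log_inv]
      linarith
  · rw [bonus, if_neg hle]
    obtain ⟨Q, hQ, hQt, hBQ, hQc⟩ := exists_posDef_mul_self hB
    rw [← hQc]
    have hu := hQ.det_pos.ne'.isUnit
    set K := Q⁻¹ * S⁻¹ * Q⁻¹ with hK
    have hKp : K.PosDef := posDef_conj hS.inv hQ.inv
    set m := cfc (fun x : ℝ => max x 1) K with hm
    obtain ⟨h1, h2, h3, h4⟩ := cfc_max_one_spec hKp hm
    have hmp : m.PosDef := by
      have := Matrix.PosDef.one.add_posSemidef h2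
      rwa [add_sub_cancel] at this
    have hQK : Q * K * Q = S⁻¹ := by
      rw [hK, show Q * (Q⁻¹ * S⁻¹ * Q⁻¹) * Q = (Q * Q⁻¹) * S⁻¹ * (Q⁻¹ * Q) by noncomm_ring,
        Matrix.mul_nonsing_inv _ hu, Matrix.nonsing_inv_mul _ hu, one_mul, mul_one]
    have e1 : Q * m * Q - B = Q * (m - 1) * Q := by rw [hBQ]; noncomm_ring
    have e2 : Q * m * Q - S⁻¹ = Q * (m - K) * Q := by rw [← hQK]; noncomm_ring
    have e3 : S⁻¹ - (Q * m * Q - B) = Q * (1 + K - m) * Q := by rw [hBQ, ← hQK]; noncomm_ring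
    refine ⟨⟨posDef_conj hmp hQ, ?_, fun y => ?_, fun y => ?_⟩, ?_⟩
    · rw [e1]; exact posSemidef_conj h2 hQt
    · have := (posSemidef_conj h1 hQt).quad_nonneg y
      rw [← e2, Matrix.sub_mulVec, dotProduct_sub] at this
      linarith
    · have := (posSemidef_conj h3 hQt).quad_nonneg y
      rw [← e3, Matrix.sub_mulVec, dotProduct_sub] at this
      linarith
    · have hKu := hKp.det_pos.ne'.isUnit
      have hmu := hmp.det_pos.ne'.isUnit
      -- Complementary slackness (m − K)(m − 1) = 0 allows K to be replaced by m wherever m ≠ 1.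
      have e4 : K⁻¹ * (m - 1) = 1 - m⁻¹ := by
        have e5 : (m - 1) * m = K * (m - 1) := by
          have : m * (m - 1) = K * (m - 1) := by rwa [sub_mul, sub_eq_zero] at h4
          rw [← this]; noncomm_ring
        calc K⁻¹ * (m - 1) = K⁻¹ * ((m - 1) * m) * m⁻¹ := by
              rw [mul_assoc, mul_assoc (m - 1), Matrix.mul_nonsing_inv _ hmu, mul_one]
          _ = K⁻¹ * K * (m - 1) * m⁻¹ := by rw [e5]; noncomm_ring
          _ = 1 - m⁻¹ := by
              rw [Matrix.nonsing_inv_mul _ hKu, one_mul, sub_mul, Matrix.mul_nonsing_inv _ hmu,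
                one_mul]
      have e6 : (S * (Q * m * Q - B)).trace = (1 - m⁻¹).trace := by
        have hKi : K⁻¹ = Q * S * Q := by
          rw [hK, Matrix.mul_inv_rev, Matrix.mul_inv_rev, Matrix.nonsing_inv_nonsing_inv _ hu,
            Matrix.nonsing_inv_nonsing_inv _ hSu, mul_assoc]
        rw [← e4, hKi, e1, ← Matrix.trace_mul_comm, ← Matrix.trace_mul_comm (m - 1)]
        rw [show Q * (m - 1) * Q * S = Q * ((m - 1) * (Q * S)) by noncomm_ring,
          Matrix.trace_mul_comm]
        congr 1; noncomm_ring
      have h5 := log_det_le_trace_sub_card hmp.inv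
      have h6 : (Q * m * Q).det = m.det * B.det := by
        rw [hBQ]; simp only [Matrix.det_mul]; ring
      rw [e6, h6, Real.log_mul hmp.det_pos.ne' hB.det_pos.ne', Matrix.trace_sub, Matrix.trace_one]
      rw [Matrix.det_nonsing_inv, Ring.inverse_eq_inv', Real.log_inv] at h5
      linarith

variable {d : ℕ} {A : Finset (Fin d → ℝ)} {β : ℝ} {p : ℕ → A → ℝ} {T : ℕ}

theorem isBonusStep_bonusSeq (hp : ∀ t ∈ Finset.Icc 1 T, IsSpread β (p t)) {t : ℕ}
    (ht : t ∈ Finset.Icc 1 T) :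
    IsBonusStep (bonusSeq p (t - 1)) (secondMoment (p t)) (bonusSeq p t) := by
  induction t with
  | zero => simp at ht
  | succ t ih =>
    rw [Nat.add_sub_cancel, bonusSeq]
    have hS := (hp _ ht).secondMoment_posDef
    -- The first round is separate because B_0 = 0 is singular.
    rcases Nat.eq_zero_or_pos t with rfl | h
    · exact isBonusStep_zero hS
    · have ht' : t ∈ Finset.Icc 1 T := by
        rw [Finset.mem_Icc] at ht ⊢; omega
      exact (isBonusStep_bonus (ih ht').posDef hS).1

theorem bonusSeq_quad_mono (hp : ∀ t ∈ Finset.Icc 1 T, IsSpread β (p t)) {s t : ℕ} (hst : s ≤ t)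
    (ht : t ≤ T) (y : Fin d → ℝ) :
    y ⬝ᵥ (bonusSeq p s *ᵥ y) ≤ y ⬝ᵥ (bonusSeq p t *ᵥ y) := by
  induction t, hst using Nat.le_induction with
  | base => rfl
  | succ t hst ih =>
    have h := (isBonusStep_bonusSeq hp (t := t + 1)
      (Finset.mem_Icc.2 ⟨by omega, ht⟩)).sub_posSemidef.quad_nonneg y
    rw [Nat.add_sub_cancel, Matrix.sub_mulVec, dotProduct_sub] at h
    linarith [ih (by omega)]

theorem quad_inv_le_bonusSeq (hp : ∀ t ∈ Finset.Icc 1 T, IsSpread β (p t)) {t : ℕ}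
    (ht : t ∈ Finset.Icc 1 T) (y : Fin d → ℝ) :
    y ⬝ᵥ ((secondMoment (p t))⁻¹ *ᵥ y) ≤ y ⬝ᵥ (bonusSeq p T *ᵥ y) :=
  ((isBonusStep_bonusSeq hp ht).inv_le y).trans
    (bonusSeq_quad_mono hp (Finset.mem_Icc.1 ht).2 le_rfl y)

/-- Each increment is at most Σ_t⁻¹ ⪯ βΣ_1⁻¹ = βB_1, by spread of p_t. -/
theorem bonusSeq_le (hp : ∀ t ∈ Finset.Icc 1 T, IsSpread β (p t)) (hT : 1 ≤ T) {t : ℕ}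
    (ht : t ≤ T) (y : Fin d → ℝ) :
    y ⬝ᵥ (bonusSeq p t *ᵥ y) ≤ t * β * (y ⬝ᵥ (bonusSeq p 1 *ᵥ y)) := by
  induction t with
  | zero => simp [bonusSeq]
  | succ t ih =>
    have ht' : t + 1 ∈ Finset.Icc 1 T := Finset.mem_Icc.2 ⟨by omega, ht⟩
    have h1' : 1 ∈ Finset.Icc 1 T := Finset.mem_Icc.2 ⟨le_rfl, hT⟩
    have h := (isBonusStep_bonusSeq hp ht').sub_le y
    rw [Nat.add_sub_cancel, Matrix.sub_mulVec, dotProduct_sub] at h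
    have h2 := quad_inv_le (hp 1 h1').secondMoment_posDef (hp _ ht').secondMoment_posDef
      (fun v => (hp _ ht').quad_secondMoment_le (hp 1 h1').mem v) y
    have h3 : bonusSeq p 1 = (secondMoment (p 1))⁻¹ := bonus_zero (hp 1 h1').secondMoment_posDef
    rw [← h3] at h2
    have h4 := ih (by omega)
    push_cast
    linarith

/-- The total cost of the bonuses, by a log-determinant potential argument. -/
theorem sum_trace_bonus_le (hp : ∀ t ∈ Finset.Icc 1 T, IsSpread β (p t)) (hT : 1 ≤ T)
    (hβ : 0 < β) :
    ∑ t ∈ Finset.Icc 1 T, (secondMoment (p t) * (bonusSeq p t - bonusSeq p (t - 1))).trace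
      ≤ d + d * Real.log (T * β) := by
  have h1' : 1 ∈ Finset.Icc 1 T := Finset.mem_Icc.2 ⟨le_rfl, hT⟩
  have key : ∀ n, 1 ≤ n → n ≤ T →
      ∑ t ∈ Finset.Icc 1 n, (secondMoment (p t) * (bonusSeq p t - bonusSeq p (t - 1))).trace
        ≤ d + Real.log (bonusSeq p n).det - Real.log (bonusSeq p 1).det := by
    intro n hn
    induction n, hn using Nat.le_induction with
    | base =>
      intro _
      have hS := (hp 1 h1').secondMoment_posDef
      have h3 : bonusSeq p 1 = (secondMoment (p 1))⁻¹ := bonus_zero hS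
      have h0 : bonusSeq p 0 = 0 := rfl
      -- Round 1 costs tr(Σ_1Σ_1⁻¹) = d; the potential only starts at B_1.
      simp [h0, h3, Matrix.mul_nonsing_inv _ hS.det_pos.ne'.isUnit]
    | succ n hn ih =>
      intro hnT
      have hn' : n + 1 ∈ Finset.Icc 1 T := Finset.mem_Icc.2 ⟨by omega, hnT⟩
      have hB := (isBonusStep_bonusSeq hp (t := n) (Finset.mem_Icc.2 ⟨hn, by omega⟩)).posDef
      have := (isBonusStep_bonus hB (hp _ hn').secondMoment_posDef).2
      rw [Finset.sum_Icc_succ_top (by omega), Nat.add_sub_cancel]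
      have h5 := ih (by omega)
      change _ ≤ _ + Real.log (bonus (bonusSeq p n) (secondMoment (p (n + 1)))).det - _
      change _ + (secondMoment (p (n + 1)) *
        (bonus (bonusSeq p n) (secondMoment (p (n + 1))) - bonusSeq p n)).trace ≤ _
      linarith
  have hBT := (isBonusStep_bonusSeq hp (Finset.mem_Icc.2 ⟨hT, le_rfl⟩)).posDef
  have hB1 := (isBonusStep_bonusSeq hp h1').posDef
  have hc : 0 < T * β := mul_pos (by exact_mod_cast hT) hβ
  have h := log_det_le_of_sub_posSemidef hBT hB1 hc ((posSemidef_iff_real (by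
    rw [Matrix.transpose_sub, Matrix.transpose_smul, hBT.transpose_eq, hB1.transpose_eq])).2
    fun y => by
      rw [Matrix.sub_mulVec, dotProduct_sub, Matrix.smul_mulVec, dotProduct_smul, smul_eq_mul]
      linarith [bonusSeq_le hp hT le_rfl y])
  rw [Fintype.card_fin] at h
  linarith [key T hT le_rfl]

end Bonus

/-! ### Stability and regret of follow-the-regularized-leader. -/

section FTRL

theorem trace_sum_vecMulVec_mul {ι n : Type*} [Fintype ι] [Fintype n] (p : ι → ℝ) (u : ι → n → ℝ)
    (N : Matrix n n ℝ) :
    ((∑ a, p a • Matrix.vecMulVec (u a) (u a)) * N).trace = ∑ a, p a * (u a ⬝ᵥ (N *ᵥ u a)) := by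
  simp only [Matrix.sum_mul, Matrix.trace_sum, Matrix.smul_mul, Matrix.trace_smul, smul_eq_mul,
    Matrix.vecMulVec_mul, Matrix.trace_vecMulVec]
  refine Finset.sum_congr rfl fun a _ => ?_
  rw [Matrix.dotProduct_mulVec, dotProduct_comm]

theorem trace_mul_sum_vecMulVec_sq {ι n : Type*} [Fintype ι] [Fintype n] (p : ι → ℝ)
    (u : ι → n → ℝ) {N : Matrix n n ℝ} (hN : Nᵀ = N) {H : Matrix n n ℝ}
    (hH : H = ∑ a, p a • Matrix.vecMulVec (u a) (u a)) :
    (N * H * (N * H)).trace = ∑ a, p a * ((N *ᵥ u a) ⬝ᵥ (H *ᵥ (N *ᵥ u a))) := by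
  have : (N * H * (N * H)).trace = (H * (N * H * N)).trace := by
    rw [show N * H * (N * H) = (N * H * N) * H by simp only [mul_assoc], Matrix.trace_mul_comm]
  rw [this]
  nth_rw 1 [hH]
  rw [trace_sum_vecMulVec_mul]
  refine Finset.sum_congr rfl fun a _ => ?_
  rw [quad_conj hN]

variable {d : ℕ} {A : Finset (Fin d → ℝ)}

theorem trace_secondMoment_mul (p : A → ℝ) (B : Matrix (Fin d) (Fin d) ℝ) :
    (secondMoment p * B).trace = ∑ a : A, p a * (a.1 ⬝ᵥ (B *ᵥ a.1)) :=
  trace_sum_vecMulVec_mul p (fun a : A => a.1) B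

theorem gainMatrix_bilin (α : ℝ) (B : Matrix (Fin d) (Fin d) ℝ) (v : Fin d → ℝ)
    (z w : Fin d ⊕ Unit → ℝ) :
    z ⬝ᵥ (gainMatrix α B v *ᵥ w) = α * ((z ∘ Sum.inl) ⬝ᵥ (B *ᵥ (w ∘ Sum.inl)))
      + 1 / 2 * ((z ∘ Sum.inl) ⬝ᵥ v) * w (Sum.inr ())
      + 1 / 2 * z (Sum.inr ()) * (v ⬝ᵥ (w ∘ Sum.inl)) := by
  have e1 : Matrix.replicateCol Unit ((1 / 2 : ℝ) • v) *ᵥ (w ∘ Sum.inr)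
      = (1 / 2 * w (Sum.inr ())) • v := by
    ext i; simp [Matrix.mulVec, dotProduct]; ring
  have e2 : Matrix.replicateRow Unit ((1 / 2 : ℝ) • v) *ᵥ (w ∘ Sum.inl)
      = fun _ => 1 / 2 * (v ⬝ᵥ (w ∘ Sum.inl)) := by
    ext i; simp [Matrix.mulVec, dotProduct, Finset.mul_sum, mul_assoc]
  rw [gainMatrix, Matrix.fromBlocks_mulVec, e1, e2, Matrix.zero_mulVec, add_zero]
  have e3 : ∀ (x : Fin d → ℝ) (y : Unit → ℝ), z ⬝ᵥ Sum.elim x y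
      = (z ∘ Sum.inl) ⬝ᵥ x + z (Sum.inr ()) * y () := by
    intro x y; simp [dotProduct]
  rw [e3, dotProduct_add, Matrix.smul_mulVec, dotProduct_smul, dotProduct_smul, smul_eq_mul,
    smul_eq_mul]
  ring

theorem gainMatrix_transpose {α : ℝ} {B : Matrix (Fin d) (Fin d) ℝ} (hB : Bᵀ = B)
    (v : Fin d → ℝ) : (gainMatrix α B v)ᵀ = gainMatrix α B v := by
  simp [gainMatrix, Matrix.fromBlocks_transpose, hB]

theorem gainMatrix_mulVec_liftVec (v a : Fin d → ℝ) :
    gainMatrix 0 0 v *ᵥ liftVec a = Sum.elim ((1 / 2 : ℝ) • v) fun _ => 1 / 2 * (v ⬝ᵥ a) := by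
  rw [gainMatrix, Matrix.fromBlocks_mulVec]
  ext (i | i)
  · simp [liftVec, Matrix.mulVec, dotProduct]
  · simp [liftVec, Matrix.mulVec, dotProduct, Finset.mul_sum, mul_assoc]

theorem trace_liftedCov_mul_gainMatrix {p : A → ℝ} (hp : ∑ a, p a = 1) (α : ℝ)
    (B : Matrix (Fin d) (Fin d) ℝ) (v : Fin d → ℝ) :
    (liftedCov p * gainMatrix α B v).trace = α * (secondMoment p * B).trace + mean p ⬝ᵥ v := by
  rw [liftedCov_eq hp, trace_sum_vecMulVec_mul, trace_secondMoment_mul, mean_dotProduct,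
    Finset.mul_sum, ← Finset.sum_add_distrib]
  refine Finset.sum_congr rfl fun a _ => ?_
  rw [gainMatrix_bilin]
  simp only [liftVec, Sum.elim_comp_inl, Sum.elim_inr]
  rw [dotProduct_comm v]
  ring

namespace IsSpread

variable {β β' : ℝ} {p q : A → ℝ} (hp : IsSpread β p) (hq : IsSpread β' q)

include hp hq

/-- Stability with respect to a reward vector. -/
theorem inner_mean_sub_le {η : ℝ} {v : Fin d → ℝ}
    (h : η ^ 2 * (v ⬝ᵥ (secondMoment p *ᵥ v)) ≤ 1 / 4) :
    η * ((mean q - mean p) ⬝ᵥ v) ≤ logDetDiv (liftedCov q) (liftedCov p)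
      + η ^ 2 * (v ⬝ᵥ (secondMoment p *ᵥ v)) := by
  have hN := gainMatrix_transpose (α := 0) (B := 0) Matrix.transpose_zero (η • v)
  -- The perturbation is the product of the two linear forms z₁·(ηv) and z₂. With Z the squared dual
  -- norm of z, their squares are at most Z/4 and Z, so the product is at most Z/2; this is the
  -- origin of the hypothesis with 1/4.
  have hquad : ∀ z : Fin d ⊕ Unit → ℝ, z ⬝ᵥ (gainMatrix 0 0 (η • v) *ᵥ z)
      ≤ (1 / 2) * (z ⬝ᵥ ((liftedCov p)⁻¹ *ᵥ z)) := by
    intro z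
    rw [gainMatrix_bilin]
    have h0 := hp.posDef.inv.posSemidef.quad_nonneg z
    set Z := z ⬝ᵥ ((liftedCov p)⁻¹ *ᵥ z)
    have h1 := sq_dotProduct_le hp.posDef z (Sum.elim (η • v) fun _ => 0)
    have h2 := sq_dotProduct_le hp.posDef z (Sum.elim 0 fun _ => 1)
    rw [liftedCov_quad hp.mem.2] at h1 h2
    simp only [dotProduct_liftVec, Sum.elim_comp_inl, Sum.elim_inr, add_zero, zero_dotProduct,
      zero_add, one_pow, mul_one, hp.mem.2] at h1 h2
    have h3 : ∑ a : A, p a * ((η • v) ⬝ᵥ a.1) ^ 2 ≤ 1 / 4 := by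
      refine le_trans (le_of_eq ?_) h
      rw [secondMoment_bilin, Finset.mul_sum]
      refine Finset.sum_congr rfl fun a _ => ?_
      rw [smul_dotProduct, smul_eq_mul]; ring
    have e1 : z ⬝ᵥ (Sum.elim (η • v) fun _ => 0) = (z ∘ Sum.inl) ⬝ᵥ (η • v) := by
      simp [dotProduct]
    have e2 : z ⬝ᵥ (Sum.elim 0 fun _ => 1) = z (Sum.inr ()) := by simp [dotProduct]
    rw [e1] at h1
    rw [e2] at h2
    have h4 : ((z ∘ Sum.inl) ⬝ᵥ (η • v)) ^ 2 ≤ Z * (1 / 4) :=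
      h1.trans (mul_le_mul_of_nonneg_left h3 h0)
    rw [dotProduct_comm (η • v)]
    nlinarith [sq_nonneg (2 * ((z ∘ Sum.inl) ⬝ᵥ (η • v)) - z (Sum.inr ()))]
  have hs := trace_sub_trace_le_logDetDiv hp.posDef hq.posDef hN hquad
  rw [trace_liftedCov_mul_gainMatrix hp.mem.2, trace_liftedCov_mul_gainMatrix hq.mem.2,
    dotProduct_smul, dotProduct_smul, smul_eq_mul, smul_eq_mul,
    trace_mul_sum_vecMulVec_sq p _ hN (liftedCov_eq hp.mem.2)] at hs
  -- tr(NHNH) is the average of (η/2)²(v·a + v·b)² over independent a, b drawn from p.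
  have hfin : ∑ a : A, p a * ((gainMatrix 0 0 (η • v) *ᵥ liftVec a.1) ⬝ᵥ
      (liftedCov p *ᵥ (gainMatrix 0 0 (η • v) *ᵥ liftVec a.1)))
      ≤ η ^ 2 * (v ⬝ᵥ (secondMoment p *ᵥ v)) := by
    have e : ∀ a b : A, (gainMatrix 0 0 (η • v) *ᵥ liftVec a.1) ⬝ᵥ liftVec b.1
        = η / 2 * (v ⬝ᵥ a.1 + v ⬝ᵥ b.1) := by
      intro a b
      rw [gainMatrix_mulVec_liftVec, dotProduct_liftVec]
      simp only [Sum.elim_comp_inl, Sum.elim_inr, smul_dotProduct, smul_eq_mul]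
      ring
    simp only [liftedCov_quad hp.mem.2, e]
    calc _ ≤ ∑ a : A, p a * ∑ b : A, p b * (η ^ 2 / 2 * (v ⬝ᵥ a.1) ^ 2
          + η ^ 2 / 2 * (v ⬝ᵥ b.1) ^ 2) := by
          refine Finset.sum_le_sum fun a _ => mul_le_mul_of_nonneg_left ?_ (hp.mem.1 a)
          refine Finset.sum_le_sum fun b _ => mul_le_mul_of_nonneg_left ?_ (hp.mem.1 b)
          nlinarith [mul_nonneg (sq_nonneg η) (sq_nonneg (v ⬝ᵥ a.1 - v ⬝ᵥ b.1))]
      _ = η ^ 2 * (v ⬝ᵥ (secondMoment p *ᵥ v)) := by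
          have e1 : ∀ f : A → ℝ, ∀ c e : ℝ,
              ∑ b : A, p b * (c + e * f b) = c + e * ∑ b : A, p b * f b := by
            intro f c e
            have : ∑ b : A, p b * (c + e * f b) = (∑ b : A, p b) * c + e * ∑ b : A, p b * f b := by
              rw [Finset.sum_mul, Finset.mul_sum, ← Finset.sum_add_distrib]
              exact Finset.sum_congr rfl fun b _ => by ring
            rw [this, hp.mem.2, one_mul]
          have e2 : ∑ b : A, p b * (v ⬝ᵥ b.1) ^ 2 = v ⬝ᵥ (secondMoment p *ᵥ v) := by
            rw [secondMoment_bilin]; simp only [sq]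
          simp only [e1, e2]
          simp only [add_comm _ (η ^ 2 / 2 * (v ⬝ᵥ (secondMoment p *ᵥ v))), e1, e2]
          ring
  rw [sub_dotProduct]
  linarith

/-- Stability with respect to an increment of the bonus. -/
theorem trace_sub_trace_bonus_le {κ : ℝ} {D : Matrix (Fin d) (Fin d) ℝ} (hκ : 0 ≤ κ)
    (hκ' : κ ≤ 1 / 2) (hD : D.PosSemidef)
    (hle : ∀ y, y ⬝ᵥ (D *ᵥ y) ≤ y ⬝ᵥ ((secondMoment p)⁻¹ *ᵥ y)) :
    κ * ((secondMoment q * D).trace - (secondMoment p * D).trace)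
      ≤ logDetDiv (liftedCov q) (liftedCov p) + κ ^ 2 * (secondMoment p * D).trace := by
  have hS := hp.secondMoment_posDef
  have hN := gainMatrix_transpose (α := κ) hD.transpose_eq 0
  have hquad : ∀ z : Fin d ⊕ Unit → ℝ, z ⬝ᵥ (gainMatrix κ D 0 *ᵥ z)
      ≤ (1 / 2) * (z ⬝ᵥ ((liftedCov p)⁻¹ *ᵥ z)) := by
    intro z
    rw [gainMatrix_bilin]
    simp only [dotProduct_zero, zero_dotProduct, mul_zero, zero_mul, add_zero]
    set y := z ∘ Sum.inl with hy
    have h0 := hp.posDef.inv.posSemidef.quad_nonneg z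
    -- The inverse of a principal block is dominated by the corresponding block of the inverse: test
    -- z against (Σ⁻¹y, 0).
    have h3 : y ⬝ᵥ ((secondMoment p)⁻¹ *ᵥ y) ≤ z ⬝ᵥ ((liftedCov p)⁻¹ *ᵥ z) := by
      set v := (secondMoment p)⁻¹ *ᵥ y with hv
      have h1 := sq_dotProduct_le hp.posDef z (Sum.elim v fun _ => 0)
      have e1 : z ⬝ᵥ (Sum.elim v fun _ => 0) = y ⬝ᵥ v := by simp [dotProduct, hy]
      have e2 : (Sum.elim v fun _ => 0) ⬝ᵥ (liftedCov p *ᵥ (Sum.elim v fun _ => 0)) = y ⬝ᵥ v := by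
        rw [liftedCov_quad hp.mem.2]
        simp only [dotProduct_liftVec, Sum.elim_comp_inl, Sum.elim_inr, add_zero]
        have := secondMoment_bilin p v v
        simp only [← sq] at this
        rw [← this, hv, inv_mulVec_mulVec hS, dotProduct_comm]
      rw [e1, e2] at h1
      have h4 : 0 ≤ y ⬝ᵥ v := hS.inv.posSemidef.quad_nonneg y
      rcases h4.eq_or_lt with h5 | h5
      · rw [← h5]; exact h0
      · rw [sq] at h1; exact le_of_mul_le_mul_right h1 h5
    have := hD.quad_nonneg y
    have := hle y
    nlinarith
  have hs := trace_sub_trace_le_logDetDiv hp.posDef hq.posDef hN hquad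
  rw [trace_liftedCov_mul_gainMatrix hp.mem.2, trace_liftedCov_mul_gainMatrix hq.mem.2,
    trace_mul_sum_vecMulVec_sq p _ hN (liftedCov_eq hp.mem.2)] at hs
  have hfin : ∑ a : A, p a * ((gainMatrix κ D 0 *ᵥ liftVec a.1) ⬝ᵥ
      (liftedCov p *ᵥ (gainMatrix κ D 0 *ᵥ liftVec a.1)))
      ≤ κ ^ 2 * (secondMoment p * D).trace := by
    rw [trace_secondMoment_mul, Finset.mul_sum]
    refine Finset.sum_le_sum fun a _ => ?_
    have e : ∀ b : A, (gainMatrix κ D 0 *ᵥ liftVec a.1) ⬝ᵥ liftVec b.1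
        = κ * ((D *ᵥ a.1) ⬝ᵥ b.1) := by
      intro b
      rw [dotProduct_comm, gainMatrix_bilin]
      simp only [liftVec, Sum.elim_comp_inl, Sum.elim_inr]
      rw [dotProduct_comm b.1]
      simp
    have e2 : (gainMatrix κ D 0 *ᵥ liftVec a.1) ⬝ᵥ
        (liftedCov p *ᵥ (gainMatrix κ D 0 *ᵥ liftVec a.1))
        = κ ^ 2 * ((D *ᵥ a.1) ⬝ᵥ (secondMoment p *ᵥ (D *ᵥ a.1))) := by
      rw [liftedCov_quad hp.mem.2, secondMoment_bilin, Finset.mul_sum]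
      refine Finset.sum_congr rfl fun b _ => ?_
      rw [e]; ring
    rw [e2]
    set v := D *ᵥ a.1 with hv
    -- D ⪯ Σ⁻¹ implies DΣD ⪯ D.
    have h1 : v ⬝ᵥ (secondMoment p *ᵥ v) ≤ a.1 ⬝ᵥ (D *ᵥ a.1) := by
      have h2 := sq_dotProduct_mulVec_le hD (secondMoment p *ᵥ v) a.1
      have h3 := hle (secondMoment p *ᵥ v)
      have h0 : (secondMoment p)⁻¹ *ᵥ (secondMoment p *ᵥ v) = v := by
        rw [Matrix.mulVec_mulVec, Matrix.nonsing_inv_mul _ hS.det_pos.ne'.isUnit,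
          Matrix.one_mulVec]
      rw [h0] at h3
      rw [← hv, dotProduct_comm (secondMoment p *ᵥ v) v] at h2
      rw [dotProduct_comm (secondMoment p *ᵥ v) v] at h3
      have h4 := hD.quad_nonneg a.1
      rw [← hv] at h4
      rcases (hS.posSemidef.quad_nonneg v).eq_or_lt with h5 | h5
      · rw [← h5]; exact h4
      · have := h2.trans (mul_le_mul_of_nonneg_right h3 h4)
        rw [sq] at this
        exact le_of_mul_le_mul_left this h5
    have h6 := mul_le_mul_of_nonneg_left h1 (mul_nonneg (hp.mem.1 a) (sq_nonneg κ))
    linarith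
  rw [dotProduct_zero, dotProduct_zero] at hs
  linarith

end IsSpread

/-- The regularized cumulative gain of a distribution `q`. -/
noncomputable def regularizedGain (η α : ℝ) (B : Matrix (Fin d) (Fin d) ℝ) (v : Fin d → ℝ)
    (q : A → ℝ) : ℝ :=
  η * (α * (secondMoment q * B).trace + mean q ⬝ᵥ v) + Real.log (liftedCov q).det

theorem ftrlObjective_liftedCov {q : A → ℝ} (hq : ∑ a, q a = 1) (η α : ℝ)
    (B : Matrix (Fin d) (Fin d) ℝ) (v : Fin d → ℝ) :
    ftrlObjective η (gainMatrix α B v) (liftedCov q) = regularizedGain η α B v q := by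
  rw [ftrlObjective, logDetBarrier, liftedCov_transpose hq, trace_liftedCov_mul_gainMatrix hq,
    regularizedGain, sub_neg_eq_add]

/-- First-order optimality on the convex feasible set; the divergence gained here later pays for
stability. -/
theorem IsFTRLChoice.regularizedGain_le {γ η α β β' : ℝ} {ρ : A → ℝ}
    {B : Matrix (Fin d) (Fin d) ℝ} {v : Fin d → ℝ} {p q : A → ℝ}
    (h : IsFTRLChoice γ η ρ (gainMatrix α B v) p) (hp : IsSpread β p) (hq : IsSpread β' q)
    (hqm : q ∈ mixedSimplex γ ρ) :
    regularizedGain η α B v q ≤ regularizedGain η α B v p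
      - logDetDiv (liftedCov q) (liftedCov p) := by
  let l : Matrix (Fin d ⊕ Unit) (Fin d ⊕ Unit) ℝ →ₗ[ℝ] ℝ :=
    { toFun := fun H => η * (Hᵀ * gainMatrix α B v).trace
      map_add' := fun X Y => by
        rw [Matrix.transpose_add, Matrix.add_mul, Matrix.trace_add, mul_add]
      map_smul' := fun c X => by
        rw [Matrix.transpose_smul, Matrix.smul_mul, Matrix.trace_smul, smul_eq_mul, smul_eq_mul,
          RingHom.id_apply]
        ring }
  have hl : ∀ H, l H + Real.log H.det = ftrlObjective η (gainMatrix α B v) H := fun H => by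
    rw [ftrlObjective, logDetBarrier, sub_neg_eq_add]; rfl
  have key := le_sub_logDetDiv_of_isMax hp.posDef hq.posDef l fun s hs hs1 => by
    rw [hl, hl, ← liftedCov_convexCombo hp.mem.2 hq.mem.2]
    exact h.2 ⟨_, mixedSimplex_convexCombo h.1 hqm hs.le hs1, rfl⟩
  rwa [hl, hl, ftrlObjective_liftedCov hp.mem.2, ftrlObjective_liftedCov hq.mem.2] at key

theorem regularizedGain_add (η α : ℝ) (B B' : Matrix (Fin d) (Fin d) ℝ) (v v' : Fin d → ℝ)
    (q : A → ℝ) :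
    regularizedGain η α (B + B') (v + v') q = regularizedGain η α B v q
      + η * (α * (secondMoment q * B').trace + mean q ⬝ᵥ v') := by
  rw [regularizedGain, regularizedGain, Matrix.mul_add, Matrix.trace_add, dotProduct_add]
  ring

theorem IsSpread.estimator_quad {β : ℝ} {p : A → ℝ} (hp : IsSpread β p) (a : A) {r : ℝ}
    (hr : |r| ≤ 1) :
    estimator p a r ⬝ᵥ (secondMoment p *ᵥ estimator p a r)
      ≤ a.1 ⬝ᵥ ((secondMoment p)⁻¹ *ᵥ a.1) := by
  have h0 := hp.secondMoment_posDef.inv.posSemidef.quad_nonneg a.1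
  rw [estimator, Matrix.mulVec_smul, inv_mulVec_mulVec hp.secondMoment_posDef, smul_dotProduct,
    dotProduct_smul, smul_eq_mul, smul_eq_mul, dotProduct_comm]
  have : r * r ≤ 1 := by
    have := sq_le_one_iff_abs_le_one r |>.2 hr
    rwa [sq] at this
  nlinarith

/-- From one-step inequalities to the regret of follow-the-regularized-leader. -/
theorem regret_le_of_step {T : ℕ} {γ η α β : ℝ} {ρ : A → ℝ} {p : ℕ → A → ℝ} {w : ℕ → Fin d → ℝ}
    {c : ℕ → ℝ} (hη : 0 < η) (hβ : 0 < β) (hsp : ∀ q ∈ mixedSimplex γ ρ, IsSpread β q)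
    (hp : ∀ t ∈ Finset.Icc 1 T, p t ∈ mixedSimplex γ ρ)
    (hstep : ∀ t ∈ Finset.Icc 1 T, ∀ q ∈ mixedSimplex γ ρ,
      regularizedGain η α (bonusSeq p t) (∑ s ∈ Finset.Icc 1 t, w s) q
        ≤ regularizedGain η α (bonusSeq p (t - 1)) (∑ s ∈ Finset.Icc 1 (t - 1), w s) (p t)
          + η * (c t + mean (p t) ⬝ᵥ w t)) {q : A → ℝ} (hq : q ∈ mixedSimplex γ ρ) :
    ∑ t ∈ Finset.Icc 1 T, (mean q - mean (p t)) ⬝ᵥ w t + α * (secondMoment q * bonusSeq p T).trace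
      ≤ (d + 1) * Real.log β / η + ∑ t ∈ Finset.Icc 1 T, c t := by
  -- Range of the regularizer: spread distributions have lifted covariances comparable up to β, in
  -- dimension d + 1.
  have hlog : ∀ q' ∈ mixedSimplex γ ρ, Real.log (liftedCov q').det
      ≤ (d + 1) * Real.log β + Real.log (liftedCov q).det := by
    intro q' hq'
    have h1 := hsp _ hq'
    have h2 := hsp _ hq
    have h := log_det_le_of_sub_posSemidef h1.posDef h2.posDef hβ ((posSemidef_iff_real (by
      rw [Matrix.transpose_sub, Matrix.transpose_smul, h1.posDef.transpose_eq,
        h2.posDef.transpose_eq])).2 fun z => by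
        rw [Matrix.sub_mulVec, dotProduct_sub, Matrix.smul_mulVec, dotProduct_smul, smul_eq_mul]
        linarith [h2.quad_lifted_le h1.mem z])
    simpa using h
  -- Be-the-leader: the claim is proved for every q', since the inductive step uses the previous
  -- bound at q' = p_{n+1}.
  have key : ∀ n ≤ T, ∀ q' ∈ mixedSimplex γ ρ,
      regularizedGain η α (bonusSeq p n) (∑ s ∈ Finset.Icc 1 n, w s) q'
        ≤ (d + 1) * Real.log β + Real.log (liftedCov q).det
          + ∑ t ∈ Finset.Icc 1 n, η * (c t + mean (p t) ⬝ᵥ w t) := by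
    intro n
    induction n with
    | zero =>
      intro _ q' hq'
      simpa [regularizedGain, bonusSeq] using hlog q' hq'
    | succ n ih =>
      intro hn q' hq'
      have hmem : n + 1 ∈ Finset.Icc 1 T := Finset.mem_Icc.2 ⟨by omega, hn⟩
      have h1 := hstep _ hmem q' hq'
      have h2 := ih (by omega) _ (hp _ hmem)
      rw [Nat.add_sub_cancel] at h1
      rw [Finset.sum_Icc_succ_top (b := n) (by omega) fun t => η * (c t + mean (p t) ⬝ᵥ w t)]
      linarith
  have h := key T le_rfl q hq
  rw [regularizedGain, ← Finset.mul_sum, Finset.sum_add_distrib, dotProduct_sum] at h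
  have h2 : η * (∑ t ∈ Finset.Icc 1 T, (mean q - mean (p t)) ⬝ᵥ w t
      + α * (secondMoment q * bonusSeq p T).trace)
      ≤ (d + 1) * Real.log β + η * ∑ t ∈ Finset.Icc 1 T, c t := by
    simp only [sub_dotProduct, Finset.sum_sub_distrib]
    linarith
  rw [← mul_le_mul_iff_right₀ hη]
  refine h2.trans (le_of_eq ?_)
  field_simp

theorem sum_Ico_add_last {M : Type*} [AddCommMonoid M] {t : ℕ} (ht : 1 ≤ t) (w : ℕ → M) :
    ∑ s ∈ Finset.Icc 1 t, w s = ∑ s ∈ Finset.Ico 1 t, w s + w t ∧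
      ∑ s ∈ Finset.Icc 1 (t - 1), w s = ∑ s ∈ Finset.Ico 1 t, w s := by
  obtain ⟨t, rfl⟩ : ∃ k, t = k + 1 := ⟨t - 1, by omega⟩
  have : Finset.Ico 1 (t + 1) = Finset.Icc 1 t := by ext; simp
  rw [this, Nat.add_sub_cancel]
  exact ⟨Finset.sum_Icc_succ_top (by omega) _, rfl⟩

theorem trace_bonus_increment_nonneg {T : ℕ} {β : ℝ} {p : ℕ → A → ℝ}
    (hp : ∀ t ∈ Finset.Icc 1 T, IsSpread β (p t)) {t : ℕ} (ht : t ∈ Finset.Icc 1 T) :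
    0 ≤ (secondMoment (p t) * (bonusSeq p t - bonusSeq p (t - 1))).trace :=
  trace_mul_nonneg (hp t ht).secondMoment_posDef (isBonusStep_bonusSeq hp ht).sub_posSemidef

/-- The estimated regret of the first algorithm. -/
theorem FollowsFixedPointFTRL.estimated_regret_le {T : ℕ} {γ η α β : ℝ} {ρ : A → ℝ}
    {p : ℕ → A → ℝ} {a : ℕ → A} {r : ℕ → ℝ} (h : FollowsFixedPointFTRL T γ α η ρ p a r)
    (hη : 0 < η) (hα : 0 ≤ α) (hβ : 0 < β) (hηβ : η ^ 2 * β ≤ 1 / 4)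
    (hr : ∀ t ∈ Finset.Icc 1 T, |r t| ≤ 1)
    (hsp : ∀ q ∈ mixedSimplex γ ρ, IsSpread β q) {q : A → ℝ} (hq : q ∈ mixedSimplex γ ρ) :
    ∑ t ∈ Finset.Icc 1 T, (mean q - mean (p t)) ⬝ᵥ estimator (p t) (a t) (r t)
        + α * (secondMoment q * bonusSeq p T).trace
      ≤ (d + 1) * Real.log β / η + ∑ t ∈ Finset.Icc 1 T,
        (2 * α * (secondMoment (p t) * (bonusSeq p t - bonusSeq p (t - 1))).trace
          + 2 * η * ((a t).1 ⬝ᵥ ((secondMoment (p t))⁻¹ *ᵥ (a t).1))) := by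
  have hps : ∀ t ∈ Finset.Icc 1 T, IsSpread β (p t) := fun t ht => hsp _ (h t ht).1
  refine regret_le_of_step hη hβ hsp (fun t ht => (h t ht).1) (fun t ht q hq => ?_) hq
  have ht1 := (Finset.mem_Icc.1 ht).1
  obtain ⟨e1, e2⟩ := sum_Ico_add_last ht1 fun s => estimator (p s) (a s) (r s)
  have h1 := (h t ht).regularizedGain_le (hps t ht) (hsp q hq) hq
  have hpt := hps t ht
  set v := estimator (p t) (a t) (r t)
  have h2 : v ⬝ᵥ (secondMoment (p t) *ᵥ v) ≤ _ := hpt.estimator_quad (a t) (hr t ht)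
  have h3 := hpt.quad_inv_action_le (a t)
  have h5 := hpt.secondMoment_posDef.inv.posSemidef.quad_nonneg (a t).1
  set x := (a t).1 ⬝ᵥ ((secondMoment (p t))⁻¹ *ᵥ (a t).1)
  have h4 := hpt.inner_mean_sub_le (hsp q hq) (v := v)
    ((mul_le_mul_of_nonneg_left (h2.trans h3) (sq_nonneg η)).trans hηβ)
  have h6 := regularizedGain_add η α (bonusSeq p t) 0
    (∑ s ∈ Finset.Ico 1 t, estimator (p s) (a s) (r s)) v q
  -- The maximized objective already contains B_t, so the increment is removed at p_t itself and
  -- costs α·tr(Σ_t(B_t − B_{t−1})), with no stability condition on ηα.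
  have h7 := regularizedGain_add η α (bonusSeq p (t - 1)) (bonusSeq p t - bonusSeq p (t - 1))
    (∑ s ∈ Finset.Ico 1 t, estimator (p s) (a s) (r s)) 0 (p t)
  rw [add_zero, Matrix.mul_zero, Matrix.trace_zero, mul_zero, zero_add] at h6
  rw [add_sub_cancel, add_zero, dotProduct_zero, add_zero] at h7
  have h8 := mul_nonneg (mul_nonneg hη.le hα) (trace_bonus_increment_nonneg hps ht)
  have h9 := mul_le_mul_of_nonneg_left h2 (sq_nonneg η)
  have h10 := mul_nonneg (sq_nonneg η) h5
  rw [e1, e2]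
  rw [sub_dotProduct] at h4
  linarith

/-- The estimated regret of the second algorithm. -/
theorem FollowsStandardFTRL.estimated_regret_le {T : ℕ} {γ η α β : ℝ} {ρ : A → ℝ}
    {p : ℕ → A → ℝ} {a : ℕ → A} {r : ℕ → ℝ} (h : FollowsStandardFTRL T γ α η ρ p a r)
    (hη : 0 < η) (hα : 0 ≤ α) (hβ : 0 < β) (hηβ : 4 * η ^ 2 * β ≤ 1 / 4) (hηα : η * α ≤ 1 / 4)
    (hr : ∀ t ∈ Finset.Icc 1 T, |r t| ≤ 1)
    (hsp : ∀ q ∈ mixedSimplex γ ρ, IsSpread β q) {q : A → ℝ} (hq : q ∈ mixedSimplex γ ρ) :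
    ∑ t ∈ Finset.Icc 1 T, (mean q - mean (p t)) ⬝ᵥ estimator (p t) (a t) (r t)
        + α * (secondMoment q * bonusSeq p T).trace
      ≤ (d + 1) * Real.log β / η + ∑ t ∈ Finset.Icc 1 T,
        (2 * α * (secondMoment (p t) * (bonusSeq p t - bonusSeq p (t - 1))).trace
          + 2 * η * ((a t).1 ⬝ᵥ ((secondMoment (p t))⁻¹ *ᵥ (a t).1))) := by
  have hps : ∀ t ∈ Finset.Icc 1 T, IsSpread β (p t) := fun t ht => hsp _ (h t ht).1
  refine regret_le_of_step hη hβ hsp (fun t ht => (h t ht).1) (fun t ht q hq => ?_) hq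
  have ht1 := (Finset.mem_Icc.1 ht).1
  obtain ⟨e1, e2⟩ := sum_Ico_add_last ht1 fun s => estimator (p s) (a s) (r s)
  have h1 := (h t ht).regularizedGain_le (hps t ht) (hsp q hq) hq
  have hpt := hps t ht
  have hB := isBonusStep_bonusSeq hps ht
  set v := estimator (p t) (a t) (r t)
  have h2 : v ⬝ᵥ (secondMoment (p t) *ᵥ v) ≤ _ := hpt.estimator_quad (a t) (hr t ht)
  have h3 := hpt.quad_inv_action_le (a t)
  set x := (a t).1 ⬝ᵥ ((secondMoment (p t))⁻¹ *ᵥ (a t).1)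
  have h9 := mul_le_mul_of_nonneg_left h2 (sq_nonneg η)
  -- Both the reward and the bonus increment are new here. Each stability bound is taken at twice
  -- the rate and then halved, so that together they use the divergence once.
  have h4 := hpt.inner_mean_sub_le (hsp q hq) (v := v) (η := 2 * η)
    (by nlinarith [mul_le_mul_of_nonneg_left h3 (sq_nonneg η)])
  have hκ : 0 ≤ η * α := mul_nonneg hη.le hα
  have h5 := hpt.trace_sub_trace_bonus_le (hsp q hq) (κ := 2 * (η * α)) (by linarith)
    (by linarith) hB.sub_posSemidef hB.sub_le
  have h7 := regularizedGain_add η α (bonusSeq p (t - 1)) (bonusSeq p t - bonusSeq p (t - 1))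
    (∑ s ∈ Finset.Ico 1 t, estimator (p s) (a s) (r s)) v q
  rw [add_sub_cancel] at h7
  have h8 := trace_bonus_increment_nonneg hps ht
  set X := (secondMoment (p t) * (bonusSeq p t - bonusSeq p (t - 1))).trace
  have h10 : (2 * (η * α)) ^ 2 * X ≤ η * α * X := by nlinarith [mul_nonneg hκ h8]
  rw [e1, e2]
  rw [sub_dotProduct] at h4
  have h11 := mul_nonneg hκ h8
  nlinarith

end FTRL

/-! ### Exponential supermartingales for the bandit process. -/

section Concentration

theorem integral_mul_condExp {Ω : Type*} {m mΩ : MeasurableSpace Ω} (hm : m ≤ mΩ) (P : Measure Ω)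
    [IsProbabilityMeasure P] {φ f : Ω → ℝ} (hφ : Measurable[m] φ) {b : ℝ} (hb : ∀ ω, |φ ω| ≤ b)
    (hf : Integrable f P) : ∫ ω, φ ω * f ω ∂P = ∫ ω, φ ω * (P[f | m]) ω ∂P := by
  have hint : Integrable (φ * f) P :=
    hf.bdd_mul (c := b) (hφ.mono hm le_rfl).aestronglyMeasurable
      (Filter.Eventually.of_forall fun ω => by simpa using hb ω)
  have h := condExp_mul_of_stronglyMeasurable_left hφ.stronglyMeasurable hint hf
  calc ∫ ω, φ ω * f ω ∂P = ∫ ω, (P[φ * f | m]) ω ∂P := (integral_condExp hm).symm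
    _ = _ := integral_congr_ae h

/-- Only the quadratic part is bounded; r stays linear, so that its conditional mean can be
substituted exactly. -/
theorem exp_add_le {g h r : ℝ} (hgh : |g| + |h| ≤ 1) (hr : |r| ≤ 1) :
    Real.exp (g + r * h) ≤ 1 + (g + 2 * g ^ 2 + 2 * h ^ 2) + r * h := by
  have h1 : |r * h| ≤ |h| := by
    rw [abs_mul]; exact mul_le_of_le_one_left (abs_nonneg h) hr
  have h2 : |g + r * h| ≤ 1 := (abs_add_le _ _).trans (by linarith)
  have h3 := (abs_le.1 (Real.abs_exp_sub_one_sub_id_le h2)).2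
  have h4 : (r * h) ^ 2 ≤ h ^ 2 := sq_le_sq.2 h1
  nlinarith [sq_nonneg (g - r * h)]

theorem sum_indicator_mul {Ω ι : Type*} [Fintype ι] (a : Ω → ι) (f : ι → ℝ) (ω : Ω) :
    ∑ x, (a ⁻¹' {x}).indicator (fun _ => (1 : ℝ)) ω * f x = f (a ω) := by
  classical
  simp [Set.indicator_apply]

/-- One step of the exponential supermartingale. -/
theorem integral_mul_exp_le {Ω ι : Type*} [Fintype ι] [MeasurableSpace ι]
    [MeasurableSingletonClass ι] {m mΩ : MeasurableSpace Ω} (hm : m ≤ mΩ) (P : Measure Ω)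
    [IsProbabilityMeasure P] {a : Ω → ι} {r : Ω → ℝ} {p R g h : Ω → ι → ℝ} {c b : ℝ}
    (ha : Measurable a) (hrm : Measurable r) (hr : ∀ ω, |r ω| ≤ 1)
    (hpm : ∀ x, Measurable[m] fun ω => p ω x) (hp : ∀ ω, p ω ∈ stdSimplex ℝ ι)
    (hRm : ∀ x, Measurable[m] fun ω => R ω x) (hR : ∀ ω x, |R ω x| ≤ c)
    (hlaw : ∀ x, P⟦a ⁻¹' {x} | m⟧ =ᵐ[P] fun ω => p ω x)
    (hmean : P[r | m ⊔ MeasurableSpace.comap a inferInstance] =ᵐ[P] fun ω => R ω (a ω))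
    (hgm : ∀ x, Measurable[m] fun ω => g ω x) (hhm : ∀ x, Measurable[m] fun ω => h ω x)
    (hgh : ∀ ω x, |g ω x| + |h ω x| ≤ 1)
    {W : Ω → ℝ} (hWm : Measurable[m] W) (hW0 : ∀ ω, 0 ≤ W ω) (hWb : ∀ ω, W ω ≤ b) :
    ∫ ω, W ω * Real.exp (g ω (a ω) + r ω * h ω (a ω)) ∂P
      ≤ ∫ ω, W ω * (1 + ∑ x, p ω x * (g ω x + 2 * g ω x ^ 2 + 2 * h ω x ^ 2 + R ω x * h ω x)) ∂P := by
  classical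
  set I : ι → Ω → ℝ := fun x => (a ⁻¹' {x}).indicator (fun _ => (1 : ℝ)) with hI
  have hIm : ∀ x, Measurable (I x) := fun x =>
    measurable_const.indicator (ha (measurableSet_singleton x))
  have hI1 : ∀ x ω, |I x ω| ≤ 1 := fun x ω => by
    rw [hI]; simp only [Set.indicator_apply]; split_ifs <;> simp
  have hIi : ∀ x, Integrable (I x) P := fun x =>
    Integrable.of_bound (hIm x).aestronglyMeasurable 1 (Filter.Eventually.of_forall (hI1 x))
  have hri : Integrable r P :=
    Integrable.of_bound hrm.aestronglyMeasurable 1 (Filter.Eventually.of_forall hr)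
  have hg1 : ∀ ω x, |g ω x| ≤ 1 := fun ω x => by linarith [hgh ω x, abs_nonneg (h ω x)]
  have hh1 : ∀ ω x, |h ω x| ≤ 1 := fun ω x => by linarith [hgh ω x, abs_nonneg (g ω x)]
  have hWa : ∀ ω, |W ω| ≤ b := fun ω => by rw [abs_of_nonneg (hW0 ω)]; exact hWb ω
  have law : ∀ x {φ : Ω → ℝ}, Measurable[m] φ → ∀ {e : ℝ}, (∀ ω, |φ ω| ≤ e) →
      ∫ ω, φ ω * I x ω ∂P = ∫ ω, φ ω * p ω x ∂P := by
    intro x φ hφ e he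
    rw [integral_mul_condExp hm P hφ he (hIi x)]
    refine integral_congr_ae ?_
    filter_upwards [hlaw x] with ω hω
    rw [← hω]
  -- Two-stage conditioning: on the past and the action, which replaces r by its mean, and then on
  -- the past alone, which replaces the indicator of the action by its probability.
  have rew : ∀ x {φ : Ω → ℝ}, Measurable[m] φ → ∀ {e : ℝ}, (∀ ω, |φ ω| ≤ e) →
      ∫ ω, φ ω * I x ω * r ω ∂P = ∫ ω, φ ω * R ω x * p ω x ∂P := by
    intro x φ hφ e he
    have hm' : m ⊔ MeasurableSpace.comap a inferInstance ≤ mΩ :=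
      sup_le hm (measurable_iff_comap_le.1 ha)
    have hI' : Measurable[m ⊔ MeasurableSpace.comap a inferInstance] (I x) := by
      refine Measurable.indicator measurable_const ?_
      exact le_sup_right (a := m) _ ⟨{x}, measurableSet_singleton x, rfl⟩
    have hφI : Measurable[m ⊔ MeasurableSpace.comap a inferInstance] fun ω => φ ω * I x ω :=
      (hφ.mono le_sup_left le_rfl).mul hI'
    have hφR : Measurable[m] fun ω => φ ω * R ω x := hφ.mul (hRm x)
    rw [integral_mul_condExp hm' P (b := e) hφI (fun ω => by
        rw [abs_mul]
        exact (mul_le_of_le_one_right (abs_nonneg _) (hI1 x ω)).trans (he ω)) hri,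
      ← law x hφR (e := e * c) (fun ω => by
        rw [abs_mul]
        exact mul_le_mul (he ω) (hR ω x) (abs_nonneg _) ((abs_nonneg _).trans (he ω)))]
    refine integral_congr_ae ?_
    filter_upwards [hmean] with ω hω
    rw [hω]
    by_cases hx : a ω = x
    · rw [hx]; ring
    · have : I x ω = 0 := by simp [hI, hx]
      rw [this]; simp
  have hG : ∀ x, Measurable[m] fun ω => g ω x + 2 * g ω x ^ 2 + 2 * h ω x ^ 2 := fun x =>
    ((hgm x).add (((hgm x).pow_const 2).const_mul 2)).add (((hhm x).pow_const 2).const_mul 2)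
  have hGb : ∀ ω x, |g ω x + 2 * g ω x ^ 2 + 2 * h ω x ^ 2| ≤ 5 := fun ω x => by
    have h1 := abs_le.1 (hg1 ω x)
    have h2 := abs_le.1 (hh1 ω x)
    rw [abs_le]
    constructor <;> nlinarith
  have hWG : ∀ x, Measurable[m] fun ω => W ω * (g ω x + 2 * g ω x ^ 2 + 2 * h ω x ^ 2) :=
    fun x => hWm.mul (hG x)
  have hWGb : ∀ x ω, |W ω * (g ω x + 2 * g ω x ^ 2 + 2 * h ω x ^ 2)| ≤ b * 5 := fun x ω => by
    rw [abs_mul]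
    exact mul_le_mul (hWa ω) (hGb ω x) (abs_nonneg _) ((abs_nonneg _).trans (hWa ω))
  have hWh : ∀ x, Measurable[m] fun ω => W ω * h ω x := fun x => hWm.mul (hhm x)
  have hWhb : ∀ x ω, |W ω * h ω x| ≤ b := fun x ω => by
    rw [abs_mul]
    exact (mul_le_of_le_one_right (abs_nonneg _) (hh1 ω x)).trans (hWa ω)
  have mk : ∀ {f : Ω → ℝ}, Measurable f → ∀ {e : ℝ}, (∀ ω, |f ω| ≤ e) → Integrable f P :=
    fun hf e he => Integrable.of_bound hf.aestronglyMeasurable e (Filter.Eventually.of_forall he)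
  have lift : ∀ {f : Ω → ℝ}, Measurable[m] f → Measurable f := fun hf => hf.mono hm le_rfl
  have hp1 : ∀ ω x, |p ω x| ≤ 1 := fun ω x => by
    rw [abs_of_nonneg ((hp ω).1 x)]
    exact ((hp ω).2).symm ▸ Finset.single_le_sum (fun i _ => (hp ω).1 i) (Finset.mem_univ x)
  have iW : Integrable W P := mk (lift hWm) hWa
  have i1 : ∀ x, Integrable
      (fun ω => W ω * (g ω x + 2 * g ω x ^ 2 + 2 * h ω x ^ 2) * I x ω) P := fun x =>
    mk ((lift (hWG x)).mul (hIm x)) (e := b * 5) fun ω => by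
      rw [abs_mul]
      exact (mul_le_of_le_one_right (abs_nonneg _) (hI1 x ω)).trans (hWGb x ω)
  have i2 : ∀ x, Integrable (fun ω => W ω * h ω x * I x ω * r ω) P := fun x =>
    mk (((lift (hWh x)).mul (hIm x)).mul hrm) (e := b) fun ω => by
      rw [abs_mul, abs_mul]
      exact (mul_le_of_le_one_right (by positivity) (hr ω)).trans
        ((mul_le_of_le_one_right (abs_nonneg _) (hI1 x ω)).trans (hWhb x ω))
  have i3 : ∀ x, Integrable
      (fun ω => W ω * (g ω x + 2 * g ω x ^ 2 + 2 * h ω x ^ 2) * p ω x) P := fun x =>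
    mk ((lift (hWG x)).mul (lift (hpm x))) (e := b * 5) fun ω => by
      rw [abs_mul]
      exact (mul_le_of_le_one_right (abs_nonneg _) (hp1 ω x)).trans (hWGb x ω)
  have i4 : ∀ x, Integrable (fun ω => W ω * h ω x * R ω x * p ω x) P := fun x =>
    mk (((lift (hWh x)).mul (lift (hRm x))).mul (lift (hpm x))) (e := b * c) fun ω => by
      rw [abs_mul, abs_mul]
      refine (mul_le_of_le_one_right (by positivity) (hp1 ω x)).trans ?_
      exact mul_le_mul (hWhb x ω) (hR ω x) (abs_nonneg _) ((abs_nonneg _).trans (hWa ω))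
  have i12 : ∀ x, Integrable (fun ω => W ω * (g ω x + 2 * g ω x ^ 2 + 2 * h ω x ^ 2) * I x ω
      + W ω * h ω x * I x ω * r ω) P := fun x => (i1 x).add (i2 x)
  have i34 : ∀ x, Integrable (fun ω => W ω * (g ω x + 2 * g ω x ^ 2 + 2 * h ω x ^ 2) * p ω x
      + W ω * h ω x * R ω x * p ω x) P := fun x => (i3 x).add (i4 x)
  calc ∫ ω, W ω * Real.exp (g ω (a ω) + r ω * h ω (a ω)) ∂P
      ≤ ∫ ω, (W ω + ∑ x, (W ω * (g ω x + 2 * g ω x ^ 2 + 2 * h ω x ^ 2) * I x ω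
          + W ω * h ω x * I x ω * r ω)) ∂P := by
        refine integral_mono_of_nonneg (Filter.Eventually.of_forall fun ω =>
          mul_nonneg (hW0 ω) (Real.exp_pos _).le)
          (iW.add (integrable_finsetSum _ fun x _ => i12 x))
          (Filter.Eventually.of_forall fun ω => ?_)
        have e1 := sum_indicator_mul a (fun x => g ω x + 2 * g ω x ^ 2 + 2 * h ω x ^ 2
          + r ω * h ω x) ω
        have e2 : ∑ x, (W ω * (g ω x + 2 * g ω x ^ 2 + 2 * h ω x ^ 2) * I x ω
            + W ω * h ω x * I x ω * r ω) = W ω * ∑ x, I x ω * (g ω x + 2 * g ω x ^ 2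
              + 2 * h ω x ^ 2 + r ω * h ω x) := by
          rw [Finset.mul_sum]
          exact Finset.sum_congr rfl fun x _ => by ring
        simp only
        rw [e2, e1]
        have := mul_le_mul_of_nonneg_left (exp_add_le (hgh ω (a ω)) (hr ω)) (hW0 ω)
        linarith
    _ = ∫ ω, (W ω + ∑ x, (W ω * (g ω x + 2 * g ω x ^ 2 + 2 * h ω x ^ 2) * p ω x
          + W ω * h ω x * R ω x * p ω x)) ∂P := by
        rw [integral_add iW (integrable_finsetSum _ fun x _ => i12 x),
          integral_add iW (integrable_finsetSum _ fun x _ => i34 x),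
          integral_finsetSum _ fun x _ => i12 x,
          integral_finsetSum _ fun x _ => i34 x]
        congr 1
        refine Finset.sum_congr rfl fun x _ => ?_
        rw [integral_add (i1 x) (i2 x), integral_add (i3 x) (i4 x), law x (hWG x) (hWGb x),
          rew x (hWh x) (hWhb x)]
    _ = _ := by
        refine integral_congr_ae (Filter.Eventually.of_forall fun ω => ?_)
        simp only
        rw [mul_add, mul_one, Finset.mul_sum]
        congr 1
        exact Finset.sum_congr rfl fun x _ => by ring

variable {Ω : Type*} [mΩ : MeasurableSpace Ω] {P : Measure Ω}
  {ℱ : Filtration ℕ mΩ} {d : ℕ} {A : Finset (Fin d → ℝ)} {T : ℕ} {C : ℝ}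
  {θ : ℕ → Ω → Fin d → ℝ} {ε : ℕ → Ω → A → ℝ}
  {p : ℕ → Ω → A → ℝ} {a : ℕ → Ω → A} {r : ℕ → Ω → ℝ}

/-- The compensator of one round in the exponential supermartingale. -/
noncomputable def compensator (θ : Fin d → ℝ) (ε p g h : A → ℝ) : ℝ :=
  ∑ x : A, p x * (g x + 2 * g x ^ 2 + 2 * h x ^ 2 + (x.1 ⬝ᵥ θ + ε x) * h x)

theorem IsMisspecifiedBandit.abs_eps_le (hb : IsMisspecifiedBandit P ℱ T C θ ε p a r) {t : ℕ}
    (ht : t ∈ Finset.Icc 1 T) (ω : Ω) (x : A) : |ε t ω x| ≤ C :=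
  (le_ciSup (Set.finite_range fun x : A => |ε t ω x|).bddAbove x).trans
    ((Finset.single_le_sum (f := fun t => ⨆ x : A, |ε t ω x|)
      (fun _ _ => Real.iSup_nonneg fun _ => abs_nonneg _) ht).trans (hb.misspecification_le ω))

theorem IsMisspecifiedBandit.measurable_inner (hb : IsMisspecifiedBandit P ℱ T C θ ε p a r) {t : ℕ}
    (ht : t ∈ Finset.Icc 1 T) (v : Fin d → ℝ) : Measurable[ℱ (t - 1)] fun ω => v ⬝ᵥ θ t ω := by
  refine Finset.measurable_sum _ fun i _ => ?_
  exact ((measurable_pi_apply i).comp (hb.measurable_theta t ht)).const_mul _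

/-- Subtracting the predictable compensator c_t leaves an exponential process of mean at most 1.
Measurability and boundedness are carried along the induction to supply integrability. -/
theorem IsMisspecifiedBandit.integral_exp_le [IsProbabilityMeasure P]
    (hb : IsMisspecifiedBandit P ℱ T C θ ε p a r)
    (hp : ∀ t ∈ Finset.Icc 1 T, ∀ ω, p t ω ∈ stdSimplex ℝ A) {g h : ℕ → Ω → A → ℝ}
    (hgm : ∀ t ∈ Finset.Icc 1 T, ∀ x, Measurable[ℱ (t - 1)] fun ω => g t ω x)
    (hhm : ∀ t ∈ Finset.Icc 1 T, ∀ x, Measurable[ℱ (t - 1)] fun ω => h t ω x)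
    (hgh : ∀ t ∈ Finset.Icc 1 T, ∀ ω x, |g t ω x| + |h t ω x| ≤ 1) {n : ℕ} (hn : n ≤ T) :
    ∃ b : ℝ, Measurable[ℱ n] (fun ω => ∑ t ∈ Finset.Icc 1 n, (g t ω (a t ω)
        + r t ω * h t ω (a t ω) - compensator (θ t ω) (ε t ω) (p t ω) (g t ω) (h t ω))) ∧
      (∀ ω, ∑ t ∈ Finset.Icc 1 n, (g t ω (a t ω) + r t ω * h t ω (a t ω)
        - compensator (θ t ω) (ε t ω) (p t ω) (g t ω) (h t ω)) ≤ b) ∧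
      ∫ ω, Real.exp (∑ t ∈ Finset.Icc 1 n, (g t ω (a t ω) + r t ω * h t ω (a t ω)
        - compensator (θ t ω) (ε t ω) (p t ω) (g t ω) (h t ω))) ∂P ≤ 1 := by
  induction n with
  | zero => exact ⟨0, by simp, by simp, by simp⟩
  | succ n ih =>
    obtain ⟨b, h1, h2, h3⟩ := ih (by omega)
    have ht : n + 1 ∈ Finset.Icc 1 T := Finset.mem_Icc.2 ⟨by omega, hn⟩
    set S : Ω → ℝ := fun ω => ∑ t ∈ Finset.Icc 1 n, (g t ω (a t ω) + r t ω * h t ω (a t ω)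
        - compensator (θ t ω) (ε t ω) (p t ω) (g t ω) (h t ω)) with hS
    set t := n + 1 with htd
    have hm : ℱ n ≤ mΩ := ℱ.le n
    have hmt : ℱ n ≤ ℱ t := ℱ.mono (by omega)
    have htn : t - 1 = n := by omega
    have hgm' := hgm t ht
    have hhm' := hhm t ht
    have hθm : ∀ v, Measurable[ℱ n] fun ω => v ⬝ᵥ θ t ω := fun v =>
      htn ▸ hb.measurable_inner ht v
    have hεm : ∀ x, Measurable[ℱ (t - 1)] fun ω => ε t ω x := fun x =>
      (measurable_pi_apply x).comp (hb.measurable_eps t ht)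
    have hpm : ∀ x, Measurable[ℱ (t - 1)] fun ω => p t ω x := fun x =>
      (measurable_pi_apply x).comp (hb.measurable_dist t ht)
    have hlaw := hb.action_law t ht
    have hmean := hb.reward_mean t ht
    rw [htn] at hgm' hhm' hεm hpm hlaw hmean
    have hRm : ∀ x : A, Measurable[ℱ n] fun ω => x.1 ⬝ᵥ θ t ω + ε t ω x := fun x =>
      (hθm x.1).add (hεm x)
    have hcm : Measurable[ℱ n] fun ω =>
        compensator (θ t ω) (ε t ω) (p t ω) (g t ω) (h t ω) := by
      refine Finset.measurable_sum _ fun x _ => ?_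
      exact (hpm x).mul ((((hgm' x).add (((hgm' x).pow_const 2).const_mul 2)).add
        (((hhm' x).pow_const 2).const_mul 2)).add ((hRm x).mul (hhm' x)))
    have hR : ∀ ω (x : A), |x.1 ⬝ᵥ θ t ω + ε t ω x| ≤ 1 + C := fun ω x =>
      (abs_add_le _ _).trans (add_le_add (hb.abs_inner_le t ht ω x.1 x.2) (hb.abs_eps_le ht ω x))
    have hg1 : ∀ ω x, |g t ω x| ≤ 1 := fun ω x => by
      linarith [hgh t ht ω x, abs_nonneg (h t ω x)]
    have hh1 : ∀ ω x, |h t ω x| ≤ 1 := fun ω x => by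
      linarith [hgh t ht ω x, abs_nonneg (g t ω x)]
    have hcb : ∀ ω, |compensator (θ t ω) (ε t ω) (p t ω) (g t ω) (h t ω)| ≤ 6 + C := fun ω => by
      refine (Finset.abs_sum_le_sum_abs _ _).trans ?_
      have e : 6 + C = ∑ x : A, p t ω x * (6 + C) := by
        rw [← Finset.sum_mul, (hp t ht ω).2, one_mul]
      rw [e]
      refine Finset.sum_le_sum fun x _ => ?_
      rw [abs_mul, abs_of_nonneg ((hp t ht ω).1 x)]
      refine mul_le_mul_of_nonneg_left ?_ ((hp t ht ω).1 x)
      have h5 := abs_le.1 (hg1 ω x)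
      have h6 : |(x.1 ⬝ᵥ θ t ω + ε t ω x) * h t ω x| ≤ 1 + C := by
        rw [abs_mul]
        exact (mul_le_of_le_one_right (abs_nonneg _) (hh1 ω x)).trans (hR ω x)
      have h7 := abs_le.1 h6
      have h8 := abs_le.1 (hh1 ω x)
      rw [abs_le]
      constructor <;> nlinarith [sq_nonneg (g t ω x), sq_nonneg (h t ω x)]
    have hsel : ∀ f : Ω → A → ℝ, (∀ x, Measurable[ℱ n] fun ω => f ω x) →
        Measurable[ℱ t] fun ω => f ω (a t ω) := by
      intro f hf
      have : (fun ω => f ω (a t ω)) = fun ω => ∑ x : A,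
          ((a t) ⁻¹' {x}).indicator (fun _ => (1 : ℝ)) ω * f ω x := by
        ext ω; rw [sum_indicator_mul (a t) (f ω) ω]
      rw [this]
      refine Finset.measurable_sum _ fun x _ => Measurable.mul ?_ ((hf x).mono hmt le_rfl)
      exact Measurable.indicator measurable_const
        (hb.measurable_action t ht (measurableSet_singleton x))
    have hYm : Measurable[ℱ t] fun ω => g t ω (a t ω) + r t ω * h t ω (a t ω)
        - compensator (θ t ω) (ε t ω) (p t ω) (g t ω) (h t ω) :=
      ((hsel _ hgm').add ((hb.measurable_reward t ht).mul (hsel _ hhm'))).sub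
        (hcm.mono hmt le_rfl)
    have hy1 : ∀ ω, g t ω (a t ω) + r t ω * h t ω (a t ω) ≤ 1 := fun ω => by
      have h5 : |r t ω * h t ω (a t ω)| ≤ |h t ω (a t ω)| := by
        rw [abs_mul]
        exact mul_le_of_le_one_left (abs_nonneg _) (hb.abs_reward_le t ht ω)
      linarith [le_abs_self (g t ω (a t ω)), le_abs_self (r t ω * h t ω (a t ω)),
        hgh t ht ω (a t ω)]
    have hsplit : ∀ f : ℕ → ℝ, ∑ s ∈ Finset.Icc 1 t, f s = ∑ s ∈ Finset.Icc 1 n, f s + f t :=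
      fun f => Finset.sum_Icc_succ_top (by omega) f
    simp only [hsplit]
    refine ⟨b + (1 + (6 + C)), (h1.mono hmt le_rfl).add hYm, fun ω => ?_, ?_⟩
    · have := h2 ω
      linarith [(abs_le.1 (hcb ω)).1, hy1 ω]
    · have hWm : Measurable[ℱ n] fun ω => Real.exp (S ω
          - compensator (θ t ω) (ε t ω) (p t ω) (g t ω) (h t ω)) :=
        Real.measurable_exp.comp (h1.sub hcm)
      have hWb : ∀ ω, Real.exp (S ω - compensator (θ t ω) (ε t ω) (p t ω) (g t ω) (h t ω))
          ≤ Real.exp (b + (6 + C)) := fun ω =>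
        Real.exp_le_exp.2 (by have := h2 ω; linarith [(abs_le.1 (hcb ω)).1])
      have key := integral_mul_exp_le hm P
        ((hb.measurable_action t ht).mono (ℱ.le t) le_rfl)
        ((hb.measurable_reward t ht).mono (ℱ.le t) le_rfl) (hb.abs_reward_le t ht) hpm
        (hp t ht) hRm hR hlaw hmean hgm' hhm' (hgh t ht) hWm (fun ω => (Real.exp_pos _).le) hWb
      refine le_trans (le_of_eq ?_) (key.trans (le_trans ?_ h3))
      · refine integral_congr_ae (Filter.Eventually.of_forall fun ω => ?_)
        simp only
        rw [← Real.exp_add]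
        congr 1
        ring
      · refine integral_mono (Integrable.of_bound
            (C := Real.exp (b + (6 + C)) * (1 + (6 + C))) (Measurable.aestronglyMeasurable
              ((hWm.mul (measurable_const.add hcm)).mono hm le_rfl))
            (Filter.Eventually.of_forall fun ω => ?_))
          (Integrable.of_bound (C := Real.exp b)
            (Real.measurable_exp.comp (h1.mono hm le_rfl)).aestronglyMeasurable
            (Filter.Eventually.of_forall fun ω => by
              rw [Real.norm_of_nonneg (Real.exp_pos _).le]
              exact Real.exp_le_exp.2 (h2 ω)))
          (fun ω => ?_)
        · rw [norm_mul, Real.norm_of_nonneg (Real.exp_pos _).le, Real.norm_eq_abs]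
          refine mul_le_mul (hWb ω) ((abs_add_le _ _).trans ?_) (abs_nonneg _) (Real.exp_pos _).le
          rw [abs_one]
          exact add_le_add le_rfl (hcb ω)
        · change Real.exp (S ω - compensator (θ t ω) (ε t ω) (p t ω) (g t ω) (h t ω))
            * (1 + compensator (θ t ω) (ε t ω) (p t ω) (g t ω) (h t ω)) ≤ Real.exp (S ω)
          -- The one-step factor 1 + c_t is at most e^{c_t}, which cancels the subtracted
          -- compensator.
          have := Real.add_one_le_exp (compensator (θ t ω) (ε t ω) (p t ω) (g t ω) (h t ω))
          calc _ ≤ Real.exp (S ω - compensator (θ t ω) (ε t ω) (p t ω) (g t ω) (h t ω))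
                * Real.exp (compensator (θ t ω) (ε t ω) (p t ω) (g t ω) (h t ω)) :=
                mul_le_mul_of_nonneg_left (by linarith) (Real.exp_pos _).le
            _ = _ := by rw [← Real.exp_add, sub_add_cancel]

/-- A uniform tail bound for finitely many exponential supermartingales. -/
theorem IsMisspecifiedBandit.le_measureReal_forall_sum_le [IsProbabilityMeasure P]
    (hb : IsMisspecifiedBandit P ℱ T C θ ε p a r)
    (hp : ∀ t ∈ Finset.Icc 1 T, ∀ ω, p t ω ∈ stdSimplex ℝ A) {κ : Type*} [Fintype κ] [Nonempty κ]
    {g h : κ → ℕ → Ω → A → ℝ}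
    (hgm : ∀ i, ∀ t ∈ Finset.Icc 1 T, ∀ x, Measurable[ℱ (t - 1)] fun ω => g i t ω x)
    (hhm : ∀ i, ∀ t ∈ Finset.Icc 1 T, ∀ x, Measurable[ℱ (t - 1)] fun ω => h i t ω x)
    (hgh : ∀ i, ∀ t ∈ Finset.Icc 1 T, ∀ ω x, |g i t ω x| + |h i t ω x| ≤ 1) {δ : ℝ} (hδ : 0 < δ) :
    1 - δ ≤ P.real {ω | ∀ i, ∑ t ∈ Finset.Icc 1 T, (g i t ω (a t ω) + r t ω * h i t ω (a t ω)
      - compensator (θ t ω) (ε t ω) (p t ω) (g i t ω) (h i t ω))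
        ≤ Real.log (Fintype.card κ / δ)} := by
  set S : κ → Ω → ℝ := fun i ω => ∑ t ∈ Finset.Icc 1 T, (g i t ω (a t ω)
    + r t ω * h i t ω (a t ω) - compensator (θ t ω) (ε t ω) (p t ω) (g i t ω) (h i t ω)) with hS
  have hN : (0 : ℝ) < Fintype.card κ := by exact_mod_cast Fintype.card_pos
  have hx : 0 < Fintype.card κ / δ := div_pos hN hδ
  have hmeas : ∀ i, Measurable (S i) := fun i => by
    obtain ⟨b, h1, -, -⟩ := hb.integral_exp_le hp (hgm i) (hhm i) (hgh i) le_rfl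
    exact h1.mono (ℱ.le T) le_rfl
  have hsingle : ∀ i, P.real {ω | Real.log (Fintype.card κ / δ) < S i ω}
      ≤ δ / Fintype.card κ := by
    intro i
    obtain ⟨b, h1, h2, h3⟩ := hb.integral_exp_le hp (hgm i) (hhm i) (hgh i) le_rfl
    have hint : Integrable (fun ω => Real.exp (S i ω)) P :=
      Integrable.of_bound (C := Real.exp b) (Real.measurable_exp.comp (hmeas i)).aestronglyMeasurable
        (Filter.Eventually.of_forall fun ω => by
          rw [Real.norm_of_nonneg (Real.exp_pos _).le]
          exact Real.exp_le_exp.2 (h2 ω))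
    have h4 := mul_meas_ge_le_integral_of_nonneg
      (Filter.Eventually.of_forall fun ω => (Real.exp_pos (S i ω)).le) hint (Fintype.card κ / δ)
    have h5 : P.real {ω | Real.log (Fintype.card κ / δ) < S i ω}
        ≤ P.real {ω | Fintype.card κ / δ ≤ Real.exp (S i ω)} :=
      measureReal_mono fun ω hω => ((Real.log_lt_iff_lt_exp hx).1 hω).le
    have h6 : (Fintype.card κ / δ) * P.real {ω | Real.log (Fintype.card κ / δ) < S i ω} ≤ 1 :=
      (mul_le_mul_of_nonneg_left h5 hx.le).trans (h4.trans h3)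
    rw [le_div_iff₀ hN]
    rw [div_mul_eq_mul_div, div_le_one hδ] at h6
    linarith
  have hbad : {ω | ∀ i, S i ω ≤ Real.log (Fintype.card κ / δ)}ᶜ
      = ⋃ i ∈ (Finset.univ : Finset κ), {ω | Real.log (Fintype.card κ / δ) < S i ω} := by
    ext ω; simp
  have hgood : MeasurableSet {ω | ∀ i, S i ω ≤ Real.log (Fintype.card κ / δ)} := by
    rw [Set.ofPred_forall]
    exact MeasurableSet.iInter fun i => measurableSet_le (hmeas i) measurable_const
  have h7 := probReal_add_probReal_compl (μ := P) hgood
  have h8 : P.real {ω | ∀ i, S i ω ≤ Real.log (Fintype.card κ / δ)}ᶜ ≤ δ := by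
    rw [hbad]
    refine (measureReal_biUnion_finset_le _ _).trans ?_
    refine (Finset.sum_le_sum fun i _ => hsingle i).trans (le_of_eq ?_)
    rw [Finset.sum_const, Finset.card_univ, nsmul_eq_mul]
    field_simp
  linarith

end Concentration

/-! ### A finite net of actions. -/

section Net

/-- Rounding each coordinate leaves 2m + 1 values; one representative per occupied cell keeps the
net inside the index set. -/
theorem exists_grid_net {ι : Type*} [Fintype ι] {d : ℕ} (f : ι → Fin d → ℝ)
    {b : ℝ} (hb : 0 < b) (hf : ∀ x i, |f x i| ≤ b) {m : ℕ} (hm : 1 ≤ m) :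
    ∃ N : Finset ι, N.card ≤ (2 * m + 1) ^ d ∧
      ∀ x, ∃ y ∈ N, ∀ i, |f x i - f y i| ≤ b / m := by
  classical
  have hm0 : (0 : ℝ) < m := by exact_mod_cast hm
  have hlt : ∀ x i, ⌊(f x i + b) * m / b⌋₊ < 2 * m + 1 := by
    intro x i
    have h := abs_le.1 (hf x i)
    rw [Nat.lt_succ_iff]
    refine Nat.floor_le_of_le ?_
    rw [div_le_iff₀ hb]
    push_cast
    nlinarith
  let cell : ι → Fin d → Fin (2 * m + 1) := fun x i => ⟨⌊(f x i + b) * m / b⌋₊, hlt x i⟩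
  choose s hs using fun c : Finset.univ.image cell => Finset.mem_image.1 c.2
  refine ⟨Finset.univ.image s, ?_, fun x => ?_⟩
  · refine Finset.card_image_le.trans ?_
    rw [Finset.card_univ, Fintype.card_coe]
    refine (Finset.card_le_univ _).trans ?_
    simp
  · have hx : cell x ∈ Finset.univ.image cell := Finset.mem_image_of_mem _ (Finset.mem_univ _)
    refine ⟨s ⟨cell x, hx⟩, Finset.mem_image_of_mem _ (Finset.mem_univ _), fun i => ?_⟩
    have h1 : ⌊(f (s ⟨cell x, hx⟩) i + b) * m / b⌋₊ = ⌊(f x i + b) * m / b⌋₊ :=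
      congrArg Fin.val (congrFun (hs ⟨cell x, hx⟩).2 i)
    set y := s ⟨cell x, hx⟩
    have hpos : ∀ z, 0 ≤ (f z i + b) * m / b := fun z =>
      div_nonneg (mul_nonneg (by linarith [(abs_le.1 (hf z i)).1]) hm0.le) hb.le
    have h2 := Nat.floor_le (hpos x)
    have h3 := Nat.lt_floor_add_one ((f x i + b) * m / b)
    have h4 := Nat.floor_le (hpos y)
    have h5 := Nat.lt_floor_add_one ((f y i + b) * m / b)
    rw [h1] at h4 h5
    have h6 : |(f x i - f y i) * m / b| ≤ 1 := by
      have : (f x i - f y i) * m / b = (f x i + b) * m / b - (f y i + b) * m / b := by ring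
      rw [this, abs_le]
      constructor <;> linarith
    rw [abs_div, abs_mul, abs_of_pos hm0, abs_of_pos hb, div_le_one hb] at h6
    rwa [le_div_iff₀ hm0]

variable {d : ℕ} {A : Finset (Fin d → ℝ)}

theorem IsSpread.pos {β : ℝ} {p : A → ℝ} (hp : IsSpread β p) : 0 < β := by
  by_contra hβ
  have hne : Nonempty A := by
    by_contra h
    rw [not_nonempty_iff] at h
    have := hp.mem.2
    rw [Finset.univ_eq_empty, Finset.sum_empty] at this
    exact zero_ne_one this
  obtain ⟨a⟩ := hne
  have h1 := hp.sq_le a (Sum.elim 0 fun _ => 1)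
  simp only [dotProduct_liftVec, Sum.elim_comp_inl, Sum.elim_inr, zero_dotProduct, zero_add,
    one_pow, mul_one, hp.mem.2] at h1
  linarith

theorem IsSpread.mono {β β' : ℝ} {p : A → ℝ} (hp : IsSpread β p) (h : β ≤ β') : IsSpread β' p :=
  ⟨hp.mem, hp.posDef, fun a z => (hp.sq_le a z).trans (mul_le_mul_of_nonneg_right h
    (Finset.sum_nonneg fun b _ => mul_nonneg (hp.mem.1 b) (sq_nonneg _)))⟩

/-- A finite subset of the actions that is a net for the norm given by `Σ(ρ)⁻¹`. -/
theorem IsSpread.exists_net {β : ℝ} {ρ : A → ℝ} (hρ : IsSpread β ρ) {m : ℕ} (hm : 1 ≤ m) :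
    ∃ N : Finset A, N.card ≤ (2 * m + 1) ^ d ∧ ∀ x : A, ∃ y ∈ N,
      (x.1 - y.1) ⬝ᵥ ((secondMoment ρ)⁻¹ *ᵥ (x.1 - y.1)) ≤ d * β / m ^ 2 := by
  obtain ⟨Q, -, hQt, hQ, -⟩ := exists_posDef_mul_self hρ.secondMoment_posDef.inv
  have hβ := hρ.pos
  have hquad : ∀ v : Fin d → ℝ, v ⬝ᵥ ((secondMoment ρ)⁻¹ *ᵥ v) = ∑ i, (Q *ᵥ v) i ^ 2 := by
    intro v
    rw [hQ, ← Matrix.mulVec_mulVec, Matrix.dotProduct_mulVec, ← Matrix.mulVec_transpose, hQt]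
    simp only [dotProduct, sq]
  obtain ⟨N, hN, h⟩ := exists_grid_net (fun (x : A) => Q *ᵥ x.1) (Real.sqrt_pos.2 hβ)
    (fun x i => Real.abs_le_sqrt (by
      have h1 := hρ.quad_inv_action_le x
      rw [hquad] at h1
      exact (Finset.single_le_sum (f := fun i => (Q *ᵥ x.1) i ^ 2) (fun i _ => sq_nonneg _)
        (Finset.mem_univ i)).trans h1)) hm
  refine ⟨N, hN, fun x => ?_⟩
  obtain ⟨y, hy, hxy⟩ := h x
  refine ⟨y, hy, ?_⟩
  rw [hquad]
  calc ∑ i, (Q *ᵥ (x.1 - y.1)) i ^ 2 ≤ ∑ i : Fin d, β / m ^ 2 := by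
        refine Finset.sum_le_sum fun i _ => ?_
        rw [Matrix.mulVec_sub, Pi.sub_apply, ← Real.sq_sqrt hβ.le, ← div_pow]
        exact sq_le_sq' (by linarith [(abs_le.1 (hxy i)).1]) (abs_le.1 (hxy i)).2
    _ = d * β / m ^ 2 := by simp; ring

end Net

/-! ### One-round moments of the deviation. -/

section Rounds

variable {d : ℕ} {A : Finset (Fin d → ℝ)}

/-- The inverse is the adjugate times the inverse determinant, which is measurable even across
singular matrices. -/
theorem measurable_inv_secondMoment (i j : Fin d) :
    Measurable fun p : A → ℝ => (secondMoment p)⁻¹ i j := by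
  have hc : Continuous fun p : A → ℝ => secondMoment p := by
    unfold secondMoment
    fun_prop
  have h1 : Measurable fun p : A → ℝ => (secondMoment p).det := hc.matrix_det.measurable
  have h2 : Measurable fun p : A → ℝ => (secondMoment p).adjugate i j :=
    (hc.matrix_adjugate.matrix_elem i j).measurable
  simp only [Matrix.inv_def, Ring.inverse_eq_inv', Matrix.smul_apply, smul_eq_mul]
  exact h1.inv.mul h2

theorem measurable_inner_inv_secondMoment {u : (A → ℝ) → Fin d → ℝ} (hu : Measurable u)
    (v : Fin d → ℝ) : Measurable fun p : A → ℝ => u p ⬝ᵥ ((secondMoment p)⁻¹ *ᵥ v) := by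
  refine Finset.measurable_sum _ fun i _ => ((measurable_pi_apply i).comp hu).mul ?_
  have : Measurable fun p : A → ℝ => ∑ j, (secondMoment p)⁻¹ i j * v j :=
    Finset.measurable_sum _ fun j _ => (measurable_inv_secondMoment i j).mul_const _
  exact this

theorem measurable_mean : Measurable fun p : A → ℝ => mean p := by
  have : Continuous fun p : A → ℝ => mean p := by
    unfold mean
    fun_prop
  exact this.measurable

theorem quad_add_le {M : Matrix (Fin d) (Fin d) ℝ} (hM : M.PosSemidef) (v w : Fin d → ℝ) :
    (v + w) ⬝ᵥ (M *ᵥ (v + w)) ≤ 2 * (v ⬝ᵥ (M *ᵥ v)) + 2 * (w ⬝ᵥ (M *ᵥ w)) := by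
  have h := hM.quad_nonneg (v - w)
  simp only [Matrix.mulVec_add, Matrix.mulVec_sub, dotProduct_add, add_dotProduct, dotProduct_sub,
    sub_dotProduct] at h ⊢
  linarith

/-- The part of the one-round deviation that does not involve the observed reward. -/
noncomputable def actionTerm (l η : ℝ) (x θ : Fin d → ℝ) (p : A → ℝ) (a : A) : ℝ :=
  l * ((x - a.1) ⬝ᵥ θ + 2 * η * (a.1 ⬝ᵥ ((secondMoment p)⁻¹ *ᵥ a.1)))

/-- The coefficient of the observed reward in the one-round deviation. -/
noncomputable def rewardTerm (l : ℝ) (x : Fin d → ℝ) (p : A → ℝ) (a : A) : ℝ :=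
  -(l * ((x - mean p) ⬝ᵥ ((secondMoment p)⁻¹ *ᵥ a.1)))

theorem actionTerm_add_rewardTerm (l η : ℝ) (x θ : Fin d → ℝ) (p : A → ℝ) (a : A) (r : ℝ) :
    actionTerm l η x θ p a + r * rewardTerm l x p a
      = l * ((x - a.1) ⬝ᵥ θ + 2 * η * (a.1 ⬝ᵥ ((secondMoment p)⁻¹ *ᵥ a.1))
        - (x - mean p) ⬝ᵥ estimator p a r) := by
  rw [actionTerm, rewardTerm, estimator, dotProduct_smul, smul_eq_mul]
  ring

namespace IsSpread

variable {β : ℝ} {p : A → ℝ} (hp : IsSpread β p)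

include hp

theorem quad_inv_sub_mean_le (x : Fin d → ℝ) :
    (x - mean p) ⬝ᵥ ((secondMoment p)⁻¹ *ᵥ (x - mean p))
      ≤ 2 * (x ⬝ᵥ ((secondMoment p)⁻¹ *ᵥ x)) + 2 := by
  have h := quad_add_le hp.secondMoment_posDef.inv.posSemidef x (-mean p)
  rw [← sub_eq_add_neg, Matrix.mulVec_neg, neg_dotProduct_neg] at h
  linarith [hp.quad_inv_mean_le]

theorem abs_actionTerm_add_le {l η : ℝ} (hl : 0 ≤ l) (hη : 0 ≤ η) (hη1 : η ≤ 1) (hβ : 2 ≤ β)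
    (hlβ : 8 * β * l ≤ 1) {θ : Fin d → ℝ} (hθ : ∀ b : A, |b.1 ⬝ᵥ θ| ≤ 1) (x a : A) :
    |actionTerm l η x.1 θ p a| + |rewardTerm l x.1 p a| ≤ 1 := by
  have hS := hp.secondMoment_posDef.inv.posSemidef
  have h1 := hp.quad_inv_action_le a
  have h2 := hS.quad_nonneg a.1
  have h3 : |(x.1 - a.1) ⬝ᵥ θ + 2 * η * (a.1 ⬝ᵥ ((secondMoment p)⁻¹ *ᵥ a.1))| ≤ 2 + 2 * β := by
    refine (abs_add_le _ _).trans (add_le_add ?_ ?_)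
    · rw [sub_dotProduct]
      exact (abs_sub _ _).trans (by linarith [hθ x, hθ a])
    · rw [abs_of_nonneg (by positivity)]
      nlinarith
  have h4 : |(x.1 - mean p) ⬝ᵥ ((secondMoment p)⁻¹ *ᵥ a.1)| ≤ 2 * β := by
    refine abs_le_of_sq_le_sq ?_ (by linarith)
    refine (sq_dotProduct_mulVec_le hS _ _).trans ?_
    have h5 := hp.quad_inv_sub_mean_le x.1
    have h6 := hp.quad_inv_action_le x
    have h7 := hS.quad_nonneg (x.1 - mean p)
    calc _ ≤ (2 * β + 2) * β := mul_le_mul (by linarith) h1 h2 (by linarith)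
      _ ≤ _ := by nlinarith
  rw [actionTerm, rewardTerm, abs_neg, abs_mul, abs_mul, abs_of_nonneg hl]
  calc _ ≤ l * (2 + 2 * β) + l * (2 * β) :=
        add_le_add (mul_le_mul_of_nonneg_left h3 hl) (mul_le_mul_of_nonneg_left h4 hl)
    _ ≤ 1 := by nlinarith [mul_nonneg hl (by linarith : 0 ≤ β - 2)]

/-- Unbiasedness cancels the θ-terms at first order in l. What remains is the mean stability cost
2ηd and the misspecification bias e·E|k| ≤ e·s, where k(a) = (x − μ)ᵀΣ⁻¹a. At second order, E k² ≤
2‖x‖² + 2 in the norm of Σ⁻¹, and the stability cost is square-integrable at scale d because η²β ≤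
2. -/
theorem compensator_le {l η e s : ℝ} (hl : 0 ≤ l) (hd : 1 ≤ d) (hηβ : η ^ 2 * β ≤ 2) (he : 0 ≤ e)
    {θ : Fin d → ℝ} {ε : A → ℝ} (hθ : ∀ b : A, |b.1 ⬝ᵥ θ| ≤ 1) (hε : ∀ b, |ε b| ≤ e) (x : A)
    (hs : 0 ≤ s) (hxs : 2 * (x.1 ⬝ᵥ ((secondMoment p)⁻¹ *ᵥ x.1)) + 2 ≤ s ^ 2) :
    compensator θ ε p (actionTerm l η x.1 θ p) (rewardTerm l x.1 p)
      ≤ l * (2 * η * d + e * s)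
        + l ^ 2 * (52 * d + 4 * (x.1 ⬝ᵥ ((secondMoment p)⁻¹ *ᵥ x.1))) := by
  have hS := hp.secondMoment_posDef.inv.posSemidef
  have hp0 := hp.mem.1
  set q : A → ℝ := fun b => b.1 ⬝ᵥ ((secondMoment p)⁻¹ *ᵥ b.1) with hq
  set k : A → ℝ := fun b => (x.1 - mean p) ⬝ᵥ ((secondMoment p)⁻¹ *ᵥ b.1) with hk
  have hq0 : ∀ b, 0 ≤ q b := fun b => hS.quad_nonneg b.1
  have hqβ : ∀ b, q b ≤ β := fun b => hp.quad_inv_action_le b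
  have hqd : ∑ b, p b * q b = d := hp.sum_quad_inv
  have hk2 : ∑ b, p b * k b ^ 2 ≤ 2 * q x + 2 :=
    (hp.sum_sq_inner_inv _).le.trans (hp.quad_inv_sub_mean_le x.1)
  have hkθ : ∑ b : A, p b * (k b * (b.1 ⬝ᵥ θ)) = (x.1 - mean p) ⬝ᵥ θ := hp.sum_mul_inner_inv _ _
  have hmθ : ∑ b : A, p b * ((x.1 - b.1) ⬝ᵥ θ) = (x.1 - mean p) ⬝ᵥ θ := by
    simp only [sub_dotProduct, mul_sub, Finset.sum_sub_distrib, mean_dotProduct, ← Finset.sum_mul,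
      hp.mem.2, one_mul]
  have hkabs : ∑ b, p b * |k b| ≤ s := by
    have hj := (even_two.convexOn_pow : ConvexOn ℝ Set.univ fun x : ℝ => x ^ 2).map_sum_le
      (t := Finset.univ) (w := p) (p := fun a : A => |k a|) (fun a _ => hp0 a) hp.mem.2
      (fun a _ => Set.mem_univ _)
    simp only [smul_eq_mul, sq_abs] at hj
    exact abs_le_of_sq_le_sq' (hj.trans (hk2.trans hxs)) hs |>.2
  have hkε : -∑ b, p b * (k b * ε b) ≤ e * s := by
    rw [← Finset.sum_neg_distrib]
    calc _ ≤ ∑ b, e * (p b * |k b|) := by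
          refine Finset.sum_le_sum fun b _ => ?_
          have h1 : |k b * ε b| ≤ |k b| * e := by
            rw [abs_mul]; exact mul_le_mul_of_nonneg_left (hε b) (abs_nonneg _)
          nlinarith [neg_abs_le (k b * ε b), hp0 b]
      _ ≤ e * s := by rw [← Finset.mul_sum]; exact mul_le_mul_of_nonneg_left hkabs he
  have hg2 : ∑ b : A, p b * ((x.1 - b.1) ⬝ᵥ θ + 2 * η * q b) ^ 2 ≤ 24 * (d : ℝ) := by
    have hd1 : (1 : ℝ) ≤ d := by exact_mod_cast hd
    calc _ ≤ ∑ b, (p b * 8 + 16 * (p b * q b)) := by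
          refine Finset.sum_le_sum fun b _ => ?_
          have h1 : ((x.1 - b.1) ⬝ᵥ θ) ^ 2 ≤ 4 := by
            have h1 : |(x.1 - b.1) ⬝ᵥ θ| ≤ 2 := by
              rw [sub_dotProduct]
              exact (abs_sub _ _).trans (by linarith [hθ x, hθ b])
            nlinarith [abs_le.1 h1]
          have h2 : η ^ 2 * q b ^ 2 ≤ 2 * q b := by
            have := mul_le_mul_of_nonneg_left (hqβ b) (sq_nonneg η)
            nlinarith [hq0 b]
          have h3 : ((x.1 - b.1) ⬝ᵥ θ + 2 * η * q b) ^ 2 ≤ 8 + 16 * q b := by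
            nlinarith [sq_nonneg ((x.1 - b.1) ⬝ᵥ θ - 2 * η * q b)]
          nlinarith [mul_le_mul_of_nonneg_left h3 (hp0 b)]
      _ = 8 + 16 * d := by
          rw [Finset.sum_add_distrib, ← Finset.sum_mul, ← Finset.mul_sum, hp.mem.2, hqd, one_mul]
      _ ≤ _ := by linarith
  have hsplit : compensator θ ε p (actionTerm l η x.1 θ p) (rewardTerm l x.1 p)
      = l * (∑ b : A, p b * ((x.1 - b.1) ⬝ᵥ θ) + 2 * η * ∑ b, p b * q b
          - ∑ b : A, p b * (k b * (b.1 ⬝ᵥ θ)) + -∑ b, p b * (k b * ε b))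
        + l ^ 2 * (2 * ∑ b : A, p b * ((x.1 - b.1) ⬝ᵥ θ + 2 * η * q b) ^ 2
          + 2 * ∑ b, p b * k b ^ 2) := by
    simp only [compensator, actionTerm, rewardTerm, Finset.mul_sum, ← Finset.sum_add_distrib,
      ← Finset.sum_sub_distrib, ← Finset.sum_neg_distrib]
    refine Finset.sum_congr rfl fun b _ => ?_
    simp only [hq, hk]
    ring
  rw [hsplit, hmθ, hkθ, hqd]
  refine add_le_add (mul_le_mul_of_nonneg_left (by linarith) hl)
    (mul_le_mul_of_nonneg_left ?_ (sq_nonneg l))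
  have hd1 : (1 : ℝ) ≤ d := by exact_mod_cast hd
  change _ ≤ 52 * d + 4 * q x
  linarith

/-- This and the next lemma transfer the deviation from a net point to a nearby action, for the true
and the estimated rewards. -/
theorem abs_inner_le_of_quad_inv_le {v θ : Fin d → ℝ} {c : ℝ} (hc : 0 ≤ c)
    (hv : v ⬝ᵥ ((secondMoment p)⁻¹ *ᵥ v) ≤ c ^ 2) (hθ : ∀ b : A, |b.1 ⬝ᵥ θ| ≤ 1) :
    |v ⬝ᵥ θ| ≤ c := by
  refine abs_le_of_sq_le_sq ?_ hc
  refine (sq_dotProduct_le hp.secondMoment_posDef v θ).trans ?_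
  have h1 : θ ⬝ᵥ (secondMoment p *ᵥ θ) ≤ 1 := by
    rw [secondMoment_bilin, ← hp.mem.2]
    refine Finset.sum_le_sum fun b _ => mul_le_of_le_one_right (hp.mem.1 b) ?_
    rw [dotProduct_comm θ]
    have := abs_le.1 (hθ b)
    nlinarith
  have h2 := hp.secondMoment_posDef.inv.posSemidef.quad_nonneg v
  have h3 := hp.secondMoment_posDef.posSemidef.quad_nonneg θ
  nlinarith

theorem abs_inner_estimator_le_of_quad_inv_le {v : Fin d → ℝ} {c : ℝ} (hc : 0 ≤ c) (hβ : 1 ≤ β)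
    (hv : v ⬝ᵥ ((secondMoment p)⁻¹ *ᵥ v) ≤ c ^ 2) (a : A) {r : ℝ} (hr : |r| ≤ 1) :
    |v ⬝ᵥ estimator p a r| ≤ c * β := by
  have hS := hp.secondMoment_posDef.inv.posSemidef
  rw [estimator, dotProduct_smul, smul_eq_mul, abs_mul]
  refine (mul_le_of_le_one_left (abs_nonneg _) hr).trans ?_
  refine abs_le_of_sq_le_sq ?_ (by positivity)
  refine (sq_dotProduct_mulVec_le hS v a.1).trans ?_
  have h1 := hp.quad_inv_action_le a
  have h2 := hS.quad_nonneg a.1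
  calc _ ≤ c ^ 2 * β := mul_le_mul hv h1 h2 (sq_nonneg c)
    _ ≤ c ^ 2 * β ^ 2 := mul_le_mul_of_nonneg_left (by nlinarith) (sq_nonneg c)
    _ = _ := by ring

end IsSpread

end Rounds

/-! ### Deterministic regret bounds on the good event. -/

section Pathwise

variable {d : ℕ} {A : Finset (Fin d → ℝ)} {T : ℕ} {β η α C L : ℝ} {N : Finset A}
  {θ : ℕ → Fin d → ℝ} {ε p : ℕ → A → ℝ} {a : ℕ → A} {r e : ℕ → ℝ}

/-- The cumulative deviation towards a fixed action, on the event where the exponential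
supermartingales of the net are controlled. -/
theorem sum_deviation_le (hd : 1 ≤ d) (hT : 1 ≤ T) (hβ : 2 ≤ β) (hηβ : η ^ 2 * β ≤ 2)
    (hα : 0 < α) (hTα : T / β ≤ α / 2) (hp : ∀ t ∈ Finset.Icc 1 T, IsSpread β (p t))
    (hθ : ∀ t ∈ Finset.Icc 1 T, ∀ b : A, |b.1 ⬝ᵥ θ t| ≤ 1)
    (hr : ∀ t ∈ Finset.Icc 1 T, |r t| ≤ 1) (he : ∀ t ∈ Finset.Icc 1 T, 0 ≤ e t)
    (hε : ∀ t ∈ Finset.Icc 1 T, ∀ b, |ε t b| ≤ e t) (hC : ∑ t ∈ Finset.Icc 1 T, e t ≤ C)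
    (hN : ∀ x : A, ∃ y ∈ N, ∀ t ∈ Finset.Icc 1 T,
      (x.1 - y.1) ⬝ᵥ ((secondMoment (p t))⁻¹ *ᵥ (x.1 - y.1)) ≤ (1 / (T : ℝ)) ^ 2)
    (hgood : ∀ y ∈ N, ∑ t ∈ Finset.Icc 1 T,
      (actionTerm (1 / (8 * β)) η y.1 (θ t) (p t) (a t)
        + r t * rewardTerm (1 / (8 * β)) y.1 (p t) (a t)
        - compensator (θ t) (ε t) (p t) (actionTerm (1 / (8 * β)) η y.1 (θ t) (p t))
          (rewardTerm (1 / (8 * β)) y.1 (p t))) ≤ L) (x : A) :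
    ∑ t ∈ Finset.Icc 1 T, ((x.1 - (a t).1) ⬝ᵥ θ t
        + 2 * η * ((a t).1 ⬝ᵥ ((secondMoment (p t))⁻¹ *ᵥ (a t).1))
        - (x.1 - mean (p t)) ⬝ᵥ estimator (p t) (a t) (r t))
      ≤ 3 / 4 * α * (x.1 ⬝ᵥ (bonusSeq p T *ᵥ x.1))
        + (8 * β * L + 2 * η * d * T + 7 * d * (T / β) + 3 / 8 * α + 4 * C ^ 2 / α + T / β
          + 1 + β) := by
  obtain ⟨y, hy, hxy⟩ := hN x
  have hT0 : (0 : ℝ) < T := by exact_mod_cast hT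
  have hT1 : (1 : ℝ) ≤ T := by exact_mod_cast hT
  have hd1 : (1 : ℝ) ≤ d := by exact_mod_cast hd
  have hβ0 : 0 < β := by linarith
  set X := x.1 ⬝ᵥ (bonusSeq p T *ᵥ x.1) with hX
  have hTmem : T ∈ Finset.Icc 1 T := Finset.mem_Icc.2 ⟨hT, le_rfl⟩
  have hX0 : 0 ≤ X := (isBonusStep_bonusSeq hp hTmem).posDef.posSemidef.quad_nonneg x.1
  -- The net point y has squared norm at most 2X + 2 in every round (`hy0`), and 2(2X + 2) + 2 = 4X
  -- + 6.
  set s := √(4 * X + 6) with hs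
  have hs2 : s ^ 2 = 4 * X + 6 := Real.sq_sqrt (by linarith)
  have hs0 : 0 ≤ s := Real.sqrt_nonneg _
  set l := 1 / (8 * β) with hl
  have hl0 : 0 < l := by positivity
  have hinvT : (1 / (T : ℝ)) ^ 2 ≤ 1 := by
    rw [div_pow, one_pow]
    exact div_le_one_of_le₀ (by nlinarith) (by positivity)
  have hy0 : ∀ t ∈ Finset.Icc 1 T, y.1 ⬝ᵥ ((secondMoment (p t))⁻¹ *ᵥ y.1) ≤ 2 * X + 2 := by
    intro t ht
    have hS := (hp t ht).secondMoment_posDef.inv.posSemidef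
    have h1 := quad_add_le hS x.1 (-(x.1 - y.1))
    rw [Matrix.mulVec_neg, neg_dotProduct_neg, show x.1 + -(x.1 - y.1) = y.1 by abel] at h1
    have h2 := quad_inv_le_bonusSeq hp ht x.1
    linarith [hxy t ht]
  have hcomp : ∑ t ∈ Finset.Icc 1 T, compensator (θ t) (ε t) (p t)
      (actionTerm l η y.1 (θ t) (p t)) (rewardTerm l y.1 (p t))
      ≤ l * (2 * η * d * T + C * s) + l ^ 2 * (52 * d * T + 8 * X * T + 8 * T) := by
    calc _ ≤ ∑ t ∈ Finset.Icc 1 T, (l * (2 * η * d) + l ^ 2 * (52 * d + 8 * X + 8)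
          + (l * s) * e t) := by
          refine Finset.sum_le_sum fun t ht => ?_
          have h1 := (hp t ht).compensator_le hl0.le hd hηβ (he t ht) (hθ t ht) (hε t ht) y hs0
            (by rw [hs2]; linarith [hy0 t ht])
          have h2 : l ^ 2 * (52 * d + 4 * (y.1 ⬝ᵥ ((secondMoment (p t))⁻¹ *ᵥ y.1)))
              ≤ l ^ 2 * (52 * d + 8 * X + 8) :=
            mul_le_mul_of_nonneg_left (by linarith [hy0 t ht]) (sq_nonneg l)
          linarith
      _ = T * (l * (2 * η * d) + l ^ 2 * (52 * d + 8 * X + 8))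
          + (l * s) * ∑ t ∈ Finset.Icc 1 T, e t := by
          rw [Finset.sum_add_distrib, ← Finset.mul_sum, Finset.sum_const, Nat.card_Icc,
            Nat.add_sub_cancel, nsmul_eq_mul]
      _ ≤ _ := by
          have := mul_le_mul_of_nonneg_left hC (mul_nonneg hl0.le hs0)
          linarith
  have hg := hgood y hy
  rw [Finset.sum_sub_distrib] at hg
  simp only [actionTerm_add_rewardTerm, ← Finset.mul_sum] at hg
  set D : A → ℝ := fun z => ∑ t ∈ Finset.Icc 1 T, ((z.1 - (a t).1) ⬝ᵥ θ t
        + 2 * η * ((a t).1 ⬝ᵥ ((secondMoment (p t))⁻¹ *ᵥ (a t).1))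
        - (z.1 - mean (p t)) ⬝ᵥ estimator (p t) (a t) (r t)) with hD
  have hDy : D y ≤ 8 * β * L + (2 * η * d * T + C * s)
      + (52 * d * T + 8 * X * T + 8 * T) / (8 * β) := by
    have h1 : l * D y ≤ l * (8 * β * L + (2 * η * d * T + C * s)
        + (52 * d * T + 8 * X * T + 8 * T) / (8 * β)) := by
      have e1 : l * (8 * β * L) = L := by rw [hl]; field_simp
      have e2 : (52 * d * T + 8 * X * T + 8 * T) / (8 * β)
          = l * (52 * d * T + 8 * X * T + 8 * T) := by rw [hl]; ring
      rw [e2, mul_add, mul_add, e1]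
      change l * D y - _ ≤ L at hg
      linarith
    exact le_of_mul_le_mul_left h1 hl0
  -- Net accuracy 1/T: each round loses at most (1 + β)/T.
  have hDxy : D x ≤ D y + (1 + β) := by
    calc D x ≤ ∑ t ∈ Finset.Icc 1 T, (((y.1 - (a t).1) ⬝ᵥ θ t
        + 2 * η * ((a t).1 ⬝ᵥ ((secondMoment (p t))⁻¹ *ᵥ (a t).1))
        - (y.1 - mean (p t)) ⬝ᵥ estimator (p t) (a t) (r t)) + 1 / T * (1 + β)) := by
          refine Finset.sum_le_sum fun t ht => ?_
          have h1 := (hp t ht).abs_inner_le_of_quad_inv_le (by positivity) (hxy t ht) (hθ t ht)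
          have h2 := (hp t ht).abs_inner_estimator_le_of_quad_inv_le (by positivity)
            (by linarith) (hxy t ht) (a t) (hr t ht)
          rw [sub_dotProduct] at h1 h2
          have h3 := (abs_le.1 h1).2
          have h4 := (abs_le.1 h2).1
          simp only [sub_dotProduct]
          linarith
      _ = D y + (1 + β) := by
          rw [Finset.sum_add_distrib, Finset.sum_const, Nat.card_Icc, nsmul_eq_mul, hD]
          simp only
          congr 1
          rw [Nat.add_sub_cancel]
          field_simp
  -- The bias is split by AM–GM so that X appears with coefficient α/4; `hlast` adds α/2, and the
  -- total 3/4 stays below the credit α.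
  have hCs : C * s ≤ α / 4 * X + 3 / 8 * α + 4 * C ^ 2 / α := by
    have h1 : C * s ≤ α * s ^ 2 / 16 + 4 * C ^ 2 / α := by
      have : α * s ^ 2 / 16 + 4 * C ^ 2 / α - C * s = (α * s - 8 * C) ^ 2 / (16 * α) := by
        field_simp; ring
      have : 0 ≤ (α * s - 8 * C) ^ 2 / (16 * α) := by positivity
      linarith
    rw [hs2] at h1
    linarith
  have hlast : (52 * d * T + 8 * X * T + 8 * T) / (8 * β)
      ≤ 7 * d * (T / β) + α / 2 * X + T / β := by
    have e1 : (52 * d * T + 8 * X * T + 8 * T) / (8 * β)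
        = 13 / 2 * (d * (T / β)) + T / β * X + T / β := by field_simp; ring
    have h1 : 0 ≤ d * (T / β) := by positivity
    have h2 := mul_le_mul_of_nonneg_right hTα hX0
    rw [e1]
    linarith
  change D x ≤ _
  linarith

/-- The regret against a distribution of the mixed simplex, on the good event. -/
theorem sum_mean_sub_le {q : A → ℝ} (hq : q ∈ stdSimplex ℝ A) {E F : ℝ} (hα : 0 ≤ α)
    (hpd : (bonusSeq p T).PosSemidef)
    (hdev : ∀ x : A, ∑ t ∈ Finset.Icc 1 T, ((x.1 - (a t).1) ⬝ᵥ θ t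
        + 2 * η * ((a t).1 ⬝ᵥ ((secondMoment (p t))⁻¹ *ᵥ (a t).1))
        - (x.1 - mean (p t)) ⬝ᵥ estimator (p t) (a t) (r t))
      ≤ 3 / 4 * α * (x.1 ⬝ᵥ (bonusSeq p T *ᵥ x.1)) + E)
    (hest : ∑ t ∈ Finset.Icc 1 T, (mean q - mean (p t)) ⬝ᵥ estimator (p t) (a t) (r t)
        + α * (secondMoment q * bonusSeq p T).trace
      ≤ F + ∑ t ∈ Finset.Icc 1 T,
        (2 * α * (secondMoment (p t) * (bonusSeq p t - bonusSeq p (t - 1))).trace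
          + 2 * η * ((a t).1 ⬝ᵥ ((secondMoment (p t))⁻¹ *ᵥ (a t).1)))) :
    ∑ t ∈ Finset.Icc 1 T, (mean q - (a t).1) ⬝ᵥ θ t
      ≤ E + F + 2 * α * ∑ t ∈ Finset.Icc 1 T,
        (secondMoment (p t) * (bonusSeq p t - bonusSeq p (t - 1))).trace := by
  -- Averaging over x drawn from q is legitimate because the deviation is affine in x; it turns
  -- xᵀB_T x into tr(Σ(q)B_T).
  have h1 : ∑ x : A, q x * (∑ t ∈ Finset.Icc 1 T, ((x.1 - (a t).1) ⬝ᵥ θ t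
        + 2 * η * ((a t).1 ⬝ᵥ ((secondMoment (p t))⁻¹ *ᵥ (a t).1))
        - (x.1 - mean (p t)) ⬝ᵥ estimator (p t) (a t) (r t)))
      ≤ 3 / 4 * α * (secondMoment q * bonusSeq p T).trace + E := by
    calc _ ≤ ∑ x : A, q x * (3 / 4 * α * (x.1 ⬝ᵥ (bonusSeq p T *ᵥ x.1)) + E) :=
          Finset.sum_le_sum fun x _ => mul_le_mul_of_nonneg_left (hdev x) (hq.1 x)
      _ = _ := by
          rw [trace_secondMoment_mul, Finset.mul_sum]
          simp only [mul_add, Finset.sum_add_distrib, ← Finset.sum_mul, hq.2, one_mul]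
          congr 1
          exact Finset.sum_congr rfl fun x _ => by ring
  have h2 : ∑ x : A, q x * (∑ t ∈ Finset.Icc 1 T, ((x.1 - (a t).1) ⬝ᵥ θ t
        + 2 * η * ((a t).1 ⬝ᵥ ((secondMoment (p t))⁻¹ *ᵥ (a t).1))
        - (x.1 - mean (p t)) ⬝ᵥ estimator (p t) (a t) (r t)))
      = ∑ t ∈ Finset.Icc 1 T, ((mean q - (a t).1) ⬝ᵥ θ t
        + 2 * η * ((a t).1 ⬝ᵥ ((secondMoment (p t))⁻¹ *ᵥ (a t).1))
        - (mean q - mean (p t)) ⬝ᵥ estimator (p t) (a t) (r t)) := by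
    simp only [Finset.mul_sum]
    rw [Finset.sum_comm]
    refine Finset.sum_congr rfl fun t _ => ?_
    simp only [sub_dotProduct, mul_add, mul_sub, Finset.sum_add_distrib, Finset.sum_sub_distrib,
      ← Finset.sum_mul, hq.2, one_mul, mean_dotProduct q]
  have h3 : 0 ≤ (secondMoment q * bonusSeq p T).trace := by
    rw [trace_secondMoment_mul]
    exact Finset.sum_nonneg fun x _ => mul_nonneg (hq.1 x) (hpd.quad_nonneg x.1)
  have h4 := mul_nonneg hα h3
  rw [h2] at h1
  simp only [Finset.sum_add_distrib, Finset.sum_sub_distrib, ← Finset.mul_sum] at h1 hest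
  linarith

end Pathwise

/-! ### Collecting constants. -/

section Numerics

theorem log_two_pow_le {T : ℕ} (hT : 2 ≤ T) : Real.log 2 ≤ Real.log T :=
  Real.log_le_log two_pos (by exact_mod_cast hT)

/-- Collecting the terms of the regret bound. -/
theorem collect_terms {d s l Lam η α C L : ℝ} (hd : 1 ≤ d) (hs : 1 ≤ s) (hl : Real.log 2 ≤ l)
    (hls : l = 2 * Real.log s) (hLam : l ≤ Lam) (hη : 0 < η) (hηl : η ^ 2 * s ^ 2 ≤ l)
    (hC : 0 ≤ C) (hα : α = max (C / √(d * l)) s) (hL : L ≤ 5 * d * Lam) :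
    (8 * (2 * s) * L + 2 * η * d * s ^ 2 + 7 * d * (s ^ 2 / (2 * s)) + 3 / 8 * α + 4 * C ^ 2 / α
        + s ^ 2 / (2 * s) + 1 + 2 * s) + (d + 1) * Real.log (2 * s) / η
        + 2 * α * (d + d * Real.log (s ^ 2 * (2 * s))) + 2 * d * s
      ≤ 3 * d * l / η + 110 * (d * s * Lam + C * √(d * l)) := by
  have hl2 : 0.69 < l := lt_of_lt_of_le (by linarith [Real.log_two_gt_d9]) hl
  have hl0 : 0 < l := by linarith
  have hs0 : 0 < s := by linarith
  have hd0 : 0 < d := by linarith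
  have hw0 : 0 < √(d * l) := Real.sqrt_pos.2 (by positivity)
  have hw2 : √(d * l) ^ 2 = d * l := Real.sq_sqrt (by positivity)
  set w := √(d * l)
  have hlog1 : Real.log (2 * s) ≤ 3 / 2 * l := by
    rw [Real.log_mul two_ne_zero hs0.ne']; linarith
  have hlog2 : Real.log (s ^ 2 * (2 * s)) ≤ 5 / 2 * l := by
    rw [Real.log_mul (by positivity) (by positivity), Real.log_mul two_ne_zero hs0.ne',
      Real.log_pow]
    push_cast
    linarith
  have hlog10 : 0 ≤ Real.log (2 * s) := Real.log_nonneg (by linarith)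
  have hαs : s ≤ α := hα ▸ le_max_right _ _
  have hαC : C / w ≤ α := hα ▸ le_max_left _ _
  have hα0 : 0 < α := by linarith
  have hαle : α ≤ C / w + s := by
    rw [hα]; exact max_le (by linarith) (by linarith [div_nonneg hC hw0.le])
  have hdsL : d * s ≤ 3 / 2 * (d * s * Lam) := by
    have : 0 < d * s := by positivity
    nlinarith
  have t1 : 8 * (2 * s) * L ≤ 80 * (d * s * Lam) := by
    have := mul_le_mul_of_nonneg_left hL (by positivity : 0 ≤ 8 * (2 * s))
    linarith
  have hηs : η * s ≤ 3 / 2 * Lam := by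
    refine abs_le_of_sq_le_sq' (a := η * s) ?_ (by linarith) |>.2
    nlinarith
  have t2 : 2 * η * d * s ^ 2 ≤ 3 * (d * s * Lam) := by
    have := mul_le_mul_of_nonneg_left hηs (by positivity : 0 ≤ 2 * (d * s))
    linarith
  have e3 : s ^ 2 / (2 * s) = s / 2 := by field_simp
  have hsd : s ≤ d * s := by nlinarith
  -- This term keeps its η: it is the one whose final size differs between the two options.
  have t4 : (d + 1) * Real.log (2 * s) / η ≤ 3 * d * l / η := by
    refine div_le_div_of_nonneg_right ?_ hη.le
    nlinarith
  -- The choice of α: when C/√(dl) is the larger entry, both αdl and C²/α equal C√(dl).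
  have hαdl : α * (d * l) ≤ C * w + d * s * Lam := by
    have h1 : C / w * (d * l) = C * w := by
      rw [← hw2]; field_simp
    have h2 := mul_le_mul_of_nonneg_right hαle (by positivity : 0 ≤ d * l)
    have h3 : s * (d * l) ≤ d * s * Lam := by
      have := mul_le_mul_of_nonneg_left hLam (by positivity : 0 ≤ d * s)
      linarith
    linarith
  have t5 : 2 * α * (d + d * Real.log (s ^ 2 * (2 * s))) ≤ 8 * (α * (d * l)) := by
    have h1 : d + d * Real.log (s ^ 2 * (2 * s)) ≤ 4 * (d * l) := by nlinarith
    have := mul_le_mul_of_nonneg_left h1 (by positivity : 0 ≤ 2 * α)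
    linarith
  have t6 : 3 / 8 * α ≤ α * (d * l) := by nlinarith [mul_le_mul hd hl2.le (by norm_num) hd0.le]
  have t7 : 4 * C ^ 2 / α ≤ 4 * (C * w) := by
    rw [div_le_iff₀ hα0]
    rw [div_le_iff₀ hw0] at hαC
    nlinarith
  have hCw : 0 ≤ C * w := by positivity
  rw [e3]
  linarith

end Numerics

/-! ### The common high-probability bound. -/

section Main

variable {d T : ℕ} {A : Finset (Fin d → ℝ)}

theorem abs_mean_dotProduct_le {q : A → ℝ} (hq : q ∈ stdSimplex ℝ A) {θ : Fin d → ℝ}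
    (hθ : ∀ b : A, |b.1 ⬝ᵥ θ| ≤ 1) : |mean q ⬝ᵥ θ| ≤ 1 := by
  rw [mean_dotProduct]
  refine (Finset.abs_sum_le_sum_abs _ _).trans ?_
  rw [← hq.2]
  refine Finset.sum_le_sum fun b _ => ?_
  rw [abs_mul, abs_of_nonneg (hq.1 b)]
  exact mul_le_of_le_one_right (hq.1 b) (hθ b)

theorem regret_le_two_mul {θ : ℕ → Fin d → ℝ} {a : ℕ → A} {q : A → ℝ} (hq : q ∈ stdSimplex ℝ A)
    (hθ : ∀ t ∈ Finset.Icc 1 T, ∀ b : A, |b.1 ⬝ᵥ θ t| ≤ 1) : regret T θ a q ≤ 2 * T := by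
  calc regret T θ a q ≤ ∑ t ∈ Finset.Icc 1 T, (2 : ℝ) := by
        refine Finset.sum_le_sum fun t ht => ?_
        rw [sub_dotProduct]
        linarith [(abs_le.1 (abs_mean_dotProduct_le hq (hθ t ht))).2,
          (abs_le.1 (hθ t ht (a t))).1]
    _ = 2 * T := by simp [mul_comm]

theorem regret_le_mixed {θ : ℕ → Fin d → ℝ} {a : ℕ → A} {q ρ : A → ℝ} (hq : q ∈ stdSimplex ℝ A)
    (hρ : ρ ∈ stdSimplex ℝ A) {γ : ℝ} (hγ : 0 ≤ γ)
    (hθ : ∀ t ∈ Finset.Icc 1 T, ∀ b : A, |b.1 ⬝ᵥ θ t| ≤ 1) :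
    regret T θ a q ≤ ∑ t ∈ Finset.Icc 1 T, (mean ((1 - γ) • q + γ • ρ) - (a t).1) ⬝ᵥ θ t
      + 2 * γ * T := by
  have hmean : mean ((1 - γ) • q + γ • ρ) = (1 - γ) • mean q + γ • mean ρ := by
    simp only [mean, Finset.smul_sum, ← Finset.sum_add_distrib, Pi.add_apply, Pi.smul_apply,
      smul_eq_mul, smul_smul, add_smul]
  calc regret T θ a q ≤ ∑ t ∈ Finset.Icc 1 T,
        ((mean ((1 - γ) • q + γ • ρ) - (a t).1) ⬝ᵥ θ t + 2 * γ) := by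
        refine Finset.sum_le_sum fun t ht => ?_
        rw [hmean]
        simp only [sub_dotProduct, add_dotProduct, smul_dotProduct, smul_eq_mul]
        have h1 := (abs_le.1 (abs_mean_dotProduct_le hq (hθ t ht))).2
        have h2 := (abs_le.1 (abs_mean_dotProduct_le hρ (hθ t ht))).1
        nlinarith
    _ = _ := by
        rw [Finset.sum_add_distrib, Finset.sum_const, Nat.card_Icc, Nat.add_sub_cancel,
          nsmul_eq_mul]
        ring

theorem log_le_sqrt {x : ℝ} (hx : 0 < x) : Real.log x ≤ √x := by
  have h1 : Real.log x = 2 * Real.log √x := by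
    rw [Real.log_sqrt hx.le]; ring
  have h2 : Real.log √x ≤ √x / 2 := by
    have h := Real.log_le_sub_one_of_pos (x := √x / 2) (by positivity)
    rw [Real.log_div (Real.sqrt_pos.2 hx).ne' two_ne_zero] at h
    linarith [Real.log_two_lt_d9]
  linarith

/-- Mixing divides John's constant d + 1 by γ, and d + 1 ≤ 2d makes β = 2√T independent of d. -/
theorem mixRate_mem (hd : 1 ≤ d) (hT : 2 ≤ T) (hdT : d ^ 2 ≤ T) :
    0 < mixRate d T ∧ mixRate d T ≤ 1 ∧ (d + 1) / mixRate d T ≤ 2 * √(T : ℝ) ∧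
      mixRate d T * T = d * √(T : ℝ) := by
  have hd1 : (1 : ℝ) ≤ d := by exact_mod_cast hd
  have hs0 : 0 < √(T : ℝ) := Real.sqrt_pos.2 (by exact_mod_cast (by omega : 0 < T))
  have hs2 : √(T : ℝ) ^ 2 = T := Real.sq_sqrt (by positivity)
  have hds : (d : ℝ) ≤ √(T : ℝ) := Real.le_sqrt_of_sq_le (by exact_mod_cast hdT)
  refine ⟨by unfold mixRate; positivity, (div_le_one hs0).2 hds, ?_, ?_⟩
  · rw [mixRate, div_div_eq_mul_div, div_le_iff₀ (by linarith)]
    nlinarith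
  · rw [mixRate]; nth_rw 2 [← hs2]; field_simp

theorem IsJohnExploration.isSpread_mixed (hd : 1 ≤ d) (hT : 2 ≤ T) (hdT : d ^ 2 ≤ T) {ρ : A → ℝ}
    (hρ : IsJohnExploration A ρ) {q : A → ℝ} (hq : q ∈ mixedSimplex (mixRate d T) ρ) :
    IsSpread (2 * √(T : ℝ)) q := by
  obtain ⟨h1, h2, h3, -⟩ := mixRate_mem hd hT hdT
  exact ((hρ.isSpread hd).of_mem_mixedSimplex h1 h2 (by positivity) hq).mono h3

theorem log_card_div_le (hd : 1 ≤ d) (hT : 2 ≤ T) {n : ℕ} (hn : 0 < n)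
    (hn' : n ≤ (2 * (2 * T ^ 2) + 1) ^ d) {δ : ℝ} (hδ : 0 < δ) (hδ1 : δ < 1) :
    Real.log (n / δ) ≤ 5 * d * Real.log (T / δ) := by
  have hT0 : (0 : ℝ) < T := by exact_mod_cast (by omega : 0 < T)
  -- 4T² + 1 ≤ T⁵ for T ≥ 2.
  have h1 : n ≤ T ^ (5 * d) := by
    refine hn'.trans ?_
    rw [pow_mul]
    refine Nat.pow_le_pow_left ?_ d
    have : T ^ 5 = T ^ 2 * T ^ 3 := by ring
    have h3 : 2 ^ 3 ≤ T ^ 3 := Nat.pow_le_pow_left hT 3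
    have h2 : 2 ^ 2 ≤ T ^ 2 := Nat.pow_le_pow_left hT 2
    nlinarith
  have h2 : Real.log n ≤ 5 * d * Real.log T := by
    have := Real.log_le_log (by exact_mod_cast hn) (show (n : ℝ) ≤ (T : ℝ) ^ (5 * d) by
      exact_mod_cast h1)
    rw [Real.log_pow] at this
    push_cast at this
    exact this
  have h3 : Real.log δ ≤ 0 := Real.log_nonpos hδ.le hδ1.le
  have hd1 : (1 : ℝ) ≤ d := by exact_mod_cast hd
  have hn0 : (n : ℝ) ≠ 0 := by exact_mod_cast hn.ne'
  rw [Real.log_div hn0 hδ.ne', Real.log_div hT0.ne' hδ.ne']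
  nlinarith

/-- A high-probability regret bound, given the pathwise bound on the estimated regret. -/
theorem le_measureReal_regret_le {Ω : Type*} [mΩ : MeasurableSpace Ω] {P : Measure Ω}
    [IsProbabilityMeasure P] {ℱ : Filtration ℕ mΩ} {C η δ : ℝ} {ρ : A → ℝ}
    {θ : ℕ → Ω → Fin d → ℝ} {ε p : ℕ → Ω → A → ℝ} {a : ℕ → Ω → A} {r : ℕ → Ω → ℝ}
    (hd : 1 ≤ d) (hT : 2 ≤ T) (hdT : d ^ 2 ≤ T) (hρ : IsJohnExploration A ρ) (hC : 0 ≤ C)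
    (hδ : 0 < δ) (hδ1 : δ < 1) (hb : IsMisspecifiedBandit P ℱ T C θ ε p a r)
    (hη : 0 < η) (hηT : η ^ 2 * T ≤ Real.log T)
    (hmem : ∀ ω, ∀ t ∈ Finset.Icc 1 T, p t ω ∈ mixedSimplex (mixRate d T) ρ)
    (hest : ∀ ω, ∀ q ∈ mixedSimplex (mixRate d T) ρ,
      ∑ t ∈ Finset.Icc 1 T, (mean q - mean (p t ω)) ⬝ᵥ estimator (p t ω) (a t ω) (r t ω)
        + bonusRate d T C * (secondMoment q * bonusSeq (fun t => p t ω) T).trace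
      ≤ (d + 1) * Real.log (2 * √(T : ℝ)) / η + ∑ t ∈ Finset.Icc 1 T,
        (2 * bonusRate d T C * (secondMoment (p t ω) * (bonusSeq (fun t => p t ω) t
            - bonusSeq (fun t => p t ω) (t - 1))).trace
          + 2 * η * ((a t ω).1 ⬝ᵥ ((secondMoment (p t ω))⁻¹ *ᵥ (a t ω).1)))) :
    1 - δ ≤ P.real {ω | ∀ pstar ∈ stdSimplex ℝ A,
      regret T (fun t => θ t ω) (fun t => a t ω) pstar ≤ 3 * d * Real.log T / η
        + 110 * (d * √(T : ℝ) * Real.log (T / δ) + C * √(d * Real.log T))} := by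
  classical
  obtain ⟨hγ0, hγ1, -, hγT⟩ := mixRate_mem hd hT hdT
  have hsp : ∀ q ∈ mixedSimplex (mixRate d T) ρ, IsSpread (2 * √(T : ℝ)) q :=
    fun q hq => hρ.isSpread_mixed hd hT hdT hq
  have hρs : ρ ∈ stdSimplex ℝ A := hρ.1
  have hρm : ρ ∈ mixedSimplex (mixRate d T) ρ := ⟨ρ, hρs, by module⟩
  set s := √(T : ℝ) with hs
  set l := Real.log T with hl
  have hT0 : (0 : ℝ) < T := by exact_mod_cast (by omega : 0 < T)
  have hT2 : (2 : ℝ) ≤ T := by exact_mod_cast hT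
  have hs2 : s ^ 2 = T := Real.sq_sqrt hT0.le
  have hs0 : 0 < s := Real.sqrt_pos.2 hT0
  have hs1 : 1 ≤ s := Real.one_le_sqrt.2 (by linarith)
  have hd1 : (1 : ℝ) ≤ d := by exact_mod_cast hd
  have hls : l = 2 * Real.log s := by rw [hs, Real.log_sqrt hT0.le]; ring
  have hlsq : l ≤ s := log_le_sqrt hT0
  have hsT : s ≤ T := by nlinarith
  -- From η²T ≤ log T ≤ √T.
  have hηs : η ^ 2 * s ≤ 1 := by
    have : η ^ 2 * s * s ≤ 1 * s := by nlinarith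
    exact le_of_mul_le_mul_right this hs0
  have hη1 : η ≤ 1 := by nlinarith
  set β := 2 * s with hβ
  have hβ2 : 2 ≤ β := by linarith
  have hβ0 : 0 < β := by linarith
  set α := bonusRate d T C with hα
  have hαs : s ≤ α := le_max_right _ _
  have hα0 : 0 < α := by linarith
  -- The net must be chosen before the randomness, so it is built in the deterministic norm of
  -- Σ(ρ)⁻¹. Passing to Σ(p_t)⁻¹ costs a factor β, and m = 2T² gives β·dβ/m² = d/T³ ≤ 1/T².
  obtain ⟨N, hNcard, hNnet⟩ := (hsp ρ hρm).exists_net (m := 2 * T ^ 2)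
    (Nat.one_le_iff_ne_zero.2 (by positivity))
  have hAne : Nonempty A := by
    by_contra h
    rw [not_nonempty_iff] at h
    have := hρs.2
    rw [Finset.univ_eq_empty, Finset.sum_empty] at this
    exact zero_ne_one this
  have hNne : Nonempty N := by
    obtain ⟨x⟩ := hAne
    obtain ⟨y, hy, -⟩ := hNnet x
    exact ⟨⟨y, hy⟩⟩
  have hps : ∀ ω, ∀ t ∈ Finset.Icc 1 T, IsSpread β (p t ω) := fun ω t ht => hsp _ (hmem ω t ht)
  have hNt : ∀ ω, ∀ x : A, ∃ y ∈ N, ∀ t ∈ Finset.Icc 1 T,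
      (x.1 - y.1) ⬝ᵥ ((secondMoment (p t ω))⁻¹ *ᵥ (x.1 - y.1)) ≤ (1 / (T : ℝ)) ^ 2 := by
    intro ω x
    obtain ⟨y, hy, hxy⟩ := hNnet x
    refine ⟨y, hy, fun t ht => ?_⟩
    have h1 := quad_inv_le (hsp ρ hρm).secondMoment_posDef (hps ω t ht).secondMoment_posDef
      (fun v => (hps ω t ht).quad_secondMoment_le hρs v) (x.1 - y.1)
    refine h1.trans ((mul_le_mul_of_nonneg_left hxy hβ0.le).trans ?_)
    have hdT' : (d : ℝ) ≤ T := by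
      have : d ≤ T := (Nat.le_self_pow two_ne_zero d).trans hdT
      exact_mod_cast this
    push_cast
    have e1 : β * (d * β / (2 * (T : ℝ) ^ 2) ^ 2) = d / T * (1 / T ^ 2) := by
      rw [hβ, show 2 * s * (d * (2 * s) / (2 * (T : ℝ) ^ 2) ^ 2)
        = 4 * s ^ 2 * d / (2 * (T : ℝ) ^ 2) ^ 2 by ring, hs2]
      field_simp
      norm_num
    rw [e1, div_pow, one_pow]
    exact mul_le_of_le_one_left (by positivity) ((div_le_one hT0).2 hdT')
  have hθ : ∀ ω, ∀ t ∈ Finset.Icc 1 T, ∀ b : A, |b.1 ⬝ᵥ θ t ω| ≤ 1 := fun ω t ht b =>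
    hb.abs_inner_le t ht ω b.1 b.2
  have hpm : ∀ t ∈ Finset.Icc 1 T, ∀ {f : (A → ℝ) → ℝ}, Measurable f →
      Measurable[ℱ (t - 1)] fun ω => f (p t ω) := fun t ht f hf =>
    hf.comp (hb.measurable_dist t ht)
  have hmain := hb.le_measureReal_forall_sum_le (κ := N) (T := T)
    (fun t ht ω => (hps ω t ht).mem)
    (g := fun y t ω => actionTerm (1 / (8 * β)) η y.1.1 (θ t ω) (p t ω))
    (h := fun y t ω => rewardTerm (1 / (8 * β)) y.1.1 (p t ω))
    (fun y t ht x => ((hb.measurable_inner ht _).add ((hpm t ht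
      (measurable_inner_inv_secondMoment measurable_const x.1)).const_mul _)).const_mul _)
    (fun y t ht x => ((hpm t ht (measurable_inner_inv_secondMoment
      (measurable_const.sub measurable_mean) x.1)).const_mul _).neg)
    (fun y t ht ω x => (hps ω t ht).abs_actionTerm_add_le (by positivity) hη.le hη1 hβ2
      (by rw [mul_one_div, div_self (by positivity)]) (hθ ω t ht) y.1 x) hδ
  refine hmain.trans (measureReal_mono fun ω hω => ?_)
  intro q hq
  have hω' : ∀ i : N, _ := hω
  -- Here α ≥ √T is needed: T/β = √T/2.
  have hTα : (T : ℝ) / β ≤ α / 2 := by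
    rw [hβ, ← hs2, div_le_iff₀ (by linarith)]
    nlinarith
  have hεle : ∀ t ∈ Finset.Icc 1 T, ∀ b, |ε t ω b| ≤ ⨆ x : A, |ε t ω x| := fun t ht b =>
    le_ciSup (Set.finite_range fun x : A => |ε t ω x|).bddAbove b
  have hdev := sum_deviation_le (C := C) (e := fun t => ⨆ x : A, |ε t ω x|) hd (by omega) hβ2
    (by rw [hβ]; linarith) hα0 hTα (hps ω) (hθ ω)
    (fun t ht => hb.abs_reward_le t ht ω) (fun t _ => Real.iSup_nonneg fun _ => abs_nonneg _) hεle
    (hb.misspecification_le ω) (hNt ω) (fun y hy => hω' ⟨y, hy⟩)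
  set q' := (1 - mixRate d T) • q + mixRate d T • ρ with hq'
  have hqm : q' ∈ mixedSimplex (mixRate d T) ρ := ⟨q, hq, rfl⟩
  have hTmem : T ∈ Finset.Icc 1 T := Finset.mem_Icc.2 ⟨by omega, le_rfl⟩
  have hreg := sum_mean_sub_le (mixedSimplex_subset hγ0.le hγ1 hρs hqm) hα0.le
    (isBonusStep_bonusSeq (hps ω) hTmem).posDef.posSemidef hdev (hest ω q' hqm)
  have hbon := sum_trace_bonus_le (hps ω) (by omega) hβ0
  have hbon' := mul_le_mul_of_nonneg_left hbon (by linarith : 0 ≤ 2 * α)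
  have hfinal := regret_le_mixed (a := fun t => a t ω) hq hρs hγ0.le (hθ ω)
  have hnum := collect_terms (d := d) (s := s) (l := l) (Lam := Real.log (T / δ)) (η := η)
    (α := α) (C := C) (L := Real.log (Fintype.card N / δ)) hd1 hs1 (log_two_pow_le hT) hls
    (Real.log_le_log hT0 ((le_div_iff₀ hδ).2 (by nlinarith))) hη (by rw [hs2]; exact hηT) hC rfl
    (by
      refine log_card_div_le hd hT Fintype.card_pos ?_ hδ hδ1
      rw [Fintype.card_coe]; exact hNcard)
  rw [hs2] at hnum
  have e2 : 2 * mixRate d T * T = 2 * d * s := by rw [mul_assoc, hγT]; ring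
  rw [e2] at hfinal
  linarith

end Main

/-! ### The two algorithms. -/

section Algorithms

variable {d T : ℕ} {A : Finset (Fin d → ℝ)} {Ω : Type*} [mΩ : MeasurableSpace Ω] {P : Measure Ω}
  [IsProbabilityMeasure P] {ℱ : Filtration ℕ mΩ} {C δ : ℝ} {ρ : A → ℝ}
  {θ : ℕ → Ω → Fin d → ℝ} {ε p : ℕ → Ω → A → ℝ} {a : ℕ → Ω → A} {r : ℕ → Ω → ℝ}

theorem fixedPoint_regret_le (hd : 1 ≤ d) (hT : 2 ≤ T) (hdT : d ^ 2 ≤ T)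
    (hρ : IsJohnExploration A ρ) (hC : 0 ≤ C) (hδ : 0 < δ) (hδ1 : δ < 1)
    (hb : IsMisspecifiedBandit P ℱ T C θ ε p a r)
    (hF : ∀ ω, FollowsFixedPointFTRL T (mixRate d T) (bonusRate d T C) (learningRate T) ρ
      (fun t => p t ω) (fun t => a t ω) (fun t => r t ω)) :
    1 - δ ≤ P.real {ω | ∀ pstar ∈ stdSimplex ℝ A,
      regret T (fun t => θ t ω) (fun t => a t ω) pstar ≤
        115 * (d * √(T : ℝ) * Real.log (T / δ) + C * √(d * Real.log T))} := by
  have hT0 : (0 : ℝ) < T := by exact_mod_cast (by omega : 0 < T)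
  have hs0 : 0 < √(T : ℝ) := Real.sqrt_pos.2 hT0
  have hs2 : √(T : ℝ) ^ 2 = T := Real.sq_sqrt hT0.le
  have hd1 : (1 : ℝ) ≤ d := by exact_mod_cast hd
  have hl : 0.69 < Real.log T :=
    lt_of_lt_of_le (by linarith [Real.log_two_gt_d9]) (log_two_pow_le hT)
  have hLam : Real.log T ≤ Real.log (T / δ) :=
    Real.log_le_log hT0 ((le_div_iff₀ hδ).2 (by nlinarith))
  have hCw : 0 ≤ C * √(d * Real.log T) := mul_nonneg hC (Real.sqrt_nonneg _)
  -- The stability condition η²β = 2 log T/√T ≤ 1/4 is √T ≥ 8 log T. Otherwise the trivial bound 2T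
  -- is already of the order √T·log T.
  by_cases hsmall : √(T : ℝ) < 8 * Real.log T
  · have huniv : {ω | ∀ pstar ∈ stdSimplex ℝ A,
        regret T (fun t => θ t ω) (fun t => a t ω) pstar ≤
          115 * (d * √(T : ℝ) * Real.log (T / δ) + C * √(d * Real.log T))} = Set.univ := by
      refine Set.eq_univ_of_forall fun ω q hq => ?_
      refine (regret_le_two_mul hq fun t ht b => hb.abs_inner_le t ht ω b.1 b.2).trans ?_
      have h1 : (T : ℝ) ≤ 8 * (√(T : ℝ) * Real.log (T / δ)) := by nlinarith
      have h2 : 0 ≤ √(T : ℝ) * Real.log (T / δ) := mul_nonneg hs0.le (by linarith)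
      nlinarith
    rw [huniv, probReal_univ]
    linarith
  · rw [not_lt] at hsmall
    have hη : 0 < learningRate T := Real.sqrt_pos.2 (div_pos (by linarith) hT0)
    have hη2 : learningRate T ^ 2 = Real.log T / T := Real.sq_sqrt (by positivity)
    have h := le_measureReal_regret_le hd hT hdT hρ hC hδ hδ1 hb hη
      (by rw [hη2, div_mul_cancel₀ _ hT0.ne']) (fun ω t ht => (hF ω t ht).1)
      (fun ω q hq => (hF ω).estimated_regret_le hη (hs0.le.trans (le_max_right _ _))
        (by positivity) (by
          rw [hη2]
          nth_rw 2 [← hs2]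
          rw [div_mul_eq_mul_div, div_le_iff₀ (by positivity)]
          nlinarith)
        (fun t ht => hb.abs_reward_le t ht ω)
        (fun q hq => hρ.isSpread_mixed hd hT hdT hq) hq)
    refine h.trans (measureReal_mono fun ω hω q hq => (hω q hq).trans ?_)
    have e : 3 * d * Real.log T / learningRate T = 3 * (d * √(T : ℝ) * √(Real.log T)) := by
      rw [div_eq_iff hη.ne', learningRate, Real.sqrt_div (by linarith)]
      have : √(Real.log T) * √(Real.log T) = Real.log T := Real.mul_self_sqrt (by linarith)
      field_simp
      rw [sq, this]
    have h3 : √(Real.log T) ≤ 3 / 2 * Real.log (T / δ) := by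
      refine (Real.sqrt_le_left (by linarith)).2 ?_
      nlinarith
    have h4 := mul_le_mul_of_nonneg_left h3 (by positivity : 0 ≤ d * √(T : ℝ))
    have h5 : 0 ≤ d * √(T : ℝ) * Real.log (T / δ) := mul_nonneg (by positivity) (by linarith)
    rw [e]
    linarith

theorem standard_regret_le (hd : 1 ≤ d) (hT : 2 ≤ T) (hdT : d ^ 2 ≤ T)
    (hρ : IsJohnExploration A ρ) (hC : 0 ≤ C) (hδ : 0 < δ) (hδ1 : δ < 1)
    (hb : IsMisspecifiedBandit P ℱ T C θ ε p a r)
    (hF : ∀ ω, FollowsStandardFTRL T (mixRate d T) (bonusRate d T C) (learningRateStandard T C) ρ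
      (fun t => p t ω) (fun t => a t ω) (fun t => r t ω)) :
    1 - δ ≤ P.real {ω | ∀ pstar ∈ stdSimplex ℝ A,
      regret T (fun t => θ t ω) (fun t => a t ω) pstar ≤
        160 * (d * √(T : ℝ) * Real.log (T / δ) + d * C * √(Real.log T))} := by
  have hT0 : (0 : ℝ) < T := by exact_mod_cast (by omega : 0 < T)
  have hT2 : (2 : ℝ) ≤ T := by exact_mod_cast hT
  have hs0 : 0 < √(T : ℝ) := Real.sqrt_pos.2 hT0
  have hs1 : 1 ≤ √(T : ℝ) := Real.one_le_sqrt.2 (by linarith)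
  have hs2 : √(T : ℝ) ^ 2 = T := Real.sq_sqrt hT0.le
  have hd1 : (1 : ℝ) ≤ d := by exact_mod_cast hd
  have hl : 0.69 < Real.log T :=
    lt_of_lt_of_le (by linarith [Real.log_two_gt_d9]) (log_two_pow_le hT)
  have hl0 : 0 < Real.log T := by linarith
  have hw0 : 0 < √(Real.log T) := Real.sqrt_pos.2 hl0
  have hw2 : √(Real.log T) ^ 2 = Real.log T := Real.sq_sqrt hl0.le
  have hLam : Real.log T ≤ Real.log (T / δ) :=
    Real.log_le_log hT0 ((le_div_iff₀ hδ).2 (by nlinarith))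
  set m := max (C / √(Real.log T)) √(T : ℝ) with hm
  have hms : √(T : ℝ) ≤ m := le_max_right _ _
  have hm0 : 0 < m := by linarith
  have hηd : learningRateStandard T C = 1 / (16 * m) := rfl
  have hη : 0 < learningRateStandard T C := by rw [hηd]; positivity
  have hηs : learningRateStandard T C * √(T : ℝ) ≤ 1 / 16 := by
    rw [hηd, div_mul_eq_mul_div, div_le_div_iff₀ (by positivity) (by norm_num)]
    linarith
  have hηs0 : 0 ≤ learningRateStandard T C * √(T : ℝ) := by positivity
  have hη2 : learningRateStandard T C ^ 2 * T ≤ 1 / 256 := by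
    rw [← hs2, ← mul_pow]
    nlinarith
  -- With η = 1/(16m), this gives ηα ≤ 1/16, the stability condition for the bonus.
  have hα : bonusRate d T C ≤ m := by
    refine max_le_max ?_ le_rfl
    refine div_le_div_of_nonneg_left hC hw0 (Real.sqrt_le_sqrt ?_)
    nlinarith
  have h := le_measureReal_regret_le hd hT hdT hρ hC hδ hδ1 hb hη (by linarith)
    (fun ω t ht => (hF ω t ht).1)
    (fun ω q hq => (hF ω).estimated_regret_le hη (hs0.le.trans (le_max_right _ _))
      (by positivity) (by
        have : learningRateStandard T C ^ 2 * √(T : ℝ) ≤ learningRateStandard T C ^ 2 * T :=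
          mul_le_mul_of_nonneg_left (by nlinarith) (sq_nonneg _)
        linarith)
      (by
        refine (mul_le_mul_of_nonneg_left hα hη.le).trans ?_
        rw [hηd, div_mul_eq_mul_div, div_le_iff₀ (by positivity)]
        linarith)
      (fun t ht => hb.abs_reward_le t ht ω)
      (fun q hq => hρ.isSpread_mixed hd hT hdT hq) hq)
  refine h.trans (measureReal_mono fun ω hω q hq => (hω q hq).trans ?_)
  -- The source of the factor d in front of C: d·log T·(C/√(log T)) = dC√(log T).
  have e : 3 * d * Real.log T / learningRateStandard T C = 48 * (d * Real.log T * m) := by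
    rw [hηd]; field_simp; norm_num
  have hmle : m ≤ C / √(Real.log T) + √(T : ℝ) :=
    max_le (by linarith) (by linarith [div_nonneg hC hw0.le])
  have h1 : d * Real.log T * (C / √(Real.log T)) = d * C * √(Real.log T) := by
    nth_rw 1 [← hw2]; field_simp
  have h2 := mul_le_mul_of_nonneg_left hmle (by positivity : 0 ≤ d * Real.log T)
  have h3 : d * √(T : ℝ) * Real.log T ≤ d * √(T : ℝ) * Real.log (T / δ) :=
    mul_le_mul_of_nonneg_left hLam (by positivity)
  have h4 : C * √(d * Real.log T) ≤ d * C * √(Real.log T) := by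
    rw [Real.sqrt_mul (by positivity)]
    have : √(d : ℝ) ≤ d := Real.sqrt_le_self_iff.2 (Or.inr hd1)
    have := mul_le_mul_of_nonneg_right this (mul_nonneg hC hw0.le)
    linarith
  have h5 : 0 ≤ d * C * √(Real.log T) := by positivity
  have h6 : 0 ≤ d * √(T : ℝ) * Real.log (T / δ) := mul_nonneg (by positivity) (by linarith)
  rw [e]
  linarith

end Algorithms

end LogDetBandit

open LogDetBandit in
theorem mainTheorem1 :
    (∃ K : ℝ, 0 < K ∧
      ∀ (d T : ℕ), 1 ≤ d → 2 ≤ T → d ^ 2 ≤ T →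
      ∀ (A : Finset (Fin d → ℝ)) (ρ : A → ℝ), IsJohnExploration A ρ →
      ∀ (C δ : ℝ), 0 ≤ C → 0 < δ → δ < 1 →
      ∀ (Ω : Type*) (mΩ : MeasurableSpace Ω) (P : MeasureTheory.Measure Ω)
        (_ : MeasureTheory.IsProbabilityMeasure P) (ℱ : MeasureTheory.Filtration ℕ mΩ)
        (θ : ℕ → Ω → Fin d → ℝ) (ε : ℕ → Ω → A → ℝ)
        (p : ℕ → Ω → A → ℝ) (a : ℕ → Ω → A) (r : ℕ → Ω → ℝ),
        IsMisspecifiedBandit P ℱ T C θ ε p a r →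
        (∀ ω, FollowsFixedPointFTRL T (mixRate d T) (bonusRate d T C) (learningRate T) ρ
          (fun t => p t ω) (fun t => a t ω) (fun t => r t ω)) →
        1 - δ ≤ P.real {ω | ∀ pstar ∈ stdSimplex ℝ A,
          regret T (fun t => θ t ω) (fun t => a t ω) pstar ≤
            K * (d * √(T : ℝ) * Real.log (T / δ) + C * √(d * Real.log T))}) ∧
    (∃ K : ℝ, 0 < K ∧
      ∀ (d T : ℕ), 1 ≤ d → 2 ≤ T → d ^ 2 ≤ T →
      ∀ (A : Finset (Fin d → ℝ)) (ρ : A → ℝ), IsJohnExploration A ρ →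
      ∀ (C δ : ℝ), 0 ≤ C → 0 < δ → δ < 1 →
      ∀ (Ω : Type*) (mΩ : MeasurableSpace Ω) (P : MeasureTheory.Measure Ω)
        (_ : MeasureTheory.IsProbabilityMeasure P) (ℱ : MeasureTheory.Filtration ℕ mΩ)
        (θ : ℕ → Ω → Fin d → ℝ) (ε : ℕ → Ω → A → ℝ)
        (p : ℕ → Ω → A → ℝ) (a : ℕ → Ω → A) (r : ℕ → Ω → ℝ),
        IsMisspecifiedBandit P ℱ T C θ ε p a r →
        (∀ ω, FollowsStandardFTRL T (mixRate d T) (bonusRate d T C) (learningRateStandard T C) ρ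
          (fun t => p t ω) (fun t => a t ω) (fun t => r t ω)) →
        1 - δ ≤ P.real {ω | ∀ pstar ∈ stdSimplex ℝ A,
          regret T (fun t => θ t ω) (fun t => a t ω) pstar ≤
            K * (d * √(T : ℝ) * Real.log (T / δ) + d * C * √(Real.log T))}) := by
  refine ⟨⟨115, by norm_num, ?_⟩, ⟨160, by norm_num, ?_⟩⟩
  · intro d T hd hT hdT A ρ hρ C δ hC hδ hδ1 Ω mΩ P hP ℱ θ ε p a r hb hF
    exact fixedPoint_regret_le hd hT hdT hρ hC hδ hδ1 hb hF
  · intro d T hd hT hdT A ρ hρ C δ hC hδ hδ1 Ω mΩ P hP ℱ θ ε p a r hb hF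
    exact standard_regret_le hd hT hdT hρ hC hδ hδ1 hb hF
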